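/- **Conventions.** For integers $n\ge 1$ and $S\subseteq\{1,\dots,\lfloor n/2\rfloor\}$, the circulant graph $C_n(S)$ has vertices $0,1,\dots,n-1$, with $a\neq b$ adjacent if and only if $|a-b|\in S$ or $n-|a-b|\in S$. A finite graph is well-covered if all its minimal vertex covers have the same cardinality. ${\rm Ind}(G)$ is the simplicial complex of all independent sets of $G$ (including $\emptyset$). Fix any field $k$. Let $\Delta$ be a finite simplicial complex containing $\emptyset$. It is *pure* if all its facets have the same cardinality. For a face $F$, ${\rm link}_\Delta(F)=\{G\in\Delta : F\cap G=\emptyset,\ F\cup G\in\Delta\}$, and for a vertex $x$, ${\rm del}_\Delta(x)=\{G\in\Delta : x\notin G\}$. A pure complex $\Delta$ is - *vertex decomposable* if it is a simplex, or it has a vertex $x$ such that ${\rm link}_\Delta(x)$ and ${\rm del}_\Delta(x)$ are both (pure and) vertex decomposable; - *shellable* if its facets can be ordered $F_1,\dots,F_t$ so that for all $j<i$ there are $x\in F_i\setminus F_j$ and $l<i$ with $F_i\setminus F_l=\{x\}$; - *Cohen–Macaulay* (over $k$) if $\tilde H_i({\rm link}_\Delta(F);k)=0$ for all $F\in\Delta$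 and all $i<\dim{\rm link}_\Delta(F)$; - *Buchsbaum* (over $k$) if ${\rm link}_\Delta(x)$ is Cohen–Macaulay over $k$ for every vertex $x$ of $\Delta$. A graph $G$ is said to have one of these properties if ${\rm Ind}(G)$ has it. "$C_n(S)$ is the smallest circulant with a property" means: $C_n(S)$ has the property, every circulant with the property has at least $n$ vertices, and every circulant on $n$ vertices with the property is isomorphic to $C_n(S)$. **Theorem 6.1.** For every field $k$: 1. The graph $C_8(2)$ is disconnected and is the smallest well-covered circulant that is not Buchsbaum. The graph $C_{10}(1,4)$ is the smallest connected well-covered circulant that is not Buchsbaum. 2. The graph $C_4(1)$ is the smallest well-covered circulant that is Buchsbaum but not Cohen–Macaulay. 3. The graph $C_{16}(1,4,8)$ is the smallest well-covered circulant that is shellable but not vertex decomposable. -/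

import Mathlib

/-- The circulant graph `C_n(S)` on the vertices `0, 1, …, n - 1`: distinct `a` and `b` are adjacent
iff `|a - b| ∈ S` or `n - |a - b| ∈ S`. It is used for `n ≥ 1` and `S ⊆ {1, …, ⌊n/2⌋}`, where the
clause `a ≠ b` is automatic. -/
def circulant (n : ℕ) (S : Finset ℕ) : SimpleGraph (Fin n) where
  Adj a b := a ≠ b ∧
    (((a : ℤ) - (b : ℤ)).natAbs ∈ S ∨ n - ((a : ℤ) - (b : ℤ)).natAbs ∈ S)
  symm := ⟨fun a b h => ⟨h.1.symm, by
    have e : ((b : ℤ) - (a : ℤ)).natAbs = ((a : ℤ) - (b : ℤ)).natAbs := by omega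
    rw [e]
    exact h.2⟩⟩
  loopless := ⟨fun _ h => h.1 rfl⟩

/-- A (finite) graph is well-covered if all its minimal vertex covers have the same cardinality. -/
def IsWellCovered {V : Type*} (G : SimpleGraph V) : Prop :=
  ∀ C D : Set V, Minimal G.IsVertexCover C → Minimal G.IsVertexCover D → C.ncard = D.ncard

/-- A simplicial complex with vertices among the elements of `V`, in the convention in which the
empty set is always a face. Its vertices are the `x : V` with `{x}` a face. (Mathlib's
`PreAbstractSimplicialComplex` leaves the empty face out.) -/
structure SComplex (V : Type*) where
  /-- The faces, the empty one included. -/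
  faces : Set (Finset V)
  empty_mem : ∅ ∈ faces
  down_closed : ∀ {F G : Finset V}, F ∈ faces → G ⊆ F → G ∈ faces

namespace SComplex

section Combinatorics

variable {V : Type*}

/-- The facets are the inclusion-maximal faces. -/
def IsFacet (Δ : SComplex V) (F : Finset V) : Prop :=
  Maximal (fun G => G ∈ Δ.faces) F

/-- All facets have the same dimension. -/
def IsPure (Δ : SComplex V) : Prop :=
  ∀ F G : Finset V, Δ.IsFacet F → Δ.IsFacet G → F.card = G.card

/-- A simplex: there is a face that contains all faces (it is then the set of all vertices). -/
def IsSimplex (Δ : SComplex V) : Prop :=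
  ∃ F ∈ Δ.faces, ∀ G ∈ Δ.faces, G ⊆ F

/-- The dimension, `max (|F| - 1)` over the faces `F`; it is `-1` for the complex `{∅}`. -/
noncomputable def dim [Finite V] (Δ : SComplex V) : ℤ :=
  ((sSup (Finset.card '' Δ.faces) : ℕ) : ℤ) - 1

/-- The link of a face: all faces `G` with `F ∩ G = ∅` and `F ∪ G` a face. -/
def link [DecidableEq V] (Δ : SComplex V) (F : Finset V) (hF : F ∈ Δ.faces) : SComplex V where
  faces := {G | G ∈ Δ.faces ∧ F ∩ G = ∅ ∧ F ∪ G ∈ Δ.faces}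
  empty_mem := ⟨Δ.empty_mem, by simp, by simpa using hF⟩
  down_closed := by
    rintro G H ⟨h1, h2, h3⟩ hHG
    refine ⟨Δ.down_closed h1 hHG, ?_, Δ.down_closed h3 (Finset.union_subset_union_right hHG)⟩
    exact Finset.subset_empty.mp (h2 ▸ Finset.inter_subset_inter_left hHG)

/-- The deletion of the vertex `x`: all faces `G` with `{x} ⊈ G`. -/
def deletion (Δ : SComplex V) (x : V) : SComplex V where
  faces := {G | G ∈ Δ.faces ∧ ¬ {x} ⊆ G}
  empty_mem := ⟨Δ.empty_mem, by simp⟩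
  down_closed := fun h hHG => ⟨Δ.down_closed h.1 hHG, fun hx => h.2 (hx.trans hHG)⟩

/-- Vertex decomposability of pure complexes: a complex is vertex decomposable if it is pure and
is a simplex or has a vertex whose link and deletion are both vertex decomposable. -/
inductive IsVertexDecomposable [DecidableEq V] : SComplex V → Prop
  | simplex (Δ : SComplex V) (hΔ : Δ.IsSimplex) : IsVertexDecomposable Δ
  | shed (Δ : SComplex V) (hpure : Δ.IsPure) (x : V) (hx : {x} ∈ Δ.faces)
      (hlink : IsVertexDecomposable (Δ.link {x} hx))
      (hdel : IsVertexDecomposable (Δ.deletion x)) : IsVertexDecomposable Δ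

/-- Shellability of pure complexes: the facets can be listed without repetition as
`F₁, …, F_t` such that for all `j < i` there are `x ∈ F_i \ F_j` and `k < i` with
`F_i \ F_k = {x}`. -/
def IsShellable [DecidableEq V] (Δ : SComplex V) : Prop :=
  Δ.IsPure ∧ ∃ (t : ℕ) (F : Fin t → Finset V), Function.Injective F ∧
    (∀ G : Finset V, Δ.IsFacet G ↔ ∃ i, F i = G) ∧
    ∀ i j : Fin t, j < i → ∃ x ∈ F i \ F j, ∃ k < i, F i \ F k = {x}

end Combinatorics

section Homology

variable {V : Type*} [LinearOrder V] (k : Type*)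

/-- The simplicial boundary map on formal `k`-linear combinations of finite subsets of `V`,
`{v₀ < v₁ < ⋯ < v_i} ↦ ∑ j, (-1) ^ j • {v₀, …, v_i} \ {v_j}`, with `∅ ↦ 0`. The index `j` of a
vertex `v` of `F` is written as the number of elements of `F` below `v`. -/
noncomputable def boundary [CommRing k] : (Finset V →₀ k) →ₗ[k] (Finset V →₀ k) :=
  Finsupp.linearCombination k fun F : Finset V =>
    ∑ v ∈ F, Finsupp.single (F.erase v) ((-1 : k) ^ (F.filter (· < v)).card)

/-- The augmented chain group `C_i(Δ; k)`: combinations of the faces of dimension `i`. So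
`C_{-1}` is spanned by the empty face, and `C_i = 0` for `i < -1`. -/
noncomputable def chains [CommRing k] (Δ : SComplex V) (i : ℤ) : Submodule k (Finset V →₀ k) :=
  Finsupp.supported k k {F | F ∈ Δ.faces ∧ (F.card : ℤ) - 1 = i}

/-- The `i`-cycles of the augmented simplicial chain complex. -/
noncomputable def cycles [CommRing k] (Δ : SComplex V) (i : ℤ) : Submodule k (Finset V →₀ k) :=
  chains k Δ i ⊓ LinearMap.ker (boundary k)

/-- The `i`-boundaries of the augmented simplicial chain complex. -/
noncomputable def boundaries [CommRing k] (Δ : SComplex V) (i : ℤ) : Submodule k (Finset V →₀ k) :=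
  (chains k Δ (i + 1)).map (boundary k)

theorem boundary_boundary [CommRing k] (c : Finset V →₀ k) :
    boundary k (boundary k c) = 0 := by
  induction c using Finsupp.induction_linear with
  | zero => simp
  | add f g hf hg => simp [hf, hg]
  | single F a =>
    simp only [boundary, Finsupp.linearCombination_single, map_smul, map_sum, Finset.smul_sum]
    rw [Finset.sum_sigma']
    refine Finset.sum_involution (fun p _ => ⟨p.2, p.1⟩) ?_ ?_ ?_ ?_
    · rintro ⟨v, w⟩ h
      simp only [Finset.mem_sigma, Finset.mem_erase] at h
      obtain ⟨hv, hne, hw⟩ := h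
      have key : ∀ x y : V, x ∈ F → x < y →
          ((F.erase y).filter (· < x)).card = (F.filter (· < x)).card ∧
          ((F.erase x).filter (· < y)).card + 1 = (F.filter (· < y)).card := by
        intro x y hx hxy
        constructor
        · congr 1
          ext z
          simp only [Finset.mem_filter, Finset.mem_erase]
          exact ⟨fun h => ⟨h.1.2, h.2⟩, fun h => ⟨⟨(h.2.trans hxy).ne, h.1⟩, h.2⟩⟩
        · rw [Finset.filter_erase]
          exact Finset.card_erase_add_one (Finset.mem_filter.mpr ⟨hx, hxy⟩)
      rw [Finset.erase_right_comm (a := w) (b := v)]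
      simp only [Finsupp.smul_single, smul_eq_mul, ← Finsupp.single_add]
      rw [Finsupp.single_eq_zero]
      rcases lt_or_gt_of_ne hne with h | h
      · obtain ⟨h1, h2⟩ := key w v hw h
        rw [h1, ← h2]
        ring
      · obtain ⟨h1, h2⟩ := key v w hv h
        rw [h1, ← h2]
        ring
    · rintro ⟨v, w⟩ h _ he
      simp only [Finset.mem_sigma, Finset.mem_erase] at h
      exact h.2.1 (congrArg Sigma.fst he)
    · rintro ⟨v, w⟩ h
      simp only [Finset.mem_sigma, Finset.mem_erase] at h ⊢
      exact ⟨h.2.2, h.2.1.symm, h.1⟩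
    · rintro ⟨v, w⟩ _
      rfl

theorem boundaries_le_cycles [CommRing k] (Δ : SComplex V) (i : ℤ) :
    boundaries k Δ i ≤ cycles k Δ i := by
  rintro _ ⟨c, hc, rfl⟩
  refine ⟨?_, boundary_boundary k c⟩
  rw [boundary, Finsupp.linearCombination_apply]
  refine Submodule.sum_mem _ fun F hF => Submodule.smul_mem _ _ (Submodule.sum_mem _ fun v hv => ?_)
  obtain ⟨h1, h2⟩ := hc hF
  refine Finsupp.single_mem_supported k _ ⟨Δ.down_closed h1 (Finset.erase_subset _ _), ?_⟩
  have := Finset.card_erase_add_one hv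
  omega

/-- Vanishing of the reduced simplicial homology `H̃_i(Δ; k)`, the quotient of the `i`-cycles by
the `i`-boundaries: every `i`-cycle is an `i`-boundary. -/
def ReducedHomologyVanishes [CommRing k] (Δ : SComplex V) (i : ℤ) : Prop :=
  cycles k Δ i ≤ boundaries k Δ i

/-- Cohen-Macaulayness over `k` of pure complexes: `H̃_i(link F; k) = 0` for all faces `F` and all
`i < dim (link F)`. -/
def IsCohenMacaulay [Field k] [Finite V] (Δ : SComplex V) : Prop :=
  Δ.IsPure ∧ ∀ (F : Finset V) (hF : F ∈ Δ.faces) (i : ℤ),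
    i < (Δ.link F hF).dim → ReducedHomologyVanishes k (Δ.link F hF) i

/-- Buchsbaumness over `k` of pure complexes: the links of all vertices are Cohen-Macaulay. -/
def IsBuchsbaum [Field k] [Finite V] (Δ : SComplex V) : Prop :=
  Δ.IsPure ∧ ∀ (x : V) (hx : {x} ∈ Δ.faces), IsCohenMacaulay k (Δ.link {x} hx)

end Homology

end SComplex

/-- The independence complex of a graph: its faces are the (finite) independent sets. -/
def indComplex {V : Type*} (G : SimpleGraph V) : SComplex V where
  faces := {W | G.IsIndepSet (W : Set V)}
  empty_mem := by simp
  down_closed := fun h hHG => Set.Pairwise.mono (Finset.coe_subset.mpr hHG) h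

/-- `C_n(S)` is the smallest circulant graph with property `P`: it has the property, every circulant
graph with the property has at least `n` vertices, and those with exactly `n` vertices are
isomorphic to it. -/
def IsSmallestCirculant (P : ∀ m : ℕ, SimpleGraph (Fin m) → Prop) (n : ℕ) (S : Finset ℕ) : Prop :=
  (1 ≤ n ∧ S ⊆ Finset.Icc 1 (n / 2) ∧ P n (circulant n S)) ∧
    ∀ (m : ℕ) (T : Finset ℕ), 1 ≤ m → T ⊆ Finset.Icc 1 (m / 2) → P m (circulant m T) →
      n ≤ m ∧ (m = n → Nonempty (circulant m T ≃g circulant n S))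

/-! Complements of facets of the independence complex are the minimal vertex covers, so well-covered
means that this complex is pure. Every minimality claim then concerns finitely many circulants, on
at most 16 vertices. Each is settled by a certificate whose soundness is proved for arbitrary graphs
and which the kernel evaluates on bit masks.

The positive certificates are vertex decompositions. A vertex decomposable complex is Cohen–Macaulay
over every field: by induction, Mayer–Vietoris for a shedding vertex kills the homology of all links
below the top degree (`IsVertexDecomposable.reducedHomologyVanishes_link`). Buchsbaumness follows,
either from a decomposition of the whole complex or from decompositions of the vertex links.

The negative certificates are two facets of different sizes, a disconnected link of dimension at
least one, or a link of dimension at least two with a non-trivial 1-cocycle over `ℤ/2`. The last two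
exclude shellability (`IsShellable.eq_of_eq_on_edges`, `IsShellable.exists_coboundary`), by
inductions along the shelling that use no homology theory. Disconnectedness also refutes the
Cohen–Macaulay property over any field, which is why nothing depends on `k`: `C_4(1)` has a
disconnected complex, while `C_8(2)` and `C_10(1,4)` have edges whose links are two disjoint
segments.

For `C_16(1,4,8)` an explicit shelling is checked. It is not vertex decomposable, because the last
entry of the `h`-vector of a vertex decomposable complex is non-negative
(`IsVertexDecomposable.alternatingSum_nonneg`), whereas it is negative for each vertex deletion. The
certificates leave only a few exceptional step sets, and those on the same number of vertices are
related by multiplication by units of `ℤ/n`. -/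

namespace SComplex

/-! ### Facets, links and deletions of simplicial complexes. -/

section Basic

variable {V : Type*}

theorem eq_of_faces_eq {Δ Γ : SComplex V} (h : Δ.faces = Γ.faces) : Δ = Γ := by
  cases Δ; cases Γ; congr

theorem exists_isFacet_superset [Finite V] (Δ : SComplex V) {F : Finset V} (hF : F ∈ Δ.faces) :
    ∃ G, Δ.IsFacet G ∧ F ⊆ G := by
  obtain ⟨G, h1, h2⟩ := Set.Finite.exists_le_maximal (Set.toFinite Δ.faces) hF
  exact ⟨G, h2, h1⟩

/-- All facets have `d` elements. -/
def FacetsHaveCard (Δ : SComplex V) (d : ℕ) : Prop :=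
  ∀ F, Δ.IsFacet F → F.card = d

theorem FacetsHaveCard.isPure {Δ : SComplex V} {d : ℕ} (h : Δ.FacetsHaveCard d) : Δ.IsPure :=
  fun F G hF hG => (h F hF).trans (h G hG).symm

theorem IsPure.facetsHaveCard {Δ : SComplex V} (h : Δ.IsPure) {F : Finset V} (hF : Δ.IsFacet F) :
    Δ.FacetsHaveCard F.card :=
  fun _ hG => h _ _ hG hF

theorem IsPure.exists_facetsHaveCard [Finite V] {Δ : SComplex V} (h : Δ.IsPure) :
    ∃ d, Δ.FacetsHaveCard d := by
  obtain ⟨G, hG, -⟩ := Δ.exists_isFacet_superset Δ.empty_mem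
  exact ⟨_, h.facetsHaveCard hG⟩

theorem FacetsHaveCard.card_le [Finite V] {Δ : SComplex V} {d : ℕ} (h : Δ.FacetsHaveCard d)
    {F : Finset V} (hF : F ∈ Δ.faces) : F.card ≤ d := by
  obtain ⟨G, hG, hFG⟩ := Δ.exists_isFacet_superset hF
  exact (Finset.card_le_card hFG).trans (h G hG).le

theorem IsSimplex.isPure {Δ : SComplex V} (h : Δ.IsSimplex) : Δ.IsPure := by
  obtain ⟨F, hF, hmax⟩ := h
  have key : ∀ G, Δ.IsFacet G → G = F := fun G hG =>
    (hmax G hG.prop).antisymm (hG.le_of_ge hF (hmax G hG.prop))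
  intro G H hG hH
  rw [key G hG, key H hH]

theorem mem_deletion {Δ : SComplex V} {x : V} {G : Finset V} :
    G ∈ (Δ.deletion x).faces ↔ G ∈ Δ.faces ∧ x ∉ G := by
  simp [deletion]

theorem card_le_dim_add_one [Finite V] {Δ : SComplex V} {F : Finset V} (hF : F ∈ Δ.faces) :
    (F.card : ℤ) ≤ Δ.dim + 1 := by
  have := le_csSup (Set.toFinite (Finset.card '' Δ.faces)).bddAbove ⟨F, hF, rfl⟩
  rw [dim]
  omega

theorem exists_card_eq_dim_add_one [Finite V] (Δ : SComplex V) :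
    ∃ F ∈ Δ.faces, (F.card : ℤ) = Δ.dim + 1 := by
  obtain ⟨F, hF, h⟩ := Nat.sSup_mem (Set.Nonempty.image Finset.card ⟨∅, Δ.empty_mem⟩)
    (Set.toFinite (Finset.card '' Δ.faces)).bddAbove
  exact ⟨F, hF, by rw [dim, h]; omega⟩

theorem IsFacet.of_deletion {Δ : SComplex V} {x : V} {F : Finset V} (hF : Δ.IsFacet F)
    (hx : x ∉ F) : (Δ.deletion x).IsFacet F :=
  ⟨mem_deletion.mpr ⟨hF.prop, hx⟩, fun _ hG hle => hF.le_of_ge (mem_deletion.mp hG).1 hle⟩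

/-- Applied to the link of a face `F` that does not extend by `x`: there `x` is not a vertex. -/
theorem deletion_eq_self {Δ : SComplex V} {x : V} (hx : {x} ∉ Δ.faces) : Δ.deletion x = Δ := by
  apply eq_of_faces_eq
  ext H
  rw [mem_deletion]
  exact ⟨fun h => h.1, fun h => ⟨h, fun hxH =>
    hx (Δ.down_closed h (Finset.singleton_subset_iff.mpr hxH))⟩⟩

variable [DecidableEq V]

theorem IsVertexDecomposable.isPure {Δ : SComplex V} (h : Δ.IsVertexDecomposable) : Δ.IsPure := by
  cases h with
  | simplex _ h => exact h.isPure
  | shed _ h => exact h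

theorem mem_link_singleton {Δ : SComplex V} {x : V} {hx : {x} ∈ Δ.faces} {G : Finset V} :
    G ∈ (Δ.link {x} hx).faces ↔ x ∉ G ∧ insert x G ∈ Δ.faces := by
  simp only [link, Set.mem_ofPred_eq, ← Finset.disjoint_iff_inter_eq_empty,
    Finset.disjoint_singleton_left, ← Finset.insert_eq]
  exact ⟨fun h => h.2, fun h => ⟨Δ.down_closed h.2 (Finset.subset_insert _ _), h⟩⟩

theorem mem_link {Δ : SComplex V} {F : Finset V} {hF : F ∈ Δ.faces} {G : Finset V} :
    G ∈ (Δ.link F hF).faces ↔ Disjoint F G ∧ F ∪ G ∈ Δ.faces := by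
  simp only [link, Set.mem_ofPred_eq, ← Finset.disjoint_iff_inter_eq_empty]
  exact ⟨fun h => h.2, fun h => ⟨Δ.down_closed h.2 Finset.subset_union_right, h⟩⟩

theorem IsFacet.union_of_link {Δ : SComplex V} {F : Finset V} {hF : F ∈ Δ.faces} {G : Finset V}
    (hG : (Δ.link F hF).IsFacet G) : Δ.IsFacet (F ∪ G) := by
  have h := mem_link.mp hG.prop
  refine ⟨h.2, fun H hH hle => ?_⟩
  have hle : F ∪ G ⊆ H := hle
  have hFH : F ⊆ H := Finset.subset_union_left.trans hle
  have h1 : H \ F ∈ (Δ.link F hF).faces := by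
    rw [mem_link, Finset.union_sdiff_of_subset hFH]
    exact ⟨Finset.disjoint_sdiff, hH⟩
  have h2 : H \ F ⊆ G := hG.le_of_ge h1 fun v hv => Finset.mem_sdiff.mpr
    ⟨hle (Finset.mem_union_right _ hv), fun hvF => Finset.disjoint_left.mp h.1 hvF hv⟩
  intro v hv
  by_cases hvF : v ∈ F
  · exact Finset.mem_union_left _ hvF
  · exact Finset.mem_union_right _ (h2 (Finset.mem_sdiff.mpr ⟨hv, hvF⟩))

theorem FacetsHaveCard.link {Δ : SComplex V} {d : ℕ} (h : Δ.FacetsHaveCard d) {F : Finset V}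
    (hF : F ∈ Δ.faces) : (Δ.link F hF).FacetsHaveCard (d - F.card) := by
  intro G hG
  have h1 := h _ hG.union_of_link
  rw [Finset.card_union_of_disjoint (mem_link.mp hG.prop).1] at h1
  omega

theorem link_link {Δ : SComplex V} {F G : Finset V} (hF : F ∈ Δ.faces)
    (hG : G ∈ (Δ.link F hF).faces) :
    (Δ.link F hF).link G hG = Δ.link (F ∪ G) (mem_link.mp hG).2 := by
  apply eq_of_faces_eq
  ext H
  simp only [mem_link, Finset.disjoint_union_left, Finset.disjoint_union_right, Finset.union_assoc]
  have := (mem_link.mp hG).1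
  tauto

theorem link_congr {Δ : SComplex V} {F G : Finset V} (hF : F ∈ Δ.faces) (h : F = G) :
    Δ.link F hF = Δ.link G (h ▸ hF) := by
  subst h; rfl

/-- Lets a homology bound for links in the deletion serve as a bound for the deletion of a link, as
Mayer–Vietoris requires. -/
theorem deletion_link {Δ : SComplex V} {F : Finset V} {x : V} (hF : F ∈ Δ.faces) (hx : x ∉ F) :
    (Δ.link F hF).deletion x = (Δ.deletion x).link F (mem_deletion.mpr ⟨hF, hx⟩) := by
  apply eq_of_faces_eq
  ext H
  simp only [mem_link, mem_deletion, Finset.mem_union]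
  tauto

end Basic

/-! ### Linear maps on chains with restricted support. -/

section Chains

variable {V : Type*} {k : Type*} [CommRing k]

/-- Chains supported on `S` are spanned by the basis vectors indexed by `S`, so memberships, and
likewise the identities in `linearCombination_eqOn`, need testing only on those. -/
theorem linearCombination_mem {S : Set (Finset V)} {M : Submodule k (Finset V →₀ k)}
    {f : Finset V → (Finset V →₀ k)} (h : ∀ F ∈ S, f F ∈ M) {z : Finset V →₀ k}
    (hz : z ∈ Finsupp.supported k k S) : Finsupp.linearCombination k f z ∈ M := by
  rw [Finsupp.linearCombination_apply]
  exact Submodule.sum_mem _ fun F hF => Submodule.smul_mem _ _ (h F (hz hF))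

theorem linearCombination_eqOn {M : Type*} [AddCommGroup M] [Module k M] {S : Set (Finset V)}
    {f g : (Finset V →₀ k) →ₗ[k] M} (h : ∀ F ∈ S, f (Finsupp.single F 1) = g (Finsupp.single F 1))
    {z : Finset V →₀ k} (hz : z ∈ Finsupp.supported k k S) : f z = g z := by
  have e : z = z.sum fun F a => a • Finsupp.single F (1 : k) := by simp
  rw [e, map_finsuppSum, map_finsuppSum]
  refine Finset.sum_congr rfl fun F hF => ?_
  change f (z F • Finsupp.single F 1) = g (z F • Finsupp.single F 1)
  rw [map_smul, map_smul, h F (hz hF)]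

end Chains

/-! ### Cones, Mayer–Vietoris and the homology of vertex decomposable complexes. -/

section Homology

variable {V : Type*} [LinearOrder V] (k : Type*) [CommRing k]

/-- Taking the cone with apex `x`, on chains; chains through `x` are sent to `0`. -/
noncomputable def coneMap (x : V) : (Finset V →₀ k) →ₗ[k] (Finset V →₀ k) :=
  Finsupp.linearCombination k fun F : Finset V =>
    if x ∈ F then 0 else Finsupp.single (insert x F) ((-1 : k) ^ (F.filter (· < x)).card)

/-- The chain of the link of `x` that a chain determines. -/
noncomputable def linkMap (x : V) : (Finset V →₀ k) →ₗ[k] (Finset V →₀ k) :=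
  Finsupp.linearCombination k fun F : Finset V =>
    if x ∈ F then Finsupp.single (F.erase x) ((-1 : k) ^ (F.filter (· < x)).card) else 0

theorem boundary_single (F : Finset V) (a : k) :
    boundary k (Finsupp.single F a) =
      a • ∑ v ∈ F, Finsupp.single (F.erase v) ((-1 : k) ^ (F.filter (· < v)).card) := by
  simp [boundary, Finsupp.linearCombination_single]

theorem coneMap_single (x : V) (F : Finset V) (a : k) :
    coneMap k x (Finsupp.single F a) = a •
      if x ∈ F then 0 else Finsupp.single (insert x F) ((-1 : k) ^ (F.filter (· < x)).card) := by
  simp [coneMap, Finsupp.linearCombination_single]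

theorem linkMap_single (x : V) (F : Finset V) (a : k) :
    linkMap k x (Finsupp.single F a) = a •
      if x ∈ F then Finsupp.single (F.erase x) ((-1 : k) ^ (F.filter (· < x)).card) else 0 := by
  simp [linkMap, Finsupp.linearCombination_single]

theorem neg_one_pow_mul_self (n : ℕ) : (-1 : k) ^ n * (-1) ^ n = 1 := by
  rw [← mul_pow]; simp

/-- The cone is a contracting homotopy on all finite subsets; its sign is the position of `x` in the
enlarged set. If `x ∈ F`, only the face without `x` contributes. If `x ∉ F`, the face of the cone
opposite `x` returns `F`, and the faces through `x` cancel. -/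
theorem boundary_coneMap_add (x : V) (z : Finset V →₀ k) :
    boundary k (coneMap k x z) + coneMap k x (boundary k z) = z := by
  induction z using Finsupp.induction_linear with
  | zero => simp
  | add f g hf hg =>
    simp only [map_add]
    nth_rewrite 3 [← hf]
    nth_rewrite 3 [← hg]
    abel
  | single F a =>
    rw [boundary_single, coneMap_single, map_smul, map_smul, ← smul_add, map_sum]
    simp only [coneMap_single]
    have ha : (Finsupp.single F a : Finset V →₀ k) = a • Finsupp.single F 1 := by simp
    rw [ha]
    congr 1
    by_cases hx : x ∈ F
    · rw [if_pos hx, map_zero, zero_add, Finset.sum_eq_single_of_mem x hx]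
      · have h1 : (F.erase x).filter (· < x) = F.filter (· < x) := by
          ext v
          simp only [Finset.mem_filter, Finset.mem_erase]
          exact ⟨fun h => ⟨h.1.2, h.2⟩, fun h => ⟨⟨h.2.ne, h.1⟩, h.2⟩⟩
        rw [if_neg (Finset.notMem_erase _ _), Finset.insert_erase hx, h1, Finsupp.smul_single,
          smul_eq_mul, neg_one_pow_mul_self]
      · intro v _ hvx
        rw [if_pos (Finset.mem_erase.mpr ⟨hvx.symm, hx⟩), smul_zero]
    · rw [if_neg hx, boundary_single, Finset.sum_insert hx, Finset.erase_insert hx]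
      have h1 : (insert x F).filter (· < x) = F.filter (· < x) := by
        rw [Finset.filter_insert, if_neg (lt_irrefl x)]
      rw [h1, smul_add, Finsupp.smul_single, smul_eq_mul, neg_one_pow_mul_self, add_assoc]
      convert add_zero _
      rw [Finset.smul_sum, ← Finset.sum_add_distrib]
      refine Finset.sum_eq_zero fun v hv => ?_
      have hvx : v ≠ x := fun h => hx (h ▸ hv)
      rw [if_neg (fun h => hx (Finset.mem_of_mem_erase h)), Finset.erase_insert_of_ne hvx.symm,
        Finsupp.smul_single, Finsupp.smul_single, smul_eq_mul, smul_eq_mul, ← Finsupp.single_add,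
        Finsupp.single_eq_zero]
      rw [Finset.filter_insert, Finset.filter_erase]
      -- The signs are opposite in either case: removing `v` below `x` lowers the position of `x` by
      -- one, and inserting `x` below `v` raises the position of `v` by one.
      rcases lt_or_gt_of_ne hvx with h | h
      · rw [if_neg h.not_gt, ← Finset.card_erase_add_one (Finset.mem_filter.mpr ⟨hv, h⟩)]
        ring
      · rw [if_pos h, Finset.card_insert_of_notMem (fun h => hx (Finset.mem_filter.mp h).1),
          Finset.erase_eq_of_notMem (fun h' => (Finset.mem_filter.mp h').2.not_gt h)]
        ring

variable {k}

variable (k) in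
/-- The chains that avoid the vertex `x`. -/
noncomputable def avoiding (x : V) : Submodule k (Finset V →₀ k) :=
  Finsupp.supported k k {F | x ∉ F}

theorem boundary_mem_avoiding {x : V} {z : Finset V →₀ k} (hz : z ∈ avoiding k x) :
    boundary k z ∈ avoiding k x := by
  refine linearCombination_mem (fun F hF => Submodule.sum_mem _ fun v _ => ?_) hz
  exact Finsupp.single_mem_supported k _ fun h => hF (Finset.mem_of_mem_erase h)

theorem linkMap_mem_avoiding (x : V) (z : Finset V →₀ k) : linkMap k x z ∈ avoiding k x := by
  refine linearCombination_mem (S := Set.univ) (fun F _ => ?_) (by simp)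
  split_ifs
  · exact Finsupp.single_mem_supported k _ (Finset.notMem_erase _ _)
  · exact zero_mem _

theorem linkMap_of_avoiding {x : V} {z : Finset V →₀ k} (hz : z ∈ avoiding k x) :
    linkMap k x z = 0 := by
  refine linearCombination_eqOn (g := 0) (fun F hF => ?_) hz
  rw [linkMap_single, if_neg hF]
  simp

theorem linkMap_coneMap {x : V} {z : Finset V →₀ k} (hz : z ∈ avoiding k x) :
    linkMap k x (coneMap k x z) = z := by
  refine linearCombination_eqOn (f := linkMap k x ∘ₗ coneMap k x) (g := LinearMap.id)
    (fun F hF => ?_) hz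
  have hF : x ∉ F := hF
  rw [LinearMap.comp_apply, coneMap_single, if_neg hF, one_smul, linkMap_single,
    if_pos (Finset.mem_insert_self _ _), Finset.erase_insert hF, Finset.filter_insert,
    if_neg (lt_irrefl x), Finsupp.smul_single, smul_eq_mul, neg_one_pow_mul_self, LinearMap.id_apply]

/-- The part of a chain carried by sets through `x` is the cone over its link part; the rest avoids
`x`. -/
theorem sub_coneMap_linkMap_mem (x : V) (z : Finset V →₀ k) :
    z - coneMap k x (linkMap k x z) ∈ avoiding k x := by
  induction z using Finsupp.induction_linear with
  | zero => simp
  | add f g hf hg =>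
    simp only [map_add]
    rw [add_sub_add_comm]
    exact add_mem hf hg
  | single F a =>
    rw [linkMap_single]
    split_ifs with h
    · have h1 : (F.erase x).filter (· < x) = F.filter (· < x) := by
        ext v
        simp only [Finset.mem_filter, Finset.mem_erase]
        exact ⟨fun h => ⟨h.1.2, h.2⟩, fun h => ⟨⟨h.2.ne, h.1⟩, h.2⟩⟩
      rw [map_smul, coneMap_single, if_neg (Finset.notMem_erase _ _), Finset.insert_erase h, h1,
        Finsupp.smul_single, smul_eq_mul, neg_one_pow_mul_self, Finsupp.smul_single, smul_eq_mul,
        mul_one, sub_self]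
      exact zero_mem _
    · rw [smul_zero, map_zero, sub_zero]
      exact Finsupp.single_mem_supported k _ h

theorem coneMap_mem_chains {Δ Γ : SComplex V} {x : V} (h : ∀ F ∈ Δ.faces, insert x F ∈ Γ.faces)
    {i : ℤ} {z : Finset V →₀ k} (hz : z ∈ chains k Δ i) : coneMap k x z ∈ chains k Γ (i + 1) := by
  refine linearCombination_mem (fun F hF => ?_) hz
  split_ifs with hx
  · exact zero_mem _
  · refine Finsupp.single_mem_supported k _ ⟨h F hF.1, ?_⟩
    rw [Finset.card_insert_of_notMem hx]
    have := hF.2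
    push_cast
    omega

/-- The contracting homotopy preserves the chains of a complex that is closed under adding `x`. -/
theorem reducedHomologyVanishes_of_cone {Δ : SComplex V} {x : V}
    (h : ∀ F ∈ Δ.faces, insert x F ∈ Δ.faces) (i : ℤ) : ReducedHomologyVanishes k Δ i := by
  rintro z ⟨hz, hz'⟩
  refine ⟨coneMap k x z, coneMap_mem_chains h hz, ?_⟩
  have h1 := boundary_coneMap_add k x z
  rwa [LinearMap.mem_ker.mp hz', map_zero, add_zero] at h1

theorem reducedHomologyVanishes_of_lt (Δ : SComplex V) {i : ℤ} (hi : i < -1) :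
    ReducedHomologyVanishes k Δ i := by
  rintro z ⟨hz, -⟩
  have : z = 0 := by
    rw [← Finsupp.support_eq_empty, Finset.eq_empty_iff_forall_notMem]
    intro F hF
    have := (hz hF).2
    omega
  rw [this]
  exact zero_mem _

/-- The part of the Mayer–Vietoris sequence for `Δ = deletion ∪ star` that is needed here. -/
theorem reducedHomologyVanishes_of_link_of_deletion {Δ : SComplex V} {x : V}
    (hx : {x} ∈ Δ.faces) {i : ℤ} (hl : ReducedHomologyVanishes k (Δ.link {x} hx) (i - 1))
    (hd : ReducedHomologyVanishes k (Δ.deletion x) i) : ReducedHomologyVanishes k Δ i := by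
  rintro z ⟨hz, hz'⟩
  have hz' : boundary k z = 0 := LinearMap.mem_ker.mp hz'
  have hlz : linkMap k x z ∈ chains k (Δ.link {x} hx) (i - 1) := by
    refine linearCombination_mem (fun F hF => ?_) hz
    split_ifs with h
    · refine Finsupp.single_mem_supported k _ ⟨mem_link_singleton.mpr ⟨Finset.notMem_erase _ _, ?_⟩, ?_⟩
      · rw [Finset.insert_erase h]
        exact hF.1
      · have h1 := Finset.card_erase_add_one h
        have h2 := hF.2
        omega
    · exact zero_mem _
  -- The part of `z` avoiding `x` has a boundary avoiding `x`. As `z` is a cycle, the boundary of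
  -- the cone over its link part avoids `x` too. That boundary is `linkMap k x z` minus the cone
  -- over `∂ (linkMap k x z)`, so its link part is, up to sign, the chain claimed to be zero.
  have hblz : boundary k (linkMap k x z) = 0 := by
    have h1 := boundary_mem_avoiding (sub_coneMap_linkMap_mem x z)
    have h2 := boundary_coneMap_add k x (linkMap k x z)
    have h3 := linkMap_of_avoiding h1
    rw [map_sub, hz', zero_sub, eq_sub_of_add_eq h2, map_neg, map_sub,
      linkMap_of_avoiding (linkMap_mem_avoiding x z),
      linkMap_coneMap (boundary_mem_avoiding (linkMap_mem_avoiding x z))] at h3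
    simpa using h3
  obtain ⟨c, hc, hc'⟩ := hl ⟨hlz, hblz⟩
  rw [sub_add_cancel] at hc
  have hca : c ∈ avoiding k x := fun F hF => (mem_link_singleton.mp (hc hF).1).1
  have hcone : coneMap k x c ∈ chains k Δ (i + 1) :=
    coneMap_mem_chains (fun F hF => (mem_link_singleton.mp hF).2) hc
  have hbc := boundary_coneMap_add k x c
  -- Adding this boundary cancels the link part of `z`, so `y` is a cycle homologous to `z` that
  -- lives in the deletion.
  set y := z + boundary k (coneMap k x c) with hy
  have hly : linkMap k x y = 0 := by
    rw [hy, map_add, eq_sub_of_add_eq hbc, map_sub, linkMap_of_avoiding hca,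
      linkMap_coneMap (boundary_mem_avoiding hca), hc']
    simp
  have hya : y ∈ avoiding k x := by
    have := sub_coneMap_linkMap_mem x y
    rwa [hly, map_zero, sub_zero] at this
  have hyΔ : y ∈ chains k Δ i :=
    add_mem hz (boundaries_le_cycles k Δ i ⟨_, hcone, rfl⟩).1
  have hyd : y ∈ cycles k (Δ.deletion x) i := by
    refine ⟨fun F hF => ⟨mem_deletion.mpr ⟨(hyΔ hF).1, hya hF⟩, (hyΔ hF).2⟩, ?_⟩
    rw [SetLike.mem_coe, LinearMap.mem_ker, hy, map_add, hz', boundary_boundary, add_zero]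
  obtain ⟨e, he, he'⟩ := hd hyd
  refine ⟨e - coneMap k x c, sub_mem (fun F hF => ⟨(mem_deletion.mp (he hF).1).1, (he hF).2⟩) hcone, ?_⟩
  rw [map_sub, he', hy, add_sub_cancel_right]

/-- Induction on the decomposition. Links of faces through the shedding vertex `x` are links inside
`link x`; for the other faces, Mayer–Vietoris combines the deletion of `x` with the link of the face
enlarged by `x`. The bound is phrased with the common facet size `d`, which passes to links and
deletions more readily than the dimension. No field is needed. -/
theorem IsVertexDecomposable.reducedHomologyVanishes_link [Finite V] {Δ : SComplex V}
    (h : Δ.IsVertexDecomposable) : ∀ {d : ℕ}, Δ.FacetsHaveCard d → ∀ (F : Finset V)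
      (hF : F ∈ Δ.faces) (i : ℤ), i < d - F.card - 1 →
      ReducedHomologyVanishes k (Δ.link F hF) i := by
  induction h with
  | simplex Δ hΔ =>
    intro d hd F hF i hi
    obtain ⟨M, hM, hmax⟩ := hΔ
    -- The link of the whole simplex has only the empty face and concerns degrees below `-1`; any
    -- other link is a cone over a vertex of `M` outside `F`.
    by_cases hFM : F = M
    · subst hFM
      have : F.card = d := hd F ⟨hF, fun G hG _ => hmax G hG⟩
      exact reducedHomologyVanishes_of_lt _ (by omega)
    · obtain ⟨x, hxM, hxF⟩ := Finset.exists_of_ssubset ((hmax F hF).ssubset_of_ne hFM)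
      refine reducedHomologyVanishes_of_cone (x := x) (fun G hG => ?_) i
      rw [mem_link] at hG ⊢
      refine ⟨Finset.disjoint_insert_right.mpr ⟨hxF, hG.1⟩, Δ.down_closed hM ?_⟩
      rw [Finset.union_insert]
      exact Finset.insert_subset hxM (hmax _ hG.2)
  | shed Δ hpure x hx hlink hdel ihl ihd =>
    intro d hd F hF i hi
    have hl := hd.link hx
    rw [Finset.card_singleton] at hl
    have hdpos : 1 ≤ d := by simpa using hd.card_le hx
    by_cases hxF : x ∈ F
    · have hF' : F.erase x ∈ (Δ.link {x} hx).faces :=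
        mem_link_singleton.mpr ⟨Finset.notMem_erase _ _, by rwa [Finset.insert_erase hxF]⟩
      have e : Δ.link F hF = (Δ.link {x} hx).link (F.erase x) hF' := by
        rw [link_link]
        apply link_congr
        rw [← Finset.insert_eq, Finset.insert_erase hxF]
      rw [e]
      refine ihl hl _ _ _ ?_
      have := Finset.card_erase_add_one hxF
      omega
    -- If `x` lies in all facets, the deletion loses a dimension and its bound would be one degree
    -- too weak, but then the link of `F` is a cone with apex `x`. Otherwise a facet avoiding `x`
    -- shows that the deletion still has facets of size `d`.
    · by_cases hcone : ∀ G, Δ.IsFacet G → x ∈ G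
      · refine reducedHomologyVanishes_of_cone (x := x) (fun G hG => ?_) i
        rw [mem_link] at hG ⊢
        obtain ⟨H, hH, hGH⟩ := Δ.exists_isFacet_superset hG.2
        refine ⟨Finset.disjoint_insert_right.mpr ⟨hxF, hG.1⟩, Δ.down_closed hH.prop ?_⟩
        rw [Finset.union_insert]
        exact Finset.insert_subset (hcone H hH) hGH
      · push Not at hcone
        obtain ⟨G, hG, hxG⟩ := hcone
        have hd' : (Δ.deletion x).FacetsHaveCard d := by
          rw [← hd G hG]
          exact hdel.isPure.facetsHaveCard (hG.of_deletion hxG)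
        have hv := ihd hd' F (mem_deletion.mpr ⟨hF, hxF⟩) i hi
        rw [← deletion_link hF hxF] at hv
        by_cases hxl : {x} ∈ (Δ.link F hF).faces
        · refine reducedHomologyVanishes_of_link_of_deletion hxl ?_ hv
          have hF' : F ∈ (Δ.link {x} hx).faces := mem_link_singleton.mpr
            ⟨hxF, by have := (mem_link.mp hxl).2; rwa [Finset.union_comm] at this⟩
          have e : (Δ.link F hF).link {x} hxl = (Δ.link {x} hx).link F hF' := by
            rw [link_link, link_link]
            exact link_congr _ (Finset.union_comm _ _)
          rw [e]
          refine ihl hl _ _ _ ?_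
          omega
        · rwa [deletion_eq_self hxl] at hv

end Homology

/-! ### Cohen–Macaulay and Buchsbaum complexes over a field. -/

section Field

variable {V : Type*} [LinearOrder V] {k : Type*} [Field k]

/-- A largest face of the link, joined to `F`, has at most `d` elements, so degrees below the
dimension of the link satisfy the numerical bound. -/
theorem IsVertexDecomposable.isCohenMacaulay [Finite V] {Δ : SComplex V} (h : Δ.IsVertexDecomposable) :
    Δ.IsCohenMacaulay k := by
  refine ⟨h.isPure, fun F hF i hi => ?_⟩
  obtain ⟨d, hd⟩ := h.isPure.exists_facetsHaveCard
  refine h.reducedHomologyVanishes_link hd F hF i ?_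
  obtain ⟨G, hG, hc⟩ := (Δ.link F hF).exists_card_eq_dim_add_one
  rw [mem_link] at hG
  have := hd.card_le hG.2
  rw [Finset.card_union_of_disjoint hG.1] at this
  omega

theorem IsCohenMacaulay.link [Finite V] {Δ : SComplex V} (h : Δ.IsCohenMacaulay k) {F : Finset V}
    (hF : F ∈ Δ.faces) : (Δ.link F hF).IsCohenMacaulay k := by
  obtain ⟨d, hd⟩ := h.1.exists_facetsHaveCard
  refine ⟨(hd.link hF).isPure, fun G hG i hi => ?_⟩
  rw [link_link] at hi ⊢
  exact h.2 _ _ i hi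

theorem IsCohenMacaulay.isBuchsbaum [Finite V] {Δ : SComplex V} (h : Δ.IsCohenMacaulay k) :
    Δ.IsBuchsbaum k :=
  ⟨h.1, fun _ hx => h.link hx⟩

/-- The zeroth reduced homology of a complex does not vanish if a set of vertices and its
complement, both non-empty, are not joined by an edge. -/
theorem not_reducedHomologyVanishes_zero {Δ : SComplex V} (f : V → Prop)
    (hf : ∀ u v, {u, v} ∈ Δ.faces → (f u ↔ f v)) {a b : V} (ha : {a} ∈ Δ.faces)
    (hb : {b} ∈ Δ.faces) (hfa : f a) (hfb : ¬ f b) : ¬ ReducedHomologyVanishes k Δ 0 := by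
  classical
  intro h
  have hz : (Finsupp.single {a} 1 - Finsupp.single {b} 1 : Finset V →₀ k) ∈ cycles k Δ 0 := by
    refine ⟨sub_mem (Finsupp.single_mem_supported k _ ⟨ha, by simp⟩)
      (Finsupp.single_mem_supported k _ ⟨hb, by simp⟩), ?_⟩
    rw [SetLike.mem_coe, LinearMap.mem_ker, map_sub, boundary_single, boundary_single]
    simp [Finset.filter_singleton]
  obtain ⟨c, hc, hcz⟩ := h hz
  -- On 0-chains, `φ` sums the coefficients of the vertices satisfying `f`. It kills the boundary of
  -- every edge, as both ends lie on the same side, but is `1` on `{a} - {b}`.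
  let φ : (Finset V →₀ k) →ₗ[k] k :=
    Finsupp.linearCombination k fun F : Finset V => if ∃ u ∈ F, f u then (1 : k) else 0
  have h1 : φ (boundary k c) = 0 := by
    refine linearCombination_eqOn (f := φ ∘ₗ boundary k) (g := 0) (fun F hF => ?_) hc
    obtain ⟨hF, hcard⟩ := hF
    obtain ⟨u, v, huv, rfl⟩ := Finset.card_eq_two.mp (show F.card = 2 by omega)
    clear hcard
    wlog hlt : u < v generalizing u v with H
    · rw [Finset.pair_comm] at hF ⊢
      exact H v u huv.symm hF (lt_of_le_of_ne (not_lt.mp hlt) huv.symm)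
    rw [LinearMap.comp_apply, boundary_single, one_smul, Finset.sum_pair huv,
      Finset.erase_insert (by simpa using huv), Finset.pair_comm, Finset.erase_insert (by simpa using huv.symm)]
    have := hf u v (by rwa [Finset.pair_comm] at hF ⊢)
    simp [φ, Finset.filter_insert, Finset.filter_singleton, hlt, hlt.not_gt, this]
  rw [hcz] at h1
  simp [φ, hfa, hfb] at h1

/-- The face `E` makes the link at least one-dimensional, so that degree `0` lies below its
dimension and the link must be connected. -/
theorem IsCohenMacaulay.imp_of_edge_of_link [Finite V] {Δ : SComplex V} (h : Δ.IsCohenMacaulay k)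
    {F E : Finset V} (hF : F ∈ Δ.faces) (hE : E ∈ (Δ.link F hF).faces) (hcard : 2 ≤ E.card)
    (f : V → Prop) (hf : ∀ u v, {u, v} ∈ (Δ.link F hF).faces → (f u ↔ f v)) {a b : V}
    (ha : {a} ∈ (Δ.link F hF).faces) (hb : {b} ∈ (Δ.link F hF).faces) : f a → f b := by
  intro hfa
  by_contra hfb
  refine not_reducedHomologyVanishes_zero f hf ha hb hfa hfb (h.2 F hF 0 ?_)
  have := card_le_dim_add_one hE
  omega

end Field

end SComplex

namespace SComplex

/-! ### Connectivity and first cohomology of links in shellable complexes. -/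

section Shellable

variable {V : Type*} [DecidableEq V] {Δ : SComplex V}

/-- Since `x ∉ F j`, everything that `F i` shares with `F j` survives in the earlier facet `F k`,
and only one vertex of `F i` is lost. -/
theorem exists_adjacent_facet {t : ℕ} {F : Fin t → Finset V}
    (hF : ∀ i j : Fin t, j < i → ∃ x ∈ F i \ F j, ∃ k < i, F i \ F k = {x}) {i j : Fin t}
    (hji : j < i) : ∃ x ∉ F j, ∃ k < i, ∀ y ∈ F i, y ≠ x → y ∈ F k := by
  obtain ⟨x, hx, k, hk, hkx⟩ := hF i j hji
  refine ⟨x, (Finset.mem_sdiff.mp hx).2, k, hk, fun y hy hyx => ?_⟩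
  by_contra hyk
  have : y ∈ F i \ F k := Finset.mem_sdiff.mpr ⟨hy, hyk⟩
  rw [hkx, Finset.mem_singleton] at this
  exact hyx this

/-- The links of dimension at least one of a shellable complex are connected. -/
theorem IsShellable.eq_of_eq_on_edges [Finite V] (h : Δ.IsShellable) {d : ℕ}
    (hd : Δ.FacetsHaveCard d) {A : Finset V} (hA : A.card + 2 ≤ d) {X : Type*} (f : V → X)
    (hf : ∀ u v, u ∉ A → v ∉ A → insert u (insert v A) ∈ Δ.faces → f u = f v) {u v : V}
    (hu : u ∉ A) (hv : v ∉ A) (huA : insert u A ∈ Δ.faces) (hvA : insert v A ∈ Δ.faces) :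
    f u = f v := by
  obtain ⟨-, t, F, -, hfacet, hF⟩ := h
  have hface : ∀ i, F i ∈ Δ.faces := fun i => ((hfacet _).mpr ⟨i, rfl⟩).prop
  have hcard : ∀ i, (F i).card = d := fun i => hd _ ((hfacet _).mpr ⟨i, rfl⟩)
  have hloc : ∀ i, A ⊆ F i → ∀ u ∈ F i, ∀ v ∈ F i, u ∉ A → v ∉ A → f u = f v := by
    intro i hi u hu v hv huA hvA
    exact hf u v huA hvA (Δ.down_closed (hface i)
      (Finset.insert_subset hu (Finset.insert_subset hv hi)))
  -- Induction over initial segments of the shelling, restricted to facets containing `A`.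
  have main : ∀ n : ℕ, ∀ i j : Fin t, (i : ℕ) < n → (j : ℕ) < n → A ⊆ F i → A ⊆ F j →
      ∀ u ∈ F i, ∀ v ∈ F j, u ∉ A → v ∉ A → f u = f v := by
    intro n
    induction n with
    | zero => intro i _ hi; omega
    | succ n ih =>
      intro i j hi hj hAi hAj u hu v hv huA hvA
      wlog hji : j ≤ i generalizing i j u v with H
      · exact (H j i hj hi hAj hAi v hv u hu hvA huA (le_of_not_ge hji)).symm
      rcases hji.eq_or_lt with rfl | hji
      · exact hloc j hAj u hu v hv huA hvA
      obtain ⟨x, hxj, k, hki, hk⟩ := exists_adjacent_facet hF hji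
      have hAk : A ⊆ F k := fun a ha => hk a (hAi ha) fun h => hxj (h ▸ hAj ha)
      -- The bound `|A| + 2 ≤ d` leaves room for a vertex outside `A` shared by `F i` and `F k`,
      -- through which the value of `f` passes from `F i` to an earlier facet.
      obtain ⟨y, hyi, hyA⟩ : ∃ y ∈ F i, y ∉ insert x A := by
        refine Finset.exists_mem_notMem_of_card_lt_card ?_
        have := Finset.card_insert_le x A
        have := hcard i
        omega
      rw [Finset.mem_insert, not_or] at hyA
      rw [hloc i hAi u hu y hyi huA hyA.2]
      have hki' : (k : ℕ) < i := hki
      have hji' : (j : ℕ) < i := hji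
      exact ih k j (by omega) (by omega) hAk hAj y (hk y hyi hyA.1) v hv hyA.2 hvA
  obtain ⟨_, hG, huG⟩ := Δ.exists_isFacet_superset huA
  obtain ⟨i, rfl⟩ := (hfacet _).mp hG
  obtain ⟨_, hG, hvG⟩ := Δ.exists_isFacet_superset hvA
  obtain ⟨j, rfl⟩ := (hfacet _).mp hG
  exact main t i j i.2 j.2 ((Finset.subset_insert _ _).trans huG)
    ((Finset.subset_insert _ _).trans hvG) u (huG (Finset.mem_insert_self _ _)) v
    (hvG (Finset.mem_insert_self _ _)) hu hv

/-- In the links of dimension at least two of a shellable complex, every 1-cocycle with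
coefficients in `ℤ/2` is a coboundary. -/
theorem IsShellable.exists_coboundary [Finite V] (h : Δ.IsShellable) {d : ℕ}
    (hd : Δ.FacetsHaveCard d) {A : Finset V} (hA : A.card + 3 ≤ d) (c : V → V → ZMod 2)
    (hc : ∀ u v w, u ∉ A → v ∉ A → w ∉ A → insert u (insert v (insert w A)) ∈ Δ.faces →
      c u v = c u w + c v w) :
    ∃ g : V → ZMod 2, ∀ u v, u ∉ A → v ∉ A → insert u (insert v A) ∈ Δ.faces →
      c u v = g u + g v := by
  obtain ⟨-, t, F, -, hfacet, hF⟩ := h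
  have hface : ∀ i, F i ∈ Δ.faces := fun i => ((hfacet _).mpr ⟨i, rfl⟩).prop
  have hcard : ∀ i, (F i).card = d := fun i => hd _ ((hfacet _).mpr ⟨i, rfl⟩)
  -- Repeated vertices are allowed here, so the identity also forces `c u u = 0` and the symmetry of
  -- `c`.
  have hloc : ∀ i, A ⊆ F i → ∀ u ∈ F i, ∀ v ∈ F i, ∀ w ∈ F i, u ∉ A → v ∉ A → w ∉ A →
      c u v = c u w + c v w := by
    intro i hi u hu v hv w hw huA hvA hwA
    exact hc u v w huA hvA hwA (Δ.down_closed (hface i)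
      (Finset.insert_subset hu (Finset.insert_subset hv (Finset.insert_subset hw hi))))
  have two : ∀ a : ZMod 2, a + a = 0 := by decide
  have cancel : ∀ a b c d : ZMod 2, a + b = c + d → a + c = b + d := by decide
  -- The potential `g` is built up along the shelling; only the facets containing `A` matter.
  have main : ∀ n : ℕ, ∃ g : V → ZMod 2, ∀ i : Fin t, (i : ℕ) < n → A ⊆ F i →
      ∀ u ∈ F i, ∀ v ∈ F i, u ∉ A → v ∉ A → c u v = g u + g v := by
    intro n
    induction n with
    | zero => exact ⟨0, fun i hi => by omega⟩
    | succ n ih =>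
      obtain ⟨g, hg⟩ := ih
      by_cases hn : ∃ i : Fin t, (i : ℕ) = n ∧ A ⊆ F i
      swap
      · refine ⟨g, fun i hi hAi => hg i ?_ hAi⟩
        rcases Nat.lt_succ_iff_lt_or_eq.mp hi with h | h
        · exact h
        · exact absurd ⟨i, h, hAi⟩ hn
      obtain ⟨i, rfl, hAi⟩ := hn
      obtain ⟨w, hwi, hwA⟩ : ∃ w ∈ F i, w ∉ A := by
        refine Finset.exists_mem_notMem_of_card_lt_card ?_
        have := hcard i
        omega
      -- On the new facet the potential must be `c · w` plus a constant. Agreement with the old `g`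
      -- on vertices shared with earlier facets determines that constant, so it has to be the same
      -- at all of these vertices.
      obtain ⟨e, he⟩ : ∃ e : ZMod 2, ∀ j < i, A ⊆ F j → ∀ u ∈ F i, u ∈ F j → u ∉ A →
          g u + c u w = e := by
        by_cases hex : ∃ j < i, A ⊆ F j ∧ ∃ u ∈ F i, u ∈ F j ∧ u ∉ A
        swap
        · exact ⟨0, fun j hj hAj u hui huj huA => absurd ⟨j, hj, hAj, u, hui, huj, huA⟩ hex⟩
        obtain ⟨j₁, hj₁, hAj₁, u₁, hu₁, huj₁, huA₁⟩ := hex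
        refine ⟨g u₁ + c u₁ w, fun j₂ hj₂ hAj₂ u₂ hu₂ huj₂ huA₂ => ?_⟩
        obtain ⟨x₁, hx₁, k₁, hk₁, h₁⟩ := exists_adjacent_facet hF hj₁
        obtain ⟨x₂, hx₂, k₂, hk₂, h₂⟩ := exists_adjacent_facet hF hj₂
        -- Here `|A| + 3 ≤ d` is needed: `y` lies in `F i` and in both adjacent earlier facets, so
        -- the constants at `u₁` and `u₂` both equal the one at `y`.
        obtain ⟨y, hyi, hyA⟩ : ∃ y ∈ F i, y ∉ insert x₁ (insert x₂ A) := by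
          refine Finset.exists_mem_notMem_of_card_lt_card ?_
          have := Finset.card_insert_le x₂ A
          have := Finset.card_insert_le x₁ (insert x₂ A)
          have := hcard i
          omega
        simp only [Finset.mem_insert, not_or] at hyA
        have hAk₁ : A ⊆ F k₁ := fun a ha => h₁ a (hAi ha) fun h => hx₁ (h ▸ hAj₁ ha)
        have hAk₂ : A ⊆ F k₂ := fun a ha => h₂ a (hAi ha) fun h => hx₂ (h ▸ hAj₂ ha)
        have e₁ := hg k₁ hk₁ hAk₁ u₁ (h₁ u₁ hu₁ fun h => hx₁ (h ▸ huj₁)) y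
          (h₁ y hyi hyA.1) huA₁ hyA.2.2
        have e₂ := hg k₂ hk₂ hAk₂ u₂ (h₂ u₂ hu₂ fun h => hx₂ (h ▸ huj₂)) y
          (h₂ y hyi hyA.2.1) huA₂ hyA.2.2
        rw [hloc i hAi u₁ hu₁ y hyi w hwi huA₁ hyA.2.2 hwA] at e₁
        rw [hloc i hAi u₂ hu₂ y hyi w hwi huA₂ hyA.2.2 hwA] at e₂
        rw [add_comm (g u₂), add_comm (g u₁), cancel _ _ _ _ e₁, cancel _ _ _ _ e₂]
      -- On vertices outside `A` in earlier facets through `A` the new definition agrees with `g`;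
      -- values on `A` itself are irrelevant.
      refine ⟨fun u => if u ∈ F i then c u w + e else g u, fun j hj hAj u hu v hv huA hvA => ?_⟩
      rcases Nat.lt_succ_iff_lt_or_eq.mp hj with hj | hj
      · have key : ∀ u ∈ F j, u ∉ A → (if u ∈ F i then c u w + e else g u) = g u := by
          intro u hu huA
          split_ifs with hui
          · rw [← he j hj hAj u hui hu huA, add_comm (g u), ← add_assoc, two, zero_add]
          · rfl
        simp only [key u hu huA, key v hv hvA]
        exact hg j hj hAj u hu v hv huA hvA
      · obtain rfl : j = i := Fin.ext hj
        simp only [if_pos hu, if_pos hv]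
        rw [hloc j hAj u hu v hv w hwi huA hvA hwA, add_add_add_comm, two, add_zero]
  obtain ⟨g, hg⟩ := main t
  refine ⟨g, fun u v hu hv huv => ?_⟩
  obtain ⟨_, hG, hsub⟩ := Δ.exists_isFacet_superset huv
  obtain ⟨i, rfl⟩ := (hfacet _).mp hG
  have hsub' := (Finset.subset_insert _ _).trans hsub
  exact hg i i.2 ((Finset.subset_insert _ _).trans hsub') u (hsub (Finset.mem_insert_self _ _)) v
    (hsub' (Finset.mem_insert_self _ _)) hu hv

end Shellable

/-! ### The reduced Euler characteristic of vertex decomposable complexes. -/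

section Euler

variable {V : Type*} [Fintype V] [DecidableEq V]

open Classical in
/-- The alternating sum of the numbers of faces, the negative of the reduced Euler
characteristic. -/
noncomputable def alternatingSum (Δ : SComplex V) : ℤ :=
  ∑ F with F ∈ Δ.faces, (-1 : ℤ) ^ F.card

/-- Faces through `x` are faces of the link with one element added, which flips the sign. -/
theorem alternatingSum_eq_sub (Δ : SComplex V) {x : V} (hx : {x} ∈ Δ.faces) :
    Δ.alternatingSum = (Δ.deletion x).alternatingSum - (Δ.link {x} hx).alternatingSum := by
  classical
  unfold alternatingSum
  rw [← Finset.sum_filter_not_add_sum_filter _ (fun F => x ∈ F), sub_eq_add_neg,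
    Finset.filter_filter, Finset.filter_filter, ← Finset.sum_neg_distrib]
  congr 1
  · refine Finset.sum_congr (Finset.filter_congr fun F _ => ?_) fun _ _ => rfl
    rw [mem_deletion]
  · refine Finset.sum_bij' (fun F _ => F.erase x) (fun F _ => insert x F) ?_ ?_ ?_ ?_ ?_
    · intro F hF
      simp only [Finset.mem_filter, Finset.mem_univ, true_and] at hF ⊢
      rw [mem_link_singleton, Finset.insert_erase hF.2]
      exact ⟨Finset.notMem_erase _ _, hF.1⟩
    · intro F hF
      simp only [Finset.mem_filter, Finset.mem_univ, true_and] at hF ⊢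
      exact ⟨(mem_link_singleton.mp hF).2, Finset.mem_insert_self _ _⟩
    · intro F hF
      simp only [Finset.mem_filter, Finset.mem_univ, true_and] at hF
      exact Finset.insert_erase hF.2
    · intro F hF
      simp only [Finset.mem_filter, Finset.mem_univ, true_and] at hF
      exact Finset.erase_insert (mem_link_singleton.mp hF).1
    · intro F hF
      simp only [Finset.mem_filter, Finset.mem_univ, true_and] at hF
      rw [← Finset.card_erase_add_one hF.2, pow_succ, mul_neg_one]

/-- The last entry of the `h`-vector of a vertex decomposable complex is non-negative. -/
theorem IsVertexDecomposable.alternatingSum_nonneg {Δ : SComplex V}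
    (h : Δ.IsVertexDecomposable) :
    ∀ {d : ℕ}, Δ.FacetsHaveCard d → 0 ≤ (-1) ^ d * Δ.alternatingSum := by
  classical
  induction h with
  | simplex Δ hΔ =>
    intro d hd
    obtain ⟨M, hM, hmax⟩ := hΔ
    have hMd : M.card = d := hd M ⟨hM, fun G hG _ => hmax G hG⟩
    have e : Δ.alternatingSum = ∑ F ∈ M.powerset, (-1 : ℤ) ^ F.card := by
      refine Finset.sum_congr ?_ fun _ _ => rfl
      ext F
      simp only [Finset.mem_filter, Finset.mem_univ, true_and, Finset.mem_powerset]
      exact ⟨hmax F, Δ.down_closed hM⟩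
    rw [e, Finset.sum_powerset_neg_one_pow_card]
    split_ifs with h0
    · subst h0
      simp [← hMd]
    · simp
  | shed Δ hpure x hx hlink hdel ihl ihd =>
    intro d hd
    have hl := hd.link hx
    rw [Finset.card_singleton] at hl
    obtain ⟨d, rfl⟩ : ∃ e, d = e + 1 := ⟨d - 1, by have := hd.card_le hx; simp at this; omega⟩
    rw [alternatingSum_eq_sub Δ hx]
    -- If every facet contains `x`, the deletion is the link and the sum is zero. Otherwise the
    -- deletion keeps the facet size while the link drops it by one, and the parity turns the
    -- difference into a sum of two non-negative terms.
    by_cases hcone : ∀ G, Δ.IsFacet G → x ∈ G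
    · have e : Δ.deletion x = Δ.link {x} hx := by
        apply eq_of_faces_eq
        ext F
        rw [mem_deletion, mem_link_singleton, and_comm, and_congr_right_iff]
        refine fun _ => ⟨fun hF => ?_, fun hF => Δ.down_closed hF (Finset.subset_insert _ _)⟩
        obtain ⟨H, hH, hFH⟩ := Δ.exists_isFacet_superset hF
        exact Δ.down_closed hH.prop (Finset.insert_subset (hcone H hH) hFH)
      simp [e]
    · push Not at hcone
      obtain ⟨G, hG, hxG⟩ := hcone
      have hd' : (Δ.deletion x).FacetsHaveCard (d + 1) := by
        rw [← hd G hG]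
        exact hdel.isPure.facetsHaveCard (hG.of_deletion hxG)
      have h1 := ihl hl
      have h2 := ihd hd'
      rw [Nat.add_sub_cancel] at h1
      rw [pow_succ] at h2 ⊢
      linarith

end Euler

end SComplex

open SComplex

/-! ### Independence complexes of induced subgraphs. -/

section InducedIndependence

variable {V : Type*} (G : SimpleGraph V)

/-- The complex of the independent sets of `G` that are contained in `W`. -/
def indOn (W : Finset V) : SComplex V where
  faces := {F | F ⊆ W ∧ G.IsIndepSet (F : Set V)}
  empty_mem := ⟨Finset.empty_subset _, by simp⟩
  down_closed := fun h hHG => ⟨hHG.trans h.1, Set.Pairwise.mono (Finset.coe_subset.mpr hHG) h.2⟩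

variable {G}

theorem mem_indOn {W F : Finset V} :
    F ∈ (indOn G W).faces ↔ F ⊆ W ∧ ∀ u ∈ F, ∀ v ∈ F, ¬ G.Adj u v := by
  refine and_congr_right fun _ => ⟨fun h _ hu _ hv huv => h hu hv huv.ne huv,
    fun h u hu v hv _ => h u hu v hv⟩

theorem mem_indComplex {F : Finset V} :
    F ∈ (indComplex G).faces ↔ ∀ u ∈ F, ∀ v ∈ F, ¬ G.Adj u v :=
  ⟨fun h _ hu _ hv huv => h hu hv huv.ne huv, fun h u hu v hv _ => h u hu v hv⟩

theorem indOn_univ [Fintype V] : indOn G Finset.univ = indComplex G := by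
  apply eq_of_faces_eq
  ext F
  simp [mem_indOn, mem_indComplex]

theorem singleton_mem_indOn {W : Finset V} {x : V} (hx : x ∈ W) : {x} ∈ (indOn G W).faces := by
  simp [mem_indOn, hx]

/-- Together with `link_indOn`, this keeps links and deletions inside the family `indOn G W`, so
that a decomposition can be followed on vertex sets alone. -/
theorem deletion_indOn {W W' : Finset V} {x : V} (hW' : ∀ y, y ∈ W' ↔ y ∈ W ∧ x ≠ y) :
    (indOn G W).deletion x = indOn G W' := by
  apply eq_of_faces_eq
  ext F
  simp only [mem_deletion, mem_indOn, and_right_comm (b := ∀ u ∈ F, _)]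
  refine and_congr_left fun _ => ⟨fun h y hy => (hW' y).mpr ⟨h.1 hy, ?_⟩,
    fun h => ⟨fun y hy => ((hW' y).mp (h hy)).1, fun hx => ((hW' x).mp (h hx)).2 rfl⟩⟩
  rintro rfl
  exact h.2 hy

variable [DecidableEq V]

theorem insert_mem_indOn {W F : Finset V} {x : V} :
    insert x F ∈ (indOn G W).faces ↔
      x ∈ W ∧ F ∈ (indOn G W).faces ∧ ∀ y ∈ F, ¬ G.Adj x y := by
  simp only [mem_indOn, Finset.insert_subset_iff, Finset.forall_mem_insert, G.loopless.irrefl,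
    not_false_eq_true, true_and]
  constructor
  · rintro ⟨⟨h1, h2⟩, h3, h4⟩
    exact ⟨h1, ⟨h2, fun u hu => (h4 u hu).2⟩, h3⟩
  · rintro ⟨h1, ⟨h2, h3⟩, h4⟩
    exact ⟨⟨h1, h2⟩, h4, fun u hu => ⟨fun h => h4 u hu h.symm, h3 u hu⟩⟩

theorem link_indOn {W W' : Finset V} {x : V} (hx : x ∈ W)
    (hW' : ∀ y, y ∈ W' ↔ y ∈ W ∧ ¬ (x = y ∨ G.Adj x y)) :
    (indOn G W).link {x} (singleton_mem_indOn hx) = indOn G W' := by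
  apply eq_of_faces_eq
  ext F
  rw [mem_link_singleton, insert_mem_indOn]
  simp only [mem_indOn, hx, true_and]
  constructor
  · rintro ⟨h1, ⟨h2, h3⟩, h4⟩
    refine ⟨fun y hy => (hW' y).mpr ⟨h2 hy, ?_⟩, h3⟩
    rintro (rfl | h)
    · exact h1 hy
    · exact h4 y hy h
  · rintro ⟨h1, h2⟩
    have h (y) (hy : y ∈ F) := (hW' y).mp (h1 hy)
    exact ⟨fun hxF => (h x hxF).2 (Or.inl rfl), ⟨fun y hy => (h y hy).1, h2⟩,
      fun y hy hxy => (h y hy).2 (Or.inr hxy)⟩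

end InducedIndependence

namespace SComplex

variable {V : Type*} [DecidableEq V] {Δ : SComplex V}

theorem IsFacet.erase {x : V} (hx : {x} ∈ Δ.faces) {F : Finset V} (hF : Δ.IsFacet F)
    (hxF : x ∈ F) : (Δ.link {x} hx).IsFacet (F.erase x) := by
  refine ⟨mem_link_singleton.mpr ⟨Finset.notMem_erase _ _, ?_⟩, fun H hH hle => ?_⟩
  · rw [Finset.insert_erase hxF]
    exact hF.prop
  · have hH := mem_link_singleton.mp hH
    have h1 : F ⊆ insert x H := by
      rw [← Finset.insert_erase hxF]
      exact Finset.insert_subset_insert x hle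
    have h2 := hF.le_of_ge hH.2 h1
    intro y hy
    refine Finset.mem_erase.mpr ⟨?_, h2 (Finset.mem_insert_of_mem hy)⟩
    rintro rfl
    exact hH.1 hy

/-- The first alternative is the cone case: a facet avoiding `x` would be a face of the link and
could be enlarged by `x`. -/
theorem FacetsHaveCard.of_link_of_deletion {x : V} (hx : {x} ∈ Δ.faces) {d : ℕ}
    (hl : (Δ.link {x} hx).FacetsHaveCard d)
    (hd : Δ.deletion x = Δ.link {x} hx ∨ (Δ.deletion x).FacetsHaveCard (d + 1)) :
    Δ.FacetsHaveCard (d + 1) := by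
  intro F hF
  by_cases hxF : x ∈ F
  · rw [← Finset.card_erase_add_one hxF, hl _ (hF.erase hx hxF)]
  · rcases hd with hd | hd
    · have h := (hF.of_deletion hxF).prop
      rw [hd, mem_link_singleton] at h
      exact absurd (hF.le_of_ge h.2 (Finset.subset_insert _ _) (Finset.mem_insert_self _ _)) hxF
    · exact hd _ (hF.of_deletion hxF)

end SComplex

/-! ### Sets of vertices as bit masks -/

section Masks

/-- The set of the `i : Fin n` whose bit in `W` is set. -/
def maskSet (n W : ℕ) : Finset (Fin n) :=
  Finset.univ.filter fun i => W.testBit i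

/-- The bits of `W` that are not bits of `M`. -/
def maskDiff (W M : ℕ) : ℕ :=
  W ^^^ (W &&& M)

/-- The mask with the lowest `n` bits set. -/
def fullMask (n : ℕ) : ℕ :=
  2 ^ n - 1

variable {n : ℕ}

theorem mem_maskSet {W : ℕ} {i : Fin n} : i ∈ maskSet n W ↔ W.testBit i = true := by
  simp [maskSet]

theorem testBit_maskDiff (W M i : ℕ) :
    (maskDiff W M).testBit i = (W.testBit i && !M.testBit i) := by
  rw [maskDiff, Nat.testBit_xor, Nat.testBit_and]
  cases W.testBit i <;> cases M.testBit i <;> rfl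

theorem mem_maskSet_maskDiff {W M : ℕ} {i : Fin n} :
    i ∈ maskSet n (maskDiff W M) ↔ i ∈ maskSet n W ∧ M.testBit i = false := by
  simp [mem_maskSet, testBit_maskDiff]

theorem testBit_one_shiftLeft (x i : ℕ) : (1 <<< x).testBit i = decide (x = i) := by
  rw [Nat.shiftLeft_eq, one_mul, Nat.testBit_two_pow]

theorem maskSet_fullMask : maskSet n (fullMask n) = Finset.univ := by
  ext i
  simp [mem_maskSet, fullMask, Nat.testBit_two_pow_sub_one]

theorem maskSet_zero : maskSet n 0 = ∅ := by
  ext i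
  simp [mem_maskSet]

/-- `C i` is the mask of the closed neighbourhood of the vertex `i`. -/
def IsNbhdMask (G : SimpleGraph (Fin n)) (C : ℕ → ℕ) : Prop :=
  ∀ i j : Fin n, (C i).testBit j = true ↔ i = j ∨ G.Adj i j

variable {G : SimpleGraph (Fin n)} {C : ℕ → ℕ}

theorem IsNbhdMask.link (hC : IsNbhdMask G C) {W : ℕ} {x : Fin n} (hx : x ∈ maskSet n W) :
    (indOn G (maskSet n W)).link {x} (singleton_mem_indOn hx) =
      indOn G (maskSet n (maskDiff W (C x))) := by
  refine link_indOn hx fun y => ?_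
  rw [mem_maskSet_maskDiff, ← hC x y, Bool.not_eq_true]

theorem deletion_maskSet {W : ℕ} {x : Fin n} :
    (indOn G (maskSet n W)).deletion x = indOn G (maskSet n (maskDiff W (1 <<< (x : ℕ)))) := by
  refine deletion_indOn fun y => ?_
  rw [mem_maskSet_maskDiff, testBit_one_shiftLeft, decide_eq_false_iff_not, Fin.val_inj]

/-- The value of `f` at `x`, computed in such a way that `x` is reduced to a numeral first. -/
def withValue (x : ℕ) (f : ℕ → Bool) : Bool :=
  Nat.rec (f 0) (fun m _ => f (Nat.succ m)) x

theorem withValue_eq (x : ℕ) (f : ℕ → Bool) : withValue x f = f x := by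
  cases x <;> rfl

/-- Search for a sequence of shedding vertices, to be chosen in the given order of preference, that
shows that `indOn` of the mask `W` is vertex decomposable with facets of cardinality `d`. -/
def shedSearch (n : ℕ) (C : ℕ → ℕ) (order : List ℕ) : ℕ → ℕ → ℕ → Bool
  | 0, W, d => W == 0 && d == 0
  | f + 1, W, d => withValue W fun W => (W == 0 && d == 0) || order.any fun x =>
      Nat.blt x n && (W.testBit x && (Nat.blt 0 d &&
        (shedSearch n C order f (maskDiff W (C x)) (d - 1) &&
          (maskDiff W (C x) == maskDiff W (1 <<< x) ||
            shedSearch n C order f (maskDiff W (1 <<< x)) d))))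

theorem isVertexDecomposable_of_mask_zero {d : ℕ} (W : ℕ) (h : (W == 0 && d == 0) = true) :
    (indOn G (maskSet n W)).IsVertexDecomposable ∧ (indOn G (maskSet n W)).FacetsHaveCard d := by
  simp only [Bool.and_eq_true, beq_iff_eq] at h
  obtain ⟨rfl, rfl⟩ := h
  refine ⟨.simplex _ ⟨∅, SComplex.empty_mem _, fun F hF => ?_⟩, fun F hF => ?_⟩
  · simpa [maskSet_zero] using (mem_indOn.mp hF).1
  · have := (mem_indOn.mp hF.prop).1
    rw [maskSet_zero, Finset.subset_empty] at this
    simp [this]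

/-- The counter `f` only bounds the recursion. Equality of the two remaining masks means that `x`
has no neighbour left in `W`; a simplex is thus shed vertex by vertex down to the empty mask, the
only base case. -/
theorem shedSearch_sound (hC : IsNbhdMask G C) (order : List ℕ) (f : ℕ) : ∀ (W d : ℕ),
    shedSearch n C order f W d = true → (indOn G (maskSet n W)).IsVertexDecomposable ∧
      (indOn G (maskSet n W)).FacetsHaveCard d := by
  induction f with
  | zero => exact fun W d h => isVertexDecomposable_of_mask_zero W h
  | succ f ih =>
    intro W d h
    rw [shedSearch, withValue_eq, Bool.or_eq_true] at h
    rcases h with h | h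
    · exact isVertexDecomposable_of_mask_zero W h
    · simp only [List.any_eq_true, Bool.and_eq_true, Bool.or_eq_true, beq_iff_eq, Nat.blt_eq] at h
      obtain ⟨x, -, hxn, hxW, hd, hl, hdel⟩ := h
      obtain ⟨d, rfl⟩ := Nat.exists_eq_add_of_lt hd
      lift x to Fin n using hxn
      simp only [zero_add, Nat.add_sub_cancel] at hl hdel ⊢
      have hx := mem_maskSet.mpr hxW
      have hl := ih _ _ hl
      rw [← hC.link hx] at hl
      have hdel' : (indOn G (maskSet n W)).deletion x =
          (indOn G (maskSet n W)).link {x} (singleton_mem_indOn hx) ∨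
          ((indOn G (maskSet n W)).deletion x).IsVertexDecomposable ∧
            ((indOn G (maskSet n W)).deletion x).FacetsHaveCard (d + 1) := by
        rcases hdel with h | h
        · rw [hC.link hx, deletion_maskSet, h]
          exact Or.inl rfl
        · rw [deletion_maskSet]
          exact Or.inr (ih _ _ h)
      have hcard : (indOn G (maskSet n W)).FacetsHaveCard (d + 1) :=
        .of_link_of_deletion (singleton_mem_indOn hx) hl.2 (hdel'.imp_right And.right)
      refine ⟨.shed _ hcard.isPure x (singleton_mem_indOn hx) hl.1 ?_, hcard⟩
      rcases hdel' with h | h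
      · rw [h]
        exact hl.1
      · exact h.1

/-- The part of the mask `W` that remains after the closed neighbourhoods of the vertices in a list
have been removed one after the other, if each of these vertices was still there at its turn. -/
def remaining (n : ℕ) (C : ℕ → ℕ) : List ℕ → ℕ → Option ℕ
  | [], W => some W
  | v :: l, W => if Nat.blt v n && W.testBit v then remaining n C l (maskDiff W (C v)) else none

/-- The set of the elements of a list. -/
def listSet (n : ℕ) (l : List ℕ) : Finset (Fin n) :=
  Finset.univ.filter fun i => (i : ℕ) ∈ l

theorem mem_listSet {l : List ℕ} {i : Fin n} : i ∈ listSet n l ↔ (i : ℕ) ∈ l := by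
  simp [listSet]

/-- The surviving mask is the vertex set of the link of the listed face. Membership of each vertex
in the current mask guarantees independence and the absence of repetitions. -/
theorem remaining_sound (hC : IsNbhdMask G C) : ∀ (l : List ℕ) (W R : ℕ),
    remaining n C l W = some R → (listSet n l).card = l.length ∧
      listSet n l ∈ (indOn G (maskSet n W)).faces ∧ ∀ y, y ∈ maskSet n R ↔
        y ∉ listSet n l ∧ insert y (listSet n l) ∈ (indOn G (maskSet n W)).faces := by
  intro l
  induction l with
  | nil =>
    intro W R h
    obtain rfl := Option.some.inj h
    have e : listSet n [] = ∅ := by ext; simp [mem_listSet]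
    rw [e]
    exact ⟨rfl, SComplex.empty_mem _, fun y => by simp [mem_indOn]⟩
  | cons v l ih =>
    intro W R h
    rw [remaining] at h
    split_ifs at h with hv
    simp only [Bool.and_eq_true, Nat.blt_eq] at hv
    obtain ⟨hvn, hvW⟩ := hv
    lift v to Fin n using hvn
    have hvW := mem_maskSet.mpr hvW
    obtain ⟨h1, h2, h3⟩ := ih _ _ h
    rw [← hC.link hvW, mem_link_singleton] at h2
    have e : listSet n ((v : ℕ) :: l) = insert v (listSet n l) := by
      ext
      simp [mem_listSet, Fin.val_inj]
    rw [e, Finset.card_insert_of_notMem h2.1, h1]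
    refine ⟨rfl, h2.2, fun y => ?_⟩
    rw [h3, ← hC.link hvW, mem_link_singleton, Finset.mem_insert, Finset.mem_insert, not_or,
      not_or, Finset.insert_comm v y]
    have : v = y ↔ y = v := eq_comm
    tauto

/-- A face whose link has no vertex is maximal. -/
theorem isFacet_of_remaining (hC : IsNbhdMask G C) {l : List ℕ} {W : ℕ}
    (h : remaining n C l W = some 0) : (indOn G (maskSet n W)).IsFacet (listSet n l) := by
  obtain ⟨-, h1, h2⟩ := remaining_sound hC l W 0 h
  refine ⟨h1, fun H hH hle y hy => ?_⟩
  by_contra hyl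
  have := (h2 y).mpr ⟨hyl, SComplex.down_closed _ hH (Finset.insert_subset hy hle)⟩
  simp [maskSet_zero] at this

theorem indOn_fullMask : indOn G (maskSet n (fullMask n)) = indComplex G := by
  rw [maskSet_fullMask, indOn_univ]

theorem not_isPure_of_remaining (hC : IsNbhdMask G C) {l l' : List ℕ}
    (h : remaining n C l (fullMask n) = some 0) (h' : remaining n C l' (fullMask n) = some 0)
    (hl : l.length ≠ l'.length) : ¬ (indComplex G).IsPure := by
  intro hp
  rw [← indOn_fullMask] at hp
  have := hp _ _ (isFacet_of_remaining hC h) (isFacet_of_remaining hC h')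
  rw [(remaining_sound hC _ _ _ h).1, (remaining_sound hC _ _ _ h').1] at this
  exact hl this

end Masks

/-! ### Checkable obstructions to shellability. -/

section Obstructions

variable {n : ℕ} {G : SimpleGraph (Fin n)} {C : ℕ → ℕ}

/-- Some vertex lies in the mask `W`. -/
def anyVertex (n W : ℕ) : Bool :=
  (List.range n).any fun i => W.testBit i

theorem anyVertex_eq_true {W : ℕ} (h : anyVertex n W = true) : ∃ i : Fin n, i ∈ maskSet n W := by
  simp only [anyVertex, List.any_eq_true, List.mem_range] at h
  obtain ⟨i, hi, h⟩ := h
  exact ⟨⟨i, hi⟩, mem_maskSet.mpr h⟩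

/-- The vertices of the mask `W` all satisfy `p`. -/
def allVertices (n W : ℕ) (p : ℕ → Bool) : Bool :=
  (List.range n).all fun i => !W.testBit i || p i

theorem allVertices_eq_true {W : ℕ} {p : ℕ → Bool} (h : allVertices n W p = true) {i : Fin n}
    (hi : i ∈ maskSet n W) : p i = true := by
  simp only [allVertices, List.all_eq_true, List.mem_range] at h
  simpa [mem_maskSet.mp hi] using h i i.2

/-- `l` is a face of size at least `r` of the complex of the independent sets in the mask `W`. -/
def hasFace (n : ℕ) (C : ℕ → ℕ) (W r : ℕ) (l : List ℕ) : Bool :=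
  (remaining n C l W).isSome && Nat.ble r l.length

/-- In the link of the face `A`, no edge joins the vertices of the mask `U` to the others. -/
def disconnectedLink (n : ℕ) (C : ℕ → ℕ) (A E : List ℕ) (U : ℕ) : Bool :=
  hasFace n C (fullMask n) (A.length + 2) (A ++ E) &&
    match remaining n C A (fullMask n) with
    | none => false
    | some W => anyVertex n (U &&& W) && (anyVertex n (maskDiff W U) &&
        allVertices n (U &&& W) fun u => maskDiff (maskDiff W U) (C u) == 0)

theorem le_of_hasFace (hC : IsNbhdMask G C) {r d : ℕ} {l : List ℕ}
    (h : hasFace n C (fullMask n) r l = true) (hd : (indComplex G).FacetsHaveCard d) : r ≤ d := by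
  simp only [hasFace, Bool.and_eq_true, Nat.ble_eq] at h
  obtain ⟨R, hR⟩ := Option.isSome_iff_exists.mp h.1
  obtain ⟨h1, h2, -⟩ := remaining_sound hC _ _ _ hR
  rw [indOn_fullMask] at h2
  have := hd.card_le h2
  omega

/-- The mask `U` splits the vertices of the link of `A` into two non-empty parts, and every pair
across is adjacent in `G`, hence not an edge of the link. The face `A ++ E` shows that `d` is large
enough for links to be connected in a shellable complex. -/
theorem not_isShellable_of_disconnectedLink (hC : IsNbhdMask G C) {A E : List ℕ} {U : ℕ}
    (h : disconnectedLink n C A E U = true) : ¬ (indComplex G).IsShellable := by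
  intro hs
  obtain ⟨d, hd⟩ := hs.1.exists_facetsHaveCard
  rw [disconnectedLink, Bool.and_eq_true] at h
  obtain ⟨hE, h⟩ := h
  split at h
  · simp at h
  rename_i W hW
  obtain ⟨hA, -, hlink⟩ := remaining_sound hC _ _ _ hW
  rw [indOn_fullMask] at hlink
  simp only [Bool.and_eq_true] at h
  obtain ⟨ha, hb, hU⟩ := h
  obtain ⟨a, ha⟩ := anyVertex_eq_true ha
  obtain ⟨b, hb⟩ := anyVertex_eq_true hb
  have hAd := le_of_hasFace hC hE hd
  rw [← hA] at hAd
  have haW : a ∈ maskSet n W := by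
    rw [mem_maskSet, Nat.testBit_and, Bool.and_eq_true] at ha
    exact mem_maskSet.mpr ha.2
  have hbW := (mem_maskSet_maskDiff.mp hb).1
  have key : ∀ u v : Fin n, u ∉ listSet n A → v ∉ listSet n A →
      insert u (insert v (listSet n A)) ∈ (indComplex G).faces → U.testBit u = true →
      U.testBit v = true := by
    intro u v hu hv huv hUu
    have hvW := (hlink v).mpr ⟨hv, SComplex.down_closed _ huv (Finset.subset_insert _ _)⟩
    have huW := (hlink u).mpr ⟨hu, SComplex.down_closed _ huv
      (Finset.insert_subset_insert _ (Finset.subset_insert _ _))⟩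
    by_contra hUv
    rw [Bool.not_eq_true] at hUv
    have h0 := allVertices_eq_true hU (i := u)
      (by rw [mem_maskSet, Nat.testBit_and, hUu, mem_maskSet.mp huW]; rfl)
    rw [beq_iff_eq] at h0
    have h1 := testBit_maskDiff (maskDiff W U) (C u) v
    rw [h0, testBit_maskDiff, mem_maskSet.mp hvW, hUv, Nat.zero_testBit] at h1
    have h2 : (C u).testBit v = true := by simpa using h1.symm
    rcases (hC u v).mp h2 with rfl | h2
    · simp [hUu] at hUv
    · exact mem_indComplex.mp huv u (by simp) v (by simp) h2
  have hab := hs.eq_of_eq_on_edges hd hAd (fun v => U.testBit v)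
    (fun u v hu hv huv => Bool.eq_iff_iff.mpr
      ⟨key u v hu hv huv, key v u hv hu (Finset.insert_comm u v _ ▸ huv)⟩)
    ((hlink a).mp haW).1 ((hlink b).mp hbW).1 ((hlink a).mp haW).2 ((hlink b).mp hbW).2
  rw [mem_maskSet, Nat.testBit_and, Bool.and_eq_true] at ha
  simp [ha.1, (mem_maskSet_maskDiff.mp hb).2] at hab

/-- The mask that a 1-cochain with coefficients in `ℤ/2`, stored in `c` as the rows of an
`n × n` matrix, has as its row with index `u`. -/
def cochainRow (n c u : ℕ) : ℕ :=
  (c >>> (u * n)) &&& fullMask n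

/-- The mask of `u` and the vertices of `W` that are not adjacent to `u`. -/
def openMask (C : ℕ → ℕ) (W u : ℕ) : ℕ :=
  maskDiff W (C u) ||| 1 <<< u

/-- `c` is a cocycle on the complex of the independent sets in the mask `W`. -/
def isCocycle (n : ℕ) (C : ℕ → ℕ) (W c : ℕ) : Bool :=
  allVertices n W fun u => withValue (cochainRow n c u) fun r => withValue (openMask C W u) fun M =>
    allVertices n M fun v => (r ^^^ cochainRow n c v) &&& (M &&& openMask C W v) ==
      bif r.testBit v then M &&& openMask C W v else 0

/-- `u` followed by `l` is an edge path in the complex of the independent sets in `W`. -/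
def isEdgePath (n : ℕ) (C : ℕ → ℕ) (W : ℕ) : ℕ → List ℕ → Bool
  | _, [] => true
  | u, v :: l => Nat.blt v n && (W.testBit v && ((openMask C W u).testBit v && isEdgePath n C W v l))

/-- The value of the cochain `c` on the path `u` followed by `l`. -/
def pathParity (n c : ℕ) : ℕ → List ℕ → Bool
  | _, [] => false
  | u, v :: l => (cochainRow n c u).testBit v ^^ pathParity n c v l

/-- In the link of the face `A`, the cochain `c` is a cocycle that is non-zero on the closed path
`p`. -/
def nontrivialCocycle (n : ℕ) (C : ℕ → ℕ) (A E : List ℕ) (c : ℕ) (p : List ℕ) : Bool :=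
  hasFace n C (fullMask n) (A.length + 3) (A ++ E) &&
    match remaining n C A (fullMask n), p with
    | some W, u :: l => isCocycle n C W c && (Nat.blt u n && (W.testBit u &&
        (isEdgePath n C W u l && (l.getLastD u == u && pathParity n c u l))))
    | _, _ => false

/-- The bit of `u` itself is set because the cocycle identity is also tested on repeated vertices,
as `IsShellable.exists_coboundary` demands. -/
theorem testBit_openMask (hC : IsNbhdMask G C) {W : ℕ} {u v : Fin n}
    (hv : v ∈ maskSet n W) : (openMask C W u).testBit v = true ↔ ¬ G.Adj u v := by
  rw [openMask, Nat.testBit_or, testBit_maskDiff, testBit_one_shiftLeft, mem_maskSet.mp hv,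
    Bool.true_and, Bool.or_eq_true, Bool.not_eq_true', ← Bool.not_eq_true, hC u v,
    decide_eq_true_eq, Fin.val_inj, not_or]
  refine ⟨?_, fun h => ?_⟩
  · rintro (h | rfl)
    · exact h.2
    · exact G.loopless.irrefl _
  · by_cases huv : u = v
    · exact Or.inr huv
    · exact Or.inl ⟨huv, h⟩

/-- The values of a coboundary telescope along a path. -/
theorem pathParity_eq_add {W c : ℕ} {g : ℕ → ZMod 2}
    (hg : ∀ u v : Fin n, u ∈ maskSet n W → v ∈ maskSet n W → (openMask C W u).testBit v = true →
      (bif (cochainRow n c u).testBit v then 1 else 0) = g u + g v) : ∀ (l : List ℕ) (u : Fin n),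
    u ∈ maskSet n W → isEdgePath n C W u l = true →
      (bif pathParity n c u l then 1 else 0) = g u + g (l.getLastD u) := by
  intro l
  induction l with
  | nil => exact fun u _ _ => (CharTwo.add_self_eq_zero (g u)).symm
  | cons v l ih =>
    intro u hu h
    simp only [isEdgePath, Bool.and_eq_true, Nat.blt_eq] at h
    obtain ⟨hvn, hvW, huv, hl⟩ := h
    lift v to Fin n using hvn
    have hv := mem_maskSet.mpr hvW
    have h1 := hg u v hu hv huv
    have h2 := ih v hv hl
    have h3 : ∀ a b : Bool, (bif a ^^ b then (1 : ZMod 2) else 0) =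
        (bif a then 1 else 0) + bif b then 1 else 0 := by decide
    rw [pathParity, h3, h1, h2, List.getLastD_cons]
    have h4 : ∀ a b c : ZMod 2, a + b + (b + c) = a + c := by decide
    exact h4 _ _ _

/-- A coboundary sums to zero on every closed path, whereas `c` has odd sum on `p`. -/
theorem not_isShellable_of_nontrivialCocycle (hC : IsNbhdMask G C) {A E : List ℕ} {c : ℕ}
    {p : List ℕ} (h : nontrivialCocycle n C A E c p = true) : ¬ (indComplex G).IsShellable := by
  intro hs
  obtain ⟨d, hd⟩ := hs.1.exists_facetsHaveCard
  unfold nontrivialCocycle at h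
  rw [Bool.and_eq_true] at h
  obtain ⟨hE, h⟩ := h
  cases hW : remaining n C A (fullMask n) with
  | none => simp [hW] at h
  | some W =>
  cases p with
  | nil => simp [hW] at h
  | cons a l =>
  rw [hW] at h
  dsimp only at h
  obtain ⟨hA, hAf, hlink⟩ := remaining_sound hC _ _ _ hW
  rw [indOn_fullMask] at hlink hAf
  simp only [Bool.and_eq_true, Nat.blt_eq, beq_iff_eq] at h
  obtain ⟨hcoc, hal, haW, hpath, hlast, hpar⟩ := h
  lift a to Fin n using hal
  have haW := mem_maskSet.mpr haW
  have hAd := le_of_hasFace hC hE hd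
  rw [← hA] at hAd
  -- An independence complex is flag: two non-adjacent vertices of the link span an edge of it.
  have hface : ∀ u v : Fin n, u ∈ maskSet n W → v ∈ maskSet n W → ¬ G.Adj u v →
      insert u (insert v (listSet n A)) ∈ (indComplex G).faces := by
    intro u v hu hv huv
    have hu' := mem_indComplex.mp ((hlink u).mp hu).2
    have hv' := mem_indComplex.mp ((hlink v).mp hv).2
    simp only [mem_indComplex, Finset.forall_mem_insert, G.loopless.irrefl, not_false_eq_true,
      true_and] at hu' hv' ⊢
    have hvu : ¬ G.Adj v u := fun h => huv h.symm
    exact ⟨⟨huv, hu'.1⟩, ⟨hvu, hv'.1⟩, fun x hx => ⟨(hu'.2 x hx).1, hv'.2 x hx⟩⟩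
  let b : Fin n → Fin n → ZMod 2 := fun u v => bif (cochainRow n c u).testBit v then 1 else 0
  obtain ⟨g, hg⟩ := hs.exists_coboundary hd hAd b (by
    intro u v w hu hv hw huvw
    have hmem : ∀ x ∉ listSet n A, x = u ∨ x = v ∨ x = w → x ∈ maskSet n W := by
      intro x hx h
      refine (hlink x).mpr ⟨hx, SComplex.down_closed _ huvw ?_⟩
      intro y hy
      simp only [Finset.mem_insert] at hy ⊢
      rcases hy with rfl | hy
      · tauto
      · exact Or.inr (Or.inr (Or.inr hy))
    have hind := mem_indComplex.mp huvw
    have huW := hmem u hu (by simp)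
    have hvW := hmem v hv (by simp)
    have hwW := hmem w hw (by simp)
    have huv := (testBit_openMask hC hvW).mpr (hind u (by simp) v (by simp))
    have huw := (testBit_openMask hC hwW).mpr (hind u (by simp) w (by simp))
    have hvw := (testBit_openMask hC hwW).mpr (hind v (by simp) w (by simp))
    have h1 := allVertices_eq_true hcoc huW
    rw [withValue_eq, withValue_eq] at h1
    replace h1 := allVertices_eq_true h1 (mem_maskSet.mpr huv)
    rw [beq_iff_eq] at h1
    -- A single equation of words holds the identities for all `w`; bit `w` extracts the required
    -- one.
    have h2 := congrArg (fun m => m.testBit w) h1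
    simp only [Nat.testBit_and, Nat.testBit_xor, huw, hvw, Bool.and_true] at h2
    have h3 : ∀ r s t : Bool, (r ^^ s) = t → (bif t then (1 : ZMod 2) else 0) =
        (bif r then 1 else 0) + bif s then 1 else 0 := by decide
    refine h3 _ _ _ (h2.trans ?_)
    cases (cochainRow n c u).testBit v
    · simp
    · simp [huw, hvw])
  -- Paths are lists of natural numbers, so the potential is extended by zero beyond the vertices.
  let g' : ℕ → ZMod 2 := fun i => if h : i < n then g ⟨i, h⟩ else 0
  have hg' : ∀ u : Fin n, g' u = g u := fun u => by simp [g']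
  have := pathParity_eq_add (g := g') (c := c) (fun u v hu hv huv => by
    rw [hg', hg']
    exact hg u v ((hlink u).mp hu).1 ((hlink v).mp hv).1
      (hface u v hu hv ((testBit_openMask hC hv).mp huv))) l a haW hpath
  rw [hlast, hpar, CharTwo.add_self_eq_zero] at this
  exact one_ne_zero this

end Obstructions

/-! ### Computing Euler characteristics on masks. -/

section AlternatingSum

variable {n : ℕ} {G : SimpleGraph (Fin n)} {C : ℕ → ℕ}

/-- The alternating sum of the numbers of independent sets in the mask of the vertices of `W` below
`k`. -/
def maskAlternatingSum (C : ℕ → ℕ) : ℕ → ℕ → ℤ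
  | 0, _ => 1
  | k + 1, W => bif W.testBit k then
      maskAlternatingSum C k W - maskAlternatingSum C k (maskDiff W (C k))
    else maskAlternatingSum C k W

theorem alternatingSum_indOn_empty : (indOn G ∅).alternatingSum = 1 := by
  rw [alternatingSum, Finset.sum_eq_single_of_mem ∅]
  · simp
  · simp [SComplex.empty_mem]
  · intro F hF hne
    simp only [Finset.mem_filter, mem_indOn, Finset.subset_empty] at hF
    exact absurd hF.2.1 hne

/-- Deletion and link at the largest remaining vertex. The deletion needs no new mask, since
lowering the bound `k` already discards that vertex. -/
theorem maskAlternatingSum_eq (hC : IsNbhdMask G C) : ∀ k ≤ n, ∀ W,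
    maskAlternatingSum C k W =
      (indOn G ((maskSet n W).filter fun i => (i : ℕ) < k)).alternatingSum := by
  intro k
  induction k with
  | zero =>
    intro _ W
    simp [alternatingSum_indOn_empty, maskAlternatingSum]
  | succ k ih =>
    intro hk W
    have ih := ih (by omega)
    obtain ⟨x, rfl⟩ : ∃ x : Fin n, (x : ℕ) = k := ⟨⟨k, hk⟩, rfl⟩
    rw [maskAlternatingSum]
    cases hx : W.testBit x
    · rw [cond_false, ih]
      congr 2
      ext i
      simp only [Finset.mem_filter, mem_maskSet]
      refine and_congr_right fun hi => ⟨fun h => by omega, fun h => ?_⟩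
      refine lt_of_le_of_ne (by omega) fun h => ?_
      rw [h, hx] at hi
      simp at hi
    · have hx' : x ∈ (maskSet n W).filter fun i : Fin n => (i : ℕ) < x + 1 := by
        simp [mem_maskSet, hx]
      have hdel : ∀ y, y ∈ (maskSet n W).filter (fun i : Fin n => (i : ℕ) < x) ↔
          y ∈ (maskSet n W).filter (fun i : Fin n => (i : ℕ) < x + 1) ∧ x ≠ y := by
        intro y
        simp only [Finset.mem_filter, ne_eq]
        rw [and_assoc, ← Fin.val_inj]
        refine and_congr_right fun _ => ?_
        omega
      have hlink : ∀ y, y ∈ (maskSet n (maskDiff W (C x))).filter (fun i : Fin n => (i : ℕ) < x) ↔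
          y ∈ (maskSet n W).filter (fun i : Fin n => (i : ℕ) < x + 1) ∧ ¬ (x = y ∨ G.Adj x y) := by
        intro y
        simp only [Finset.mem_filter, mem_maskSet_maskDiff, ← hC x y, Bool.not_eq_true]
        refine ⟨fun h => ⟨⟨h.1.1, by omega⟩, h.1.2⟩, fun h => ⟨⟨h.1.1, h.2⟩, ?_⟩⟩
        refine lt_of_le_of_ne (Nat.lt_succ_iff.mp h.1.2) fun e => ?_
        rw [Fin.ext e, (hC x x).mpr (Or.inl rfl)] at h
        simp at h
      rw [cond_true, ih, ih, alternatingSum_eq_sub _ (singleton_mem_indOn hx'),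
        deletion_indOn hdel, link_indOn hx' hlink]

/-- All vertex deletions have an `h`-vector whose last entry is negative; for every vertex, one of
the given independent sets of size `d` shows the dimension of the deletion. -/
def deletionsNotVertexDecomposable (n : ℕ) (C : ℕ → ℕ) (d : ℕ) (L : List (List ℕ)) : Bool :=
  (List.range n).all fun x =>
    decide ((-1) ^ d * maskAlternatingSum C n (maskDiff (fullMask n) (1 <<< x)) < 0) &&
      L.any fun l => remaining n C l (maskDiff (fullMask n) (1 <<< x)) == some 0 && l.length == d

/-- The deletion of a shedding vertex would be vertex decomposable, with non-negative last
`h`-entry. It would also be pure, so one facet fixes the sign exponent `d`. The edge `uv` excludes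
the simplex. -/
theorem not_isVertexDecomposable_of_deletions (hC : IsNbhdMask G C) {d : ℕ} {L : List (List ℕ)}
    (h : deletionsNotVertexDecomposable n C d L = true) {u v : Fin n} (huv : G.Adj u v) :
    ¬ (indComplex G).IsVertexDecomposable := by
  intro hvd
  cases hvd with
  | simplex _ hs =>
    obtain ⟨F, hF, hmax⟩ := hs
    have hsing : ∀ u : Fin n, u ∈ F := fun u => Finset.singleton_subset_iff.mp
      (hmax {u} (mem_indComplex.mpr (by simp)))
    exact mem_indComplex.mp hF u (hsing u) v (hsing v) huv
  | shed _ _ x hx _ hdel =>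
    rw [← indOn_fullMask, deletion_maskSet] at hdel
    simp only [deletionsNotVertexDecomposable, List.all_eq_true, List.mem_range, Bool.and_eq_true,
      decide_eq_true_eq, List.any_eq_true, beq_iff_eq] at h
    obtain ⟨h1, l, -, h2, rfl⟩ := h x x.2
    have h3 := hdel.isPure.facetsHaveCard (isFacet_of_remaining hC h2)
    rw [(remaining_sound hC _ _ _ h2).1] at h3
    have h4 := hdel.alternatingSum_nonneg h3
    rw [maskAlternatingSum_eq hC n le_rfl, Finset.filter_true_of_mem fun i _ => i.2] at h1
    exact absurd h4 (not_le.mpr h1)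

end AlternatingSum

/-! ### Enumerating facets and verifying shellings. -/

section Facets

variable {n : ℕ} {G : SimpleGraph (Fin n)} {C : ℕ → ℕ}

/-- All the facets of the complex of the independent sets in the mask `W`, when joined to the mask
`M`, have the property `p`. -/
def allFacets (n : ℕ) (C : ℕ → ℕ) (p : ℕ → Bool) : ℕ → ℕ → ℕ → Bool
  | 0, W, M => W == 0 && p M
  | f + 1, W, M => bif W == 0 then p M else (List.range n).any fun v => W.testBit v &&
      allVertices n (W &&& C v) fun u => allFacets n C p f (maskDiff W (C u)) (M ||| 1 <<< u)

theorem eq_empty_of_mem_indOn_mask_zero {F : Finset (Fin n)}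
    (hF : F ∈ (indOn G (maskSet n 0)).faces) : F = ∅ := by
  simpa [maskSet_zero] using (mem_indOn.mp hF).1

/-- A maximal independent set meets the closed neighbourhood of every vertex `v`, as otherwise `v`
could be added. It therefore suffices to branch over the members of one such neighbourhood. -/
theorem allFacets_sound (hC : IsNbhdMask G C) {p : ℕ → Bool} (f : ℕ) : ∀ W M : ℕ,
    allFacets n C p f W M = true → ∀ F, (indOn G (maskSet n W)).IsFacet F →
      ∃ N, p N = true ∧ maskSet n N = maskSet n M ∪ F := by
  induction f with
  | zero =>
    intro W M h F hF
    simp only [allFacets, Bool.and_eq_true, beq_iff_eq] at h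
    obtain ⟨rfl, h⟩ := h
    exact ⟨M, h, by rw [eq_empty_of_mem_indOn_mask_zero hF.prop, Finset.union_empty]⟩
  | succ f ih =>
    intro W M h F hF
    rw [allFacets] at h
    by_cases hW : W = 0
    · subst hW
      exact ⟨M, h, by rw [eq_empty_of_mem_indOn_mask_zero hF.prop, Finset.union_empty]⟩
    · rw [beq_false_of_ne hW, cond_false] at h
      simp only [List.any_eq_true, List.mem_range, Bool.and_eq_true] at h
      obtain ⟨v, hvn, hvW, h⟩ := h
      lift v to Fin n using hvn
      obtain ⟨u, huF, huv⟩ : ∃ u ∈ F, (C v).testBit u = true := by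
        by_contra! hne
        have hv : v ∈ F := hF.le_of_ge (insert_mem_indOn.mpr ⟨mem_maskSet.mpr hvW, hF.prop,
          fun y hy hvy => hne y hy ((hC v y).mpr (Or.inr hvy))⟩) (Finset.subset_insert _ _)
          (Finset.mem_insert_self _ _)
        exact hne v hv ((hC v v).mpr (Or.inl rfl))
      have huW := (mem_indOn.mp hF.prop).1 huF
      have h1 := allVertices_eq_true h (i := u)
        (by rw [mem_maskSet, Nat.testBit_and, huv, mem_maskSet.mp huW]; rfl)
      have h2 := hF.erase (singleton_mem_indOn huW) huF
      rw [hC.link huW] at h2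
      obtain ⟨N, hN, hN'⟩ := ih _ _ h1 _ h2
      refine ⟨N, hN, hN'.trans ?_⟩
      ext y
      simp only [Finset.mem_union, mem_maskSet, Finset.mem_erase, Nat.testBit_or, Bool.or_eq_true,
        testBit_one_shiftLeft, decide_eq_true_eq, Fin.val_inj]
      by_cases hy : y = u
      · subst hy
        simp [huF]
      · have : ¬ u = y := fun h => hy h.symm
        simp [hy, this]

theorem isPure_of_allFacets (hC : IsNbhdMask G C) {L : List ℕ} {d : ℕ}
    (h : allFacets n C (fun M => L.contains M) n (fullMask n) 0 = true)
    (hL : ∀ M ∈ L, (maskSet n M).card = d) : (indComplex G).IsPure := by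
  refine FacetsHaveCard.isPure (d := d) fun F hF => ?_
  rw [← indOn_fullMask] at hF
  obtain ⟨N, hN, hN'⟩ := allFacets_sound hC n _ _ h F hF
  rw [maskSet_zero, Finset.empty_union] at hN'
  rw [← hN', hL N (by simpa using hN)]

/-- A list of pairs of a facet and its restriction set, in the reverse order of a shelling. -/
def isReverseShelling (n : ℕ) : List (ℕ × ℕ) → Bool
  | [] => true
  | M :: L => (L.all fun N => anyVertex n (maskDiff (M.1 &&& M.2) N.1)) &&
      ((allVertices n M.2 fun x => L.any fun N => maskDiff M.1 N.1 == 1 <<< x) &&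
        isReverseShelling n L)

theorem isReverseShelling_append {L L' : List (ℕ × ℕ)} (h : isReverseShelling n (L ++ L') = true) :
    isReverseShelling n L' = true := by
  induction L with
  | nil => exact h
  | cons M L ih =>
    simp only [List.cons_append, isReverseShelling, Bool.and_eq_true] at h
    exact ih h.2.2

/-- Every earlier facet misses some `x` in the restriction set of `M`, and each such `x` is the
whole difference between `M` and some earlier facet. -/
theorem isReverseShelling_cons {M : ℕ × ℕ} {L : List (ℕ × ℕ)}
    (h : isReverseShelling n (M :: L) = true) {N : ℕ × ℕ} (hN : N ∈ L) :
    ∃ x ∈ maskSet n M.1 \ maskSet n N.1, ∃ K ∈ L, maskSet n M.1 \ maskSet n K.1 = {x} := by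
  simp only [isReverseShelling, Bool.and_eq_true, List.all_eq_true] at h
  obtain ⟨x, hx⟩ := anyVertex_eq_true (h.1 N hN)
  rw [mem_maskSet_maskDiff, mem_maskSet, Nat.testBit_and, Bool.and_eq_true] at hx
  have h1 := allVertices_eq_true h.2.1 (mem_maskSet.mpr hx.1.2)
  simp only [List.any_eq_true, beq_iff_eq] at h1
  obtain ⟨K, hK, hKx⟩ := h1
  refine ⟨x, by simp [mem_maskSet, hx.1.1, hx.2], K, hK, ?_⟩
  ext y
  have := testBit_maskDiff M.1 K.1 y
  rw [hKx, testBit_one_shiftLeft] at this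
  rw [Finset.mem_sdiff, mem_maskSet, mem_maskSet, Bool.not_eq_true, Finset.mem_singleton]
  rw [Bool.eq_iff_iff, decide_eq_true_eq, Bool.and_eq_true, Bool.not_eq_true', Fin.val_inj] at this
  rw [← this, eq_comm]

theorem isShellable_of_isReverseShelling (hpure : (indComplex G).IsPure) {L : List (ℕ × ℕ)}
    (h : isReverseShelling n L = true)
    (hfacet : ∀ F, (indComplex G).IsFacet F ↔ ∃ M ∈ L, maskSet n M.1 = F) :
    (indComplex G).IsShellable := by
  let F : Fin L.length → Finset (Fin n) := fun i => maskSet n (L.get i.rev).1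
  have key : ∀ i j : Fin L.length, j < i →
      ∃ x ∈ F i \ F j, ∃ k < i, F i \ F k = {x} := by
    intro i j hji
    -- Indices run backwards through `L`, so the facets before `i` form the tail after position
    -- `i.rev`.
    have e : L = L.take i.rev ++ L.get i.rev :: L.drop (i.rev + 1) := by
      simp
    have h' := h
    rw [e] at h'
    have hj : L.get j.rev ∈ L.drop (i.rev + 1) := by
      rw [List.mem_drop_iff_getElem]
      refine ⟨j.rev - (i.rev + 1), ?_, ?_⟩
      · simp only [Fin.val_rev]; omega
      · simp only [List.get_eq_getElem]
        congr 1
        simp only [Fin.val_rev]; omega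
    obtain ⟨x, hx, K, hK, hKx⟩ := isReverseShelling_cons (isReverseShelling_append h') hj
    rw [List.mem_drop_iff_getElem] at hK
    obtain ⟨m, hm, rfl⟩ := hK
    refine ⟨x, hx, Fin.rev ⟨m + (i.rev + 1), by omega⟩, ?_, ?_⟩
    · rw [← Fin.rev_lt_rev, Fin.rev_rev, Fin.lt_def]
      simp only
      omega
    · simp only [F, Fin.rev_rev]
      convert hKx using 4
      simp only [List.get_eq_getElem]
      congr 1
      omega
  refine ⟨hpure, L.length, F, fun i j hij => ?_, fun H => ?_, key⟩
  -- A repeated facet would contradict the shelling condition, whose `x` lies in an empty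
  -- difference.
  · by_contra hne
    rcases lt_or_gt_of_ne hne with hlt | hlt
    · obtain ⟨x, hx, -⟩ := key j i hlt
      simp [hij] at hx
    · obtain ⟨x, hx, -⟩ := key i j hlt
      simp [hij] at hx
  · rw [hfacet]
    constructor
    · rintro ⟨M, hM, rfl⟩
      obtain ⟨i, rfl⟩ := List.mem_iff_get.mp hM
      exact ⟨i.rev, by simp only [F, Fin.rev_rev]⟩
    · rintro ⟨i, rfl⟩
      exact ⟨_, List.get_mem L i.rev, rfl⟩

end Facets

/-! ### Neighbourhood masks of circulant graphs. -/

section CirculantMasks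

/-- The mask of the numbers `n - 1 - i` where `i < k` is a bit of `t`. -/
def reverseBits (n t : ℕ) : ℕ → ℕ
  | 0 => 0
  | k + 1 => reverseBits n t k ||| ((t >>> k) &&& 1) <<< (n - 1 - k)

/-- The mask of the closed neighbourhood of the vertex `0` of `circulant n (stepSet n t)`. -/
def baseMask (n t : ℕ) : ℕ :=
  1 ||| (t <<< 1 ||| reverseBits n t (n / 2))

/-- The mask of the closed neighbourhood of the vertex `i` of a circulant graph, where `b` is that
of the vertex `0`. -/
def rotateMask (n b i : ℕ) : ℕ :=
  b <<< i ||| b >>> (n - i)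

/-- The set of the steps `i + 1` where `i < n / 2` is a bit of `t`. -/
def stepSet (n t : ℕ) : Finset ℕ :=
  ((Finset.range (n / 2)).filter fun i => t.testBit i).image (· + 1)

theorem mem_stepSet {n t s : ℕ} : s ∈ stepSet n t ↔ ∃ i < n / 2, t.testBit i = true ∧ i + 1 = s := by
  simp [stepSet, and_assoc]

/-- Bit `i` encodes the step `i + 1`, so the step sets are numbered by `t < 2 ^ (n / 2)`, the order
in which certificates are listed. -/
theorem exists_eq_stepSet {n : ℕ} {T : Finset ℕ} (hT : T ⊆ Finset.Icc 1 (n / 2)) :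
    ∃ t < 2 ^ (n / 2), T = stepSet n t := by
  refine ⟨Nat.ofBits fun i : Fin (n / 2) => decide ((i : ℕ) + 1 ∈ T), Nat.ofBits_lt_two_pow _, ?_⟩
  ext s
  rw [mem_stepSet]
  constructor
  · intro hs
    have := Finset.mem_Icc.mp (hT hs)
    have hlt : s - 1 < n / 2 := by omega
    refine ⟨s - 1, hlt, ?_, by omega⟩
    rw [Nat.testBit_ofBits_lt _ _ hlt, decide_eq_true_eq, Nat.sub_add_cancel this.1]
    exact hs
  · rintro ⟨i, hi, h, rfl⟩
    rw [Nat.testBit_ofBits_lt _ _ hi, decide_eq_true_eq] at h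
    exact h

theorem testBit_reverseBits {n t j : ℕ} (k : ℕ) :
    (reverseBits n t k).testBit j = true ↔ ∃ i < k, t.testBit i = true ∧ j = n - 1 - i := by
  induction k with
  | zero => simp [reverseBits]
  | succ k ih =>
    rw [reverseBits, Nat.testBit_or, Bool.or_eq_true, ih]
    have : (((t >>> k) &&& 1) <<< (n - 1 - k)).testBit j = true ↔
        t.testBit k = true ∧ j = n - 1 - k := by
      have e : (t >>> k) &&& 1 = if t.testBit k then 1 else 0 := by
        rw [Nat.and_one_is_mod, Nat.testBit_eq_decide_div_mod_eq, Nat.shiftRight_eq_div_pow]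
        rcases Nat.mod_two_eq_zero_or_one (t / 2 ^ k) with h | h <;> simp [h]
      rw [e]
      split_ifs with h
      · rw [testBit_one_shiftLeft, decide_eq_true_eq, h]
        exact ⟨fun h => ⟨rfl, h.symm⟩, fun h => h.2.symm⟩
      · simp [h]
    rw [this]
    constructor
    · rintro (⟨i, hi, h⟩ | h)
      · exact ⟨i, by omega, h⟩
      · exact ⟨k, by omega, h⟩
    · rintro ⟨i, hi, h⟩
      rcases Nat.lt_succ_iff_lt_or_eq.mp hi with hi | rfl
      · exact Or.inl ⟨i, hi, h⟩
      · exact Or.inr h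

theorem testBit_baseMask {n t j : ℕ} (ht : t < 2 ^ (n / 2)) (hn : 1 ≤ n) :
    (baseMask n t).testBit j = true ↔ j = 0 ∨ j ∈ stepSet n t ∨ n - j ∈ stepSet n t := by
  have hlow : ∀ i, t.testBit i = true → i < n / 2 := by
    intro i hi
    by_contra hge
    have h1 := Nat.testBit_lt_two_pow (lt_of_lt_of_le ht
      (Nat.pow_le_pow_right (by omega) (not_lt.mp hge)))
    simp [h1] at hi
  rw [baseMask, Nat.testBit_or, Nat.testBit_or, Bool.or_eq_true, Bool.or_eq_true,
    testBit_reverseBits, Nat.testBit_shiftLeft, mem_stepSet, mem_stepSet]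
  have h1 : (1 : ℕ).testBit j = true ↔ j = 0 := by
    have := testBit_one_shiftLeft 0 j
    rw [Nat.shiftLeft_zero] at this
    rw [this, decide_eq_true_eq, eq_comm]
  rw [h1]
  refine or_congr_right (or_congr ?_ ?_)
  · rw [Bool.and_eq_true, decide_eq_true_eq]
    exact ⟨fun h => ⟨j - 1, hlow _ h.2, h.2, Nat.sub_add_cancel h.1⟩,
      by rintro ⟨i, -, h, rfl⟩; exact ⟨by omega, h⟩⟩
  · refine exists_congr fun i => and_congr_right fun hi => and_congr_right fun _ => ?_
    omega

/-- The left shift accounts for `j ≥ i` and the right shift for the wrap-around `j < i`. Bits at or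
above `n` are never read at a vertex. -/
theorem isNbhdMask_circulant {n t : ℕ} (ht : t < 2 ^ (n / 2)) (hn : 1 ≤ n) :
    IsNbhdMask (circulant n (stepSet n t)) (rotateMask n (baseMask n t)) := by
  intro i j
  have hle : ∀ s ∈ stepSet n t, 1 ≤ s ∧ s ≤ n / 2 := by
    intro s hs
    obtain ⟨i, hi, -, rfl⟩ := mem_stepSet.mp hs
    omega
  have h0 : (0 : ℕ) ∉ stepSet n t := fun h => by have := hle 0 h; omega
  rw [rotateMask, Nat.testBit_or, Nat.testBit_shiftLeft, Nat.testBit_shiftRight, Bool.or_eq_true,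
    Bool.and_eq_true, decide_eq_true_eq, testBit_baseMask ht hn, testBit_baseMask ht hn]
  simp only [circulant]
  rcases lt_trichotomy i j with hij | rfl | hij
  · have hij' : (i : ℕ) < j := hij
    have e : ((i : ℤ) - (j : ℤ)).natAbs = (j : ℕ) - i := by omega
    have h1 : n - ((i : ℕ) + j) ≤ n := by omega
    rw [e]
    have h2 : ¬ (n - (i : ℕ) = 0) := by omega
    have h3 : n - (i : ℕ) + j ∉ stepSet n t := fun h => by have := hle _ h; omega
    have h4 : n - (n - (i : ℕ) + j) = 0 := by omega
    have h5 : ¬ ((j : ℕ) - i = 0) := by omega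
    simp [h2, h3, h4, h5, h0, hij.ne, hij'.le]
  · simp
  · have hij' : (j : ℕ) < i := hij
    have e : ((i : ℤ) - (j : ℤ)).natAbs = (i : ℕ) - j := by omega
    rw [e]
    have h2 : ¬ (n - (i : ℕ) + j = 0) := by omega
    have h3 : n - (i : ℕ) + j = n - (i - j) := by omega
    have h4 : n - (n - ((i : ℕ) - j)) = i - j := by omega
    rw [h3] at h2 ⊢
    simp [h2, h4, hij.ne', hij'.not_ge, or_comm]

end CirculantMasks

/-! ### Certificates, their soundness and their table. -/

section Certificates

/-- The evidence on which a circulant graph is classified. -/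
inductive Certificate
  | impure (l l' : List ℕ)
  | decomposable (order : List ℕ)
  | disconnected (A E : List ℕ) (U : ℕ)
  | cocycle (A E : List ℕ) (c : ℕ) (p : List ℕ)
  -- Carries no evidence: such a graph must be listed as an exception or, for Buchsbaumness, pass
  -- through its vertex links.
  | exceptional

/-- The size of a greedily chosen independent set in the mask `W`, with at most `f` elements. -/
def greedySize (C : ℕ → ℕ) : ℕ → ℕ → ℕ
  | 0, _ => 0
  | f + 1, W => bif W == 0 then 0 else greedySize C f (maskDiff W (C W.log2)) + 1

/-- Search for a vertex decomposition of the complex of the independent sets in a mask. -/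
def isDecomposableMask (n : ℕ) (C : ℕ → ℕ) (order : List ℕ) (W : ℕ) : Bool :=
  shedSearch n C order n W (greedySize C n W)

/-- The certificate shows that the independence complex is not pure or is vertex decomposable. -/
def checkDecomposable (n : ℕ) (C : ℕ → ℕ) : Certificate → Bool
  | .impure l l' => remaining n C l (fullMask n) == some 0 &&
      (remaining n C l' (fullMask n) == some 0 && !(l.length == l'.length))
  | .decomposable order => isDecomposableMask n C order (fullMask n)
  | _ => false

/-- The certificate shows that the independence complex is not pure, is vertex decomposable or is
not shellable. -/
def checkShellable (n : ℕ) (C : ℕ → ℕ) : Certificate → Bool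
  | .disconnected A E U => disconnectedLink n C A E U
  | .cocycle A E c p => nontrivialCocycle n C A E c p
  | c => checkDecomposable n C c

/-- The certificate shows that the independence complex is not pure or is vertex decomposable, or
the links of its vertices are vertex decomposable. -/
def checkBuchsbaum (n : ℕ) (C : ℕ → ℕ) (c : Certificate) : Bool :=
  checkDecomposable n C c || (List.range n).all fun x =>
    isDecomposableMask n C (List.range n) (maskDiff (fullMask n) (C x))

variable {n : ℕ} {G : SimpleGraph (Fin n)} {C : ℕ → ℕ}

/-- Nothing need be known about the greedy size: the search itself verifies it. -/
theorem isDecomposableMask_sound (hC : IsNbhdMask G C) {order : List ℕ} {W : ℕ}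
    (h : isDecomposableMask n C order W = true) :
    (indOn G (maskSet n W)).IsVertexDecomposable :=
  (shedSearch_sound hC _ _ _ _ h).1

theorem checkDecomposable_sound (hC : IsNbhdMask G C) {c : Certificate}
    (h : checkDecomposable n C c = true) (hp : (indComplex G).IsPure) :
    (indComplex G).IsVertexDecomposable := by
  cases c with
  | impure l l' =>
    simp only [checkDecomposable, Bool.and_eq_true, beq_iff_eq, Bool.not_eq_true',
      beq_eq_false_iff_ne] at h
    exact absurd hp (not_isPure_of_remaining hC h.1 h.2.1 h.2.2)
  | decomposable order =>
    rw [← indOn_fullMask]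
    exact isDecomposableMask_sound hC h
  | _ => simp [checkDecomposable] at h

theorem checkShellable_sound (hC : IsNbhdMask G C) {c : Certificate}
    (h : checkShellable n C c = true) (hs : (indComplex G).IsShellable) :
    (indComplex G).IsVertexDecomposable := by
  cases c with
  | disconnected A E U => exact absurd hs (not_isShellable_of_disconnectedLink hC h)
  | cocycle A E c p => exact absurd hs (not_isShellable_of_nontrivialCocycle hC h)
  | impure l l' => exact checkDecomposable_sound hC (c := .impure l l') h hs.1
  | decomposable order => exact checkDecomposable_sound hC (c := .decomposable order) h hs.1
  | exceptional => exact checkDecomposable_sound hC (c := .exceptional) h hs.1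

/-- Both branches go through vertex decomposability, so one computation serves every field. -/
theorem checkBuchsbaum_sound (k : Type*) [Field k] (hC : IsNbhdMask G C) {c : Certificate}
    (h : checkBuchsbaum n C c = true) (hp : (indComplex G).IsPure) :
    (indComplex G).IsBuchsbaum k := by
  rw [checkBuchsbaum, Bool.or_eq_true] at h
  rcases h with h | h
  · exact (checkDecomposable_sound hC h hp).isCohenMacaulay.isBuchsbaum
  · refine ⟨hp, fun x hx => ?_⟩
    simp only [List.all_eq_true, List.mem_range] at h
    have h1 := isDecomposableMask_sound hC (h x x.2)
    rw [← hC.link (by simp [maskSet_fullMask])] at h1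
    simp only [indOn_fullMask] at h1
    exact h1.isCohenMacaulay

/-- The multiples of `u` modulo `n`. -/
def multiples (n u : ℕ) : List ℕ :=
  (List.range n).map fun i => i * u % n

/-- Certificates for the circulant graphs on `n ≤ 16` vertices, in the order of the bit masks of
their sets of steps. -/
def certificates : ℕ → List Certificate
  | 1 => [
    .decomposable (multiples 1 1)]
  | 2 => [
    .decomposable (multiples 2 1),
    .decomposable (multiples 2 1)]
  | 3 => [
    .decomposable (multiples 3 1),
    .decomposable (multiples 3 1)]
  | 4 => [
    .decomposable (multiples 4 1),
    .disconnected [] [0, 2] 5,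
    .decomposable (multiples 4 1),
    .decomposable (multiples 4 1)]
  | 5 => [
    .decomposable (multiples 5 1),
    .decomposable (multiples 5 2),
    .decomposable (multiples 5 1),
    .decomposable (multiples 5 1)]
  | 6 => [
    .decomposable (multiples 6 1),
    .impure [0, 3] [0, 2, 4],
    .decomposable (multiples 6 1),
    .disconnected [] [0, 3] 9,
    .decomposable (multiples 6 1),
    .disconnected [] [0, 2] 21,
    .decomposable (multiples 6 1),
    .decomposable (multiples 6 1)]
  | 7 => [
    .decomposable (multiples 7 1),
    -- The complex of the 7-cycle is pure of dimension two with the homotopy type of a circle; the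
    -- odd closed path detects its first cohomology.
    .cocycle [] [0, 2, 4] 343666593800 [0, 2, 6, 3, 0],
    .cocycle [] [0, 1, 4] 558882621570 [0, 1, 2, 3, 0],
    .decomposable (multiples 7 3),
    .cocycle [] [0, 1, 2] 71219214811136 [0, 1, 3, 5, 0],
    .decomposable (multiples 7 2),
    .decomposable (multiples 7 1),
    .decomposable (multiples 7 1)]
  | 8 => [
    .decomposable (multiples 8 1),
    .impure [0, 2, 5] [0, 2, 4, 6],
    -- `C_8(2)`: the mask `34` is `{1, 5}`, one of the two components of the link of `{0, 4}`.
    .disconnected [0, 4] [1, 5] 34,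
    .decomposable (multiples 8 3),
    .impure [0, 1, 2] [0, 2, 4, 6],
    .disconnected [] [0, 2] 85,
    .decomposable (multiples 8 1),
    .disconnected [] [0, 4] 17,
    .decomposable (multiples 8 1),
    .cocycle [] [0, 2, 5] 5066824492271616 [0, 2, 4, 6, 0],
    .decomposable (multiples 8 1),
    .decomposable (multiples 8 3),
    .cocycle [] [0, 1, 2] 2319565189206245376 [0, 2, 4, 6, 0],
    .disconnected [] [0, 2] 85,
    .decomposable (multiples 8 1),
    .decomposable (multiples 8 1)]
  | 9 => [
    .decomposable (multiples 9 1),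
    .impure [0, 3, 6] [0, 2, 4, 6],
    .impure [0, 3, 6] [0, 1, 4, 5],
    .impure [0, 4] [0, 3, 6],
    .decomposable (multiples 9 1),
    .cocycle [] [0, 2, 4] 73787328160033947648 [0, 2, 6, 1, 5, 0],
    .cocycle [] [0, 1, 5] 578782920861303298 [0, 1, 2, 3, 4, 0],
    .decomposable (multiples 9 4),
    .impure [0, 3, 6] [0, 1, 2, 3],
    .impure [0, 2] [0, 3, 6],
    .impure [0, 1] [0, 3, 6],
    .disconnected [] [0, 3] 73,
    .cocycle [] [0, 1, 2] 303123820651822620606464 [0, 1, 3, 5, 7, 0],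
    .decomposable (multiples 9 2),
    .decomposable (multiples 9 1),
    .decomposable (multiples 9 1)]
  | 10 => [
    .decomposable (multiples 10 1),
    .impure [0, 2, 4, 7] [0, 2, 4, 6, 8],
    .decomposable (multiples 10 3),
    .impure [0, 5] [0, 3, 6],
    .impure [0, 1, 2, 6] [0, 2, 4, 6, 8],
    .impure [0, 5] [0, 2, 4, 6, 8],
    .disconnected [0, 5] [1, 6] 66,
    .decomposable [9, 3, 0, 4, 5, 8, 7, 6, 1, 2],
    .decomposable (multiples 10 1),
    .disconnected [0, 5] [2, 7] 132,
    .decomposable (multiples 10 1),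
    .decomposable (multiples 10 3),
    .impure [0, 5] [0, 1, 2],
    .decomposable [3, 5, 6, 4, 1, 9, 7, 0, 2, 8],
    .decomposable (multiples 10 1),
    .disconnected [] [0, 5] 33,
    .decomposable (multiples 10 1),
    .impure [0, 3, 6] [0, 2, 4, 6, 8],
    .cocycle [] [0, 1, 4] 174389910680984950155658242 [0, 1, 2, 3, 0],
    .cocycle [] [0, 3, 6] 21250649314750403575824 [0, 4, 8, 2, 6, 0],
    .impure [0, 1, 2] [0, 2, 4, 6, 8],
    .disconnected [] [0, 2] 341,
    .decomposable (multiples 10 1),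
    .disconnected [] [0, 4] 341,
    .cocycle [] [0, 1, 2] 79344352652659016773832540160 [0, 1, 4, 7, 0],
    .decomposable (multiples 10 3),
    .decomposable (multiples 10 1),
    .decomposable (multiples 10 3),
    .cocycle [] [0, 1, 2] 158689345775407300139865341952 [0, 2, 4, 6, 8, 0],
    .disconnected [] [0, 2] 341,
    .decomposable (multiples 10 1),
    .decomposable (multiples 10 1)]
  | 11 => [
    .decomposable (multiples 11 1),
    .impure [0, 2, 5, 8] [0, 2, 4, 6, 8],
    .impure [0, 1, 5, 6] [0, 1, 4, 5, 8],
    .cocycle [] [0, 3, 6] 93484166736597095309017420709560464 [0, 3, 9, 4, 0],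
    .impure [0, 2, 4, 6] [0, 1, 2, 6, 7],
    .cocycle [] [0, 2, 4] 25353018351448235471123945619488 [0, 4, 10, 5, 0],
    .cocycle [] [0, 1, 5] 40273550586879855291252875264 [0, 1, 8, 4, 0],
    .decomposable (multiples 11 4),
    .impure [0, 1, 2, 3] [0, 1, 3, 6, 9],
    .cocycle [] [0, 2, 5] 92538571189241377351949945552896 [0, 2, 4, 6, 0],
    .cocycle [] [0, 1, 6] 208053164481235946364238913734658 [0, 1, 2, 3, 0],
    .cocycle [] [0, 3, 6] 11141460362827823309039599648 [0, 3, 9, 4, 10, 5, 0],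
    .cocycle [] [0, 1, 2] 332555933910220039518453240157962240 [0, 1, 3, 5, 0],
    .decomposable (multiples 11 2),
    .cocycle [] [0, 1, 6] 9680998863835362364622850 [0, 1, 2, 3, 4, 5, 0],
    .decomposable (multiples 11 5),
    .impure [0, 1, 4, 8] [0, 1, 2, 3, 4],
    .cocycle [] [0, 2, 4] 166175049694105521224093395175079944 [0, 2, 5, 8, 0],
    .cocycle [] [0, 1, 4] 162428255644585618230025225013250 [0, 1, 2, 3, 0],
    .cocycle [] [0, 3, 7] 10522490343149139557869977600 [0, 3, 6, 2, 5, 8, 0],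
    .cocycle [] [0, 1, 2] 83178226273760003439743267938238592 [0, 1, 3, 7, 0],
    .cocycle [] [0, 2, 4] 20282415648303826928284773384192 [0, 2, 6, 10, 3, 7, 0],
    .decomposable (multiples 11 1),
    .decomposable (multiples 11 4),
    .cocycle [] [0, 1, 2] 166275263526234655331658368125239296 [0, 2, 5, 8, 0],
    .decomposable (multiples 11 2),
    .decomposable (multiples 11 1),
    .decomposable (multiples 11 3),
    .cocycle [] [0, 1, 2] 332550863307819126312400960530415616 [0, 1, 3, 5, 7, 9, 0],
    .decomposable (multiples 11 2),
    .decomposable (multiples 11 1),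
    .decomposable (multiples 11 1)]
  | 12 => [
    .decomposable (multiples 12 1),
    .impure [0, 3, 6, 9] [0, 2, 4, 6, 9],
    .impure [0, 1, 6, 7] [0, 1, 4, 7, 8],
    .impure [0, 3, 7] [0, 3, 6, 9],
    .disconnected [0, 1, 6, 7] [2, 8] 260,
    .impure [0, 2, 7] [0, 2, 4, 6, 8, 10],
    .impure [0, 4, 8] [0, 1, 5, 6],
    .impure [0, 5] [0, 4, 8],
    .decomposable (multiples 12 1),
    .disconnected [0, 3] [5, 10] 1056,
    .disconnected [0, 6] [1, 7] 130,
    .impure [0, 5] [0, 3, 6, 9],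
    .cocycle [] [0, 1, 2] 2788625632935480323045686497379995478917120 [0, 1, 3, 5, 0],
    .impure [0, 6] [0, 2, 7],
    .disconnected [0, 6] [1, 7] 130,
    .decomposable (multiples 12 5),
    .impure [0, 3, 6, 9] [0, 1, 2, 3, 4],
    .impure [0, 3, 6, 9] [0, 2, 4, 6, 8, 10],
    .impure [0, 1, 4] [0, 3, 6, 9],
    .impure [0, 4, 8] [0, 3, 6, 9],
    .impure [0, 1, 2] [0, 2, 4, 6, 8, 10],
    .disconnected [] [0, 2] 1365,
    .impure [0, 1] [0, 4, 8],
    .impure [0, 6] [0, 4, 8],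
    .disconnected [0, 3] [1, 2] 6,
    .impure [0, 2] [0, 3, 6, 9],
    .impure [0, 1] [0, 3, 6, 9],
    .disconnected [] [0, 3] 585,
    .impure [0, 6] [0, 1, 2],
    .disconnected [] [0, 2] 1365,
    .decomposable (multiples 12 1),
    .disconnected [] [0, 6] 65,
    .decomposable (multiples 12 1),
    .impure [0, 4, 8] [0, 2, 4, 7, 9],
    .disconnected [0, 4, 8] [1, 5] 546,
    .cocycle [] [0, 3, 7] 370407990217427690927933000921421365379072 [0, 3, 6, 9, 0],
    .decomposable (multiples 12 1),
    .decomposable (multiples 12 5),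
    .cocycle [] [0, 1, 5] 88309769870624421307329484835262498 [0, 1, 2, 7, 0],
    .impure [0, 5] [0, 4, 8],
    .decomposable (multiples 12 1),
    .cocycle [] [0, 2, 5] 353574730543727237559924526669681917960 [0, 3, 6, 9, 0],
    .decomposable (multiples 12 1),
    .decomposable (multiples 12 5),
    .cocycle [] [0, 1, 2] 42846606381690335363897661157539840 [0, 1, 6, 5, 0],
    .cocycle [] [0, 2, 7] 41538384849170187766622439172210692 [0, 2, 4, 6, 8, 10, 0],
    .decomposable (multiples 12 1),
    .decomposable (multiples 12 5),
    .impure [0, 4, 8] [0, 1, 2, 3, 4],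
    .impure [0, 3] [0, 2, 4],
    .cocycle [] [0, 1, 4] 83444368410623742187141387467690498 [0, 1, 2, 3, 0],
    .impure [0, 3] [0, 4, 8],
    .decomposable (multiples 12 1),
    .disconnected [] [0, 2] 1365,
    .impure [0, 1] [0, 4, 8],
    .disconnected [] [0, 4] 273,
    .cocycle [] [0, 1, 2] 1394307144126840840446268927096684911001600 [0, 3, 6, 9, 0],
    .decomposable (multiples 12 1),
    .decomposable (multiples 12 1),
    .disconnected [] [0, 3] 585,
    .cocycle [] [0, 1, 2] 2788614993919217185183866267454424708284416 [0, 2, 4, 6, 8, 10, 0],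
    .disconnected [] [0, 2] 1365,
    .decomposable (multiples 12 1),
    .decomposable (multiples 12 1)]
  | 13 => [
    .decomposable (multiples 13 1),
    .impure [0, 2, 4, 7, 10] [0, 2, 4, 6, 8, 10],
    .impure [0, 1, 4, 7, 8] [0, 1, 4, 5, 8, 9],
    .impure [0, 3, 8] [0, 3, 6, 9],
    .impure [0, 1, 5, 7, 9] [0, 1, 2, 6, 7, 8],
    .cocycle [] [0, 2, 4] 11692459113558172415315372048760860372762805403680 [0, 2, 10, 5, 0],
    .decomposable (multiples 13 4),
    .impure [0, 6] [0, 4, 8],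
    .impure [0, 1, 2, 3, 8] [0, 1, 3, 6, 8, 11],
    .cocycle [] [0, 2, 5] 5851916247153467747396466332550129816919670849536 [0, 2, 4, 6, 0],
    .impure [0, 3, 6] [0, 1, 6, 7],
    .cocycle [] [0, 3, 6] 3300510290753339160422483742584157817526026304 [0, 5, 12, 6, 0],
    .cocycle [] [0, 1, 2] 93553329392927657126817466262501109377298633588736 [0, 1, 3, 5, 0],
    .cocycle [] [0, 2, 7] 95003588645304620855698297743565676275939716104192 [0, 2, 4, 6, 0],
    .cocycle [] [0, 1, 6] 42878230856599370690733109016304582656 [0, 1, 2, 10, 5, 0],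
    .decomposable (multiples 13 5),
    .impure [0, 1, 2, 3, 4] [0, 1, 3, 4, 7, 10],
    .decomposable (multiples 13 2),
    .cocycle [] [0, 1, 4] 13026425511353561986419646768547686145280057346 [0, 1, 2, 3, 0],
    .cocycle [] [0, 3, 6] 1427272193036383303795897664805176477242884112 [0, 3, 12, 8, 4, 0],
    .impure [0, 1, 2] [0, 2, 4, 6],
    .cocycle [] [0, 2, 4] 356811929822630053176213326549844283295268864 [0, 2, 8, 1, 7, 0],
    .impure [0, 4] [0, 1, 7],
    .decomposable (multiples 13 4),
    .impure [0, 1, 7] [0, 1, 2, 3],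
    .impure [0, 2] [0, 3, 6],
    .cocycle [] [0, 1, 7] 11420790912871575143241050323781758026144292866 [0, 1, 2, 3, 0],
    .cocycle [] [0, 3, 6] 21778071482984627503075436712300265865216 [0, 3, 9, 2, 8, 1, 7, 0],
    .cocycle [] [0, 1, 2] 93553418530571578344498282387177793146323682197504 [0, 2, 4, 6, 0],
    .decomposable (multiples 13 2),
    .cocycle [] [0, 1, 7] 2596787206327685070487096113766402 [0, 1, 2, 3, 4, 5, 6, 0],
    .decomposable (multiples 13 6),
    .impure [0, 1, 2, 5, 10] [0, 1, 2, 3, 4, 5],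
    .impure [0, 2, 4] [0, 2, 5, 10],
    .cocycle [] [0, 1, 4] 11443336672005518517310904056990112526272856064 [0, 1, 2, 3, 0],
    .cocycle [] [0, 3, 8] 71616434725280344423008046048316119806676937211912 [0, 3, 6, 9, 0],
    .impure [0, 1, 2] [0, 1, 5, 9],
    .cocycle [] [0, 2, 4] 1462215266621774113680817667862027352546492809472 [0, 2, 10, 5, 0],
    .cocycle [] [0, 1, 5] 740624903910421521668623518024728806957058 [0, 1, 2, 3, 4, 0],
    .cocycle [] [0, 4, 8] 5649218982085911386200599632195616800 [0, 4, 12, 7, 2, 10, 5, 0],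
    .decomposable (multiples 13 1),
    .cocycle [] [0, 2, 5] 6444915702659015083755678874814408477959585792 [0, 2, 4, 1, 3, 0],
    .impure [0, 1] [0, 3, 8],
    .cocycle [] [0, 3, 8] 179669089736790809909265825479627565432832 [0, 3, 6, 1, 4, 7, 10, 0],
    .impure [0, 5] [0, 1, 2],
    .decomposable (multiples 13 2),
    .decomposable (multiples 13 1),
    .decomposable (multiples 13 5),
    .cocycle [] [0, 1, 2] 23388308550238475550750728152941061415697991598080 [0, 1, 5, 9, 0],
    .impure [0, 3] [0, 2, 4],
    .cocycle [] [0, 1, 4] 12848019549765316996335600856001606116779892738 [0, 1, 2, 3, 0],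
    .decomposable (multiples 13 3),
    .cocycle [] [0, 1, 2] 23391163568728387158436418551572953771113751511552 [0, 1, 5, 9, 0],
    .cocycle [] [0, 2, 4] 7136238803978324896305408707652664983029809664 [0, 2, 6, 10, 1, 5, 9, 0],
    .decomposable (multiples 13 1),
    .decomposable (multiples 13 4),
    .cocycle [] [0, 1, 2] 46776617101508182780768605655982158930225953505280 [0, 1, 4, 7, 10, 0],
    .decomposable (multiples 13 2),
    .decomposable (multiples 13 1),
    .decomposable (multiples 13 3),
    .cocycle [] [0, 1, 2] 93553240124609990099513145264833234050183608664064 [0, 1, 3, 5, 7, 9, 11, 0],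
    .decomposable (multiples 13 2),
    .decomposable (multiples 13 1),
    .decomposable (multiples 13 1)]
  | 14 => [
    .decomposable (multiples 14 1),
    .impure [0, 2, 5, 8, 11] [0, 2, 4, 6, 8, 11],
    .cocycle [0, 4, 8] [1, 5, 9] 3105690979328169350853762886489678691028506247168 [1, 5, 13, 7, 1],
    .impure [0, 4, 9] [0, 3, 6, 9],
    .impure [0, 1, 5, 6, 10] [0, 1, 2, 6, 7, 8],
    .impure [0, 2, 4, 9] [0, 2, 4, 6, 8, 10, 12],
    .impure [0, 1, 6, 7] [0, 1, 5, 6, 10],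
    .impure [0, 7] [0, 4, 8],
    .cocycle [0, 2, 8] [1, 3, 9] 11692013273552359942991848881904814637772227870720 [1, 3, 5, 7, 1],
    .impure [0, 2, 5, 7] [0, 2, 5, 8, 11],
    .decomposable (multiples 14 3),
    .impure [0, 7] [0, 3, 6, 9],
    .disconnected [0, 1, 7, 8] [2, 9] 516,
    .impure [0, 2, 8] [0, 2, 7, 9],
    .cocycle [] [0, 1, 6] 92065928113005532972683226985916954792280719360 [0, 1, 10, 5, 0],
    .decomposable (multiples 14 5),
    .impure [0, 1, 2, 3, 4] [0, 1, 2, 4, 8, 12],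
    .impure [0, 3, 6, 10] [0, 2, 4, 6, 8, 10, 12],
    .disconnected [0, 3, 7, 10] [4, 11] 2064,
    .cocycle [] [0, 3, 6] 5992933135801544728904050223841473314112883355025664 [0, 4, 12, 6, 0],
    .impure [0, 1, 2, 8] [0, 2, 4, 6, 8, 10, 12],
    .impure [0, 7] [0, 2, 4, 6, 8, 10, 12],
    .impure [0, 4, 8] [0, 1, 7, 8],
    .impure [0, 7] [0, 4, 8],
    .impure [0, 3, 6] [0, 1, 2, 3],
    .impure [0, 7] [0, 2, 8],
    .impure [0, 3, 6] [0, 1, 7, 8],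
    .impure [0, 7] [0, 3, 6],
    .cocycle [] [0, 1, 2] 12555359110084491628663336162712645743247677764771376005120 [0, 2, 4, 6, 0],
    .impure [0, 7] [0, 2, 8],
    .disconnected [0, 7] [1, 8] 258,
    .decomposable [9, 1, 3, 8, 13, 11, 5, 7, 0, 6, 2, 4, 12, 10],
    .cocycle [0, 2, 4] [1, 3, 5] 3138550882308357626349783860280255318306456510430005166080 [1, 3, 7, 11, 1],
    .disconnected [0, 2, 7, 9] [4, 11] 2064,
    .decomposable (multiples 14 5),
    .impure [0, 4, 9] [0, 3, 7, 10],
    .impure [0, 1, 2] [0, 1, 5, 10],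
    .cocycle [] [0, 2, 4] 481898017628830036476923994845511018914684963798909952 [0, 2, 6, 10, 0],
    .impure [0, 7] [0, 1, 5, 10],
    .impure [0, 7] [0, 4, 9],
    .decomposable (multiples 14 1),
    .cocycle [] [0, 2, 5] 386865335340037549035811963636125553824870726872596488 [0, 3, 6, 9, 0],
    .decomposable (multiples 14 1),
    .decomposable (multiples 14 3),
    .impure [0, 1, 2] [0, 2, 7, 9],
    .disconnected [0, 7] [2, 9] 516,
    .decomposable (multiples 14 1),
    .decomposable (multiples 14 5),
    .impure [0, 1, 4, 11] [0, 1, 2, 3, 4],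
    .impure [0, 2, 4] [0, 3, 7, 10],
    .cocycle [] [0, 1, 4] 766347198216209108549923401555706000221728021021999106 [0, 1, 2, 3, 0],
    .disconnected [0, 7] [3, 10] 1032,
    .impure [0, 7] [0, 1, 2],
    .impure [0, 7] [0, 2, 4],
    .decomposable (multiples 14 1),
    .decomposable [3, 11, 9, 7, 13, 10, 6, 2, 0, 4, 5, 8, 1, 12],
    .impure [0, 7] [0, 1, 2, 3],
    .decomposable (multiples 14 3),
    .decomposable (multiples 14 1),
    .decomposable (multiples 14 3),
    .impure [0, 7] [0, 1, 2],
    .decomposable [9, 0, 6, 7, 2, 12, 10, 5, 4, 3, 11, 1, 13, 8],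
    .decomposable (multiples 14 1),
    .disconnected [] [0, 7] 129,
    .decomposable (multiples 14 1),
    .impure [0, 2, 5, 8, 10] [0, 2, 4, 6, 8, 10, 12],
    .impure [0, 3, 6, 9] [0, 1, 4, 5, 9, 10],
    .impure [0, 4, 8] [0, 3, 6, 9],
    .impure [0, 1, 2, 6, 10] [0, 2, 4, 6, 8, 10, 12],
    .impure [0, 4, 9] [0, 2, 4, 6, 8, 10, 12],
    .cocycle [] [0, 1, 5] 23970867636679542515207386183719726644840958871535616 [0, 1, 2, 8, 0],
    .cocycle [] [0, 4, 8] 784711049412177515530684996791192681721092295848225669120 [0, 4, 12, 6, 0],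
    .impure [0, 1, 2, 3] [0, 1, 3, 6, 9, 12],
    .cocycle [] [0, 2, 5] 437748976122355233192060153421875273991122266119864320 [0, 2, 4, 6, 0],
    .cocycle [] [0, 1, 6] 984841648039313855902372496772657208122485645308346370 [0, 1, 2, 3, 0],
    .cocycle [] [0, 3, 6] 218500340787869290297501961706935434757892385583136768 [0, 5, 10, 1, 6, 0],
    .cocycle [] [0, 1, 2] 12555356118390706915901787659362277420117815216902959529984 [0, 1, 3, 5, 0],
    .impure [0, 5] [0, 2, 8],
    .cocycle [] [0, 1, 6] 731531432029827146133154060095137079030160834626 [0, 1, 2, 8, 0],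
    .decomposable (multiples 14 5),
    .impure [0, 1, 2, 3, 4] [0, 2, 4, 6, 8, 10, 12],
    .impure [0, 3, 6] [0, 2, 4, 6, 8, 10, 12],
    .cocycle [] [0, 1, 4] 868109364971125673192983012309156580815792801858207746 [0, 1, 2, 3, 0],
    .cocycle [] [0, 3, 6] 25447689345174220245738134728555187894687563595646984 [0, 3, 7, 4, 0],
    .impure [0, 1, 2] [0, 2, 4, 6, 8, 10, 12],
    .disconnected [] [0, 2] 5461,
    .impure [0, 1] [0, 4, 8],
    .disconnected [] [0, 4] 5461,
    .impure [0, 2, 8] [0, 1, 2, 3],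
    .cocycle [] [0, 2, 8] 389858490470294845237596050816254888476318036385726464 [0, 2, 4, 6, 0],
    .impure [0, 1] [0, 3, 6],
    .cocycle [] [0, 3, 6] 730750818665638381788752390235862740680180760576 [0, 6, 12, 4, 10, 2, 8, 0],
    .cocycle [] [0, 1, 2] 362408896187688953856533058845990001454350336 [0, 1, 7, 6, 0],
    .disconnected [] [0, 2] 5461,
    .decomposable (multiples 14 1),
    .disconnected [] [0, 6] 5461,
    .impure [0, 1, 5, 10] [0, 1, 2, 3, 4, 5],
    .cocycle [] [0, 2, 4] 6277201257814043233066426245139504745261298782008274059272 [0, 2, 6, 3, 0],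
    .cocycle [] [0, 1, 4] 767098455908129320082063238068287732860449104024633344 [0, 1, 2, 3, 0],
    .impure [0, 3] [0, 4, 9],
    .impure [0, 1, 2] [0, 1, 5, 10],
    .cocycle [] [0, 2, 4] 383498035701431625386195381949605666222033602558824452 [0, 2, 6, 10, 0],
    .cocycle [] [0, 1, 5] 23386972683253802549861958818804557721143897243650 [0, 1, 2, 3, 4, 0],
    .cocycle [] [0, 4, 9] 91990573943938840265877827624000324438065152 [0, 4, 8, 12, 2, 6, 10, 0],
    .cocycle [] [0, 1, 2] 7846999787950359982842619340295871523032506252211020366336 [0, 1, 4, 9, 0],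
    .cocycle [] [0, 2, 5] 386865335340037549035811963636125553824870726872596488 [0, 3, 6, 9, 0],
    .decomposable (multiples 14 1),
    .decomposable (multiples 14 3),
    .impure [0, 5] [0, 1, 2],
    .decomposable (multiples 14 5),
    .decomposable (multiples 14 1),
    .decomposable (multiples 14 5),
    .cocycle [] [0, 1, 2] 3138838231069615010144897927772649051855972982235070464000 [0, 2, 6, 10, 0],
    .impure [0, 3] [0, 2, 4],
    .cocycle [] [0, 1, 4] 862122323513799629367791796130076756009815034103611394 [0, 1, 2, 3, 0],
    .decomposable (multiples 14 3),
    .cocycle [] [0, 1, 2] 3138646663280821470292625341068564074691152124560107634688 [0, 2, 6, 10, 0],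
    .disconnected [] [0, 2] 5461,
    .decomposable (multiples 14 1),
    .disconnected [] [0, 4] 5461,
    .cocycle [] [0, 1, 2] 6277676462156533307805188365908598308401057425588538572800 [0, 2, 5, 8, 11, 0],
    .decomposable (multiples 14 3),
    .decomposable (multiples 14 1),
    .decomposable (multiples 14 3),
    .cocycle [] [0, 1, 2] 12555353123043034302619531741317416589496562697754285965312 [0, 2, 4, 6, 8, 10, 12, 0],
    .disconnected [] [0, 2] 5461,
    .decomposable (multiples 14 1),
    .decomposable (multiples 14 1)]
  | 15 => [
    .decomposable (multiples 15 1),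
    .impure [0, 3, 6, 9, 12] [0, 2, 4, 6, 9, 12],
    .impure [0, 3, 6, 9, 12] [0, 1, 4, 5, 9, 10],
    .impure [0, 5, 10] [0, 3, 6, 10],
    .decomposable (multiples 15 2),
    .impure [0, 5, 10] [0, 2, 4, 6, 8, 10],
    .impure [0, 1, 7, 8] [0, 1, 5, 9, 10],
    .cocycle [] [0, 4, 8] 645065907910207229520199463572703653179999472714500383876013097216 [0, 4, 12, 5, 0],
    .impure [0, 3, 6, 9, 12] [0, 1, 3, 6, 8, 9],
    .impure [0, 2, 5, 8, 10] [0, 2, 5, 7, 10, 12],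
    .impure [0, 5, 10] [0, 1, 6, 7],
    .impure [0, 3, 8] [0, 3, 6, 9, 12],
    .impure [0, 5, 10] [0, 1, 2, 7, 8, 9],
    .impure [0, 5, 10] [0, 2, 7, 9],
    .impure [0, 5, 10] [0, 1, 6, 7],
    .impure [0, 6] [0, 5, 10],
    .decomposable (multiples 15 1),
    .disconnected [0, 3, 9] [6, 12] 4160,
    .disconnected [0, 3, 6] [7, 14] 16512,
    .impure [0, 3, 7, 11] [0, 3, 6, 9, 12],
    .disconnected [0, 2, 8] [1, 9] 514,
    .cocycle [] [0, 2, 4] 8034690229151984187405289290361944980588683558296515231350912 [0, 6, 14, 7, 0],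
    .impure [0, 4, 8] [0, 1, 7, 8],
    .impure [0, 6] [0, 4, 8],
    .disconnected [0, 3, 9] [1, 2] 6,
    .impure [0, 2, 8] [0, 3, 6, 9, 12],
    .impure [0, 1, 7, 8] [0, 3, 6, 9, 12],
    .impure [0, 7] [0, 3, 6, 9, 12],
    .cocycle [] [0, 1, 2] 6740296040171294409000898611933999028483398558271323709106078875648 [0, 2, 4, 6, 0],
    .cocycle [] [0, 2, 8] 1581559910501983781793647724810632416794502470313592225792 [0, 2, 4, 6, 0],
    .cocycle [] [0, 1, 7] 733650438220292942654861602968616055486162272256 [0, 6, 12, 3, 9, 0],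
    .decomposable (multiples 15 7),
    .decomposable (multiples 15 1),
    .impure [0, 3, 7, 11] [0, 2, 4, 7, 12],
    .impure [0, 5, 10] [0, 1, 4, 5, 8, 12],
    .impure [0, 5, 10] [0, 3, 7, 10],
    .decomposable (multiples 15 1),
    .decomposable (multiples 15 2),
    .decomposable (multiples 15 4),
    .disconnected [0] [4, 8] 2448,
    .impure [0, 1, 2, 3] [0, 1, 3, 8, 13],
    .disconnected [0, 5, 10] [2, 7] 4228,
    .cocycle [] [0, 1, 8] 218852110071620479550722836861200840675931159169749600811798904832 [0, 1, 2, 3, 0],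
    .cocycle [] [0, 3, 8] 3314309728630933275479489585839887520350795621767469999325184 [0, 3, 6, 9, 12, 0],
    .decomposable (multiples 15 7),
    .cocycle [] [0, 2, 7] 1618315297006094174520851311648892391862755684865376518276 [0, 2, 4, 6, 8, 0],
    .disconnected [0] [1, 8] 16770,
    .impure [0, 7] [0, 5, 10],
    .disconnected [0, 1, 4] [2, 3] 12,
    .impure [0, 2, 4] [0, 3, 7, 11],
    .cocycle [] [0, 1, 4] 205701460611186841595772543001988047956627068119541148226715650 [0, 1, 2, 3, 0],
    .cocycle [] [0, 3, 7] 836742565312953722670439473666052653594515620230943211520 [0, 3, 6, 9, 12, 0],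
    .decomposable [11, 2, 13, 9, 10, 12, 4, 1, 5, 3, 7, 8, 0, 14, 6],
    .cocycle [] [0, 2, 4] 27317946782708533082096087107264671123339464132604239143764096 [0, 2, 6, 14, 7, 0],
    .cocycle [] [0, 1, 8] 3555581216751481543999000222247144645811283756261031575554 [0, 1, 2, 3, 4, 0],
    .cocycle [] [0, 4, 8] 6360455125664089583139750947745809170936048235053184 [0, 4, 12, 5, 13, 6, 14, 7, 0],
    .impure [0, 1, 8] [0, 1, 2, 3],
    .decomposable (multiples 15 2),
    .impure [0, 3] [0, 1, 8],
    .decomposable (multiples 15 7),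
    .cocycle [] [0, 1, 2] 6740296843493195469995234425668056936928311458954111945815720198144 [0, 1, 3, 5, 7, 0],
    .decomposable (multiples 15 2),
    .cocycle [] [0, 1, 8] 11151055822455145017526531693153164858523650 [0, 1, 2, 3, 4, 5, 6, 7, 0],
    .decomposable (multiples 15 7),
    .impure [0, 3, 6, 9, 12] [0, 1, 2, 3, 6, 12],
    .impure [0, 5, 10] [0, 2, 4, 6],
    .impure [0, 1, 4, 5, 10] [0, 1, 5, 6, 10, 11],
    .impure [0, 4, 9] [0, 3, 6, 9, 12],
    .impure [0, 2, 4, 6] [0, 1, 2, 6, 11],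
    .impure [0, 5, 10] [0, 2, 4, 6],
    .disconnected [0, 5, 10] [1, 6] 2114,
    .cocycle [] [0, 4, 9] 101150879080064750385660559111582932617109121807742402560 [0, 4, 8, 2, 6, 0],
    .impure [0, 5, 10] [0, 1, 2, 3],
    .impure [0, 2, 5] [0, 3, 6, 9, 12],
    .impure [0, 1, 6] [0, 3, 6, 9, 12],
    .impure [0, 5, 10] [0, 3, 6, 9, 12],
    .cocycle [] [0, 1, 2] 20642032798110112150313710354761757467041619160670357344983726432256 [0, 1, 3, 5, 0],
    .impure [0, 2] [0, 5, 10],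
    .cocycle [] [0, 1, 6] 49389989186455918629695128285196407777357454358118466 [0, 1, 2, 3, 9, 0],
    .impure [0, 6] [0, 5, 10],
    .disconnected [0, 3, 6] [2, 4] 20,
    .impure [0, 2, 4, 6] [0, 3, 6, 9, 12],
    .impure [0, 1, 4] [0, 3, 6, 9, 12],
    .impure [0, 4] [0, 3, 6, 9, 12],
    .impure [0, 1, 2] [0, 2, 4, 6],
    .cocycle [] [0, 2, 4] 6427752184518849492619503764988313685552174977728713720856576 [0, 6, 12, 3, 9, 0],
    .decomposable (multiples 15 1),
    .decomposable (multiples 15 4),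
    .impure [0, 1, 2, 3] [0, 3, 6, 9, 12],
    .impure [0, 2] [0, 3, 6, 9, 12],
    .impure [0, 1] [0, 3, 6, 9, 12],
    .disconnected [] [0, 3] 4681,
    .impure [0, 6] [0, 1, 2],
    .decomposable (multiples 15 2),
    .decomposable (multiples 15 1),
    .disconnected [] [0, 6] 4681,
    .impure [0, 5, 10] [0, 1, 2, 3, 4, 5],
    .cocycle [] [0, 2, 4] 13292691936133277112557880445620861214340854339308403801988532224 [0, 2, 6, 3, 0],
    .impure [0, 5, 10] [0, 1, 4, 5],
    .impure [0, 3] [0, 5, 10],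
    .decomposable (multiples 15 1),
    .disconnected [0] [2, 4] 10260,
    .cocycle [] [0, 1, 5] 47940268051580610704350964880236455242968093919578114 [0, 1, 2, 3, 4, 0],
    .impure [0, 4] [0, 5, 10],
    .impure [0, 5, 10] [0, 1, 2, 3],
    .cocycle [] [0, 2, 5] 1570807935416230333807323076868354747310816343294409183236 [0, 2, 4, 1, 3, 0],
    .impure [0, 1] [0, 5, 10],
    .impure [0, 3] [0, 5, 10],
    .disconnected [0] [1, 2] 24582,
    .impure [0, 2] [0, 5, 10],
    .impure [0, 1] [0, 5, 10],
    .disconnected [] [0, 5] 1057,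
    .cocycle [] [0, 1, 2] 1685073802469361266437858450932117886367486399589167331677373988864 [0, 3, 7, 11, 0],
    .impure [0, 3] [0, 2, 4],
    .cocycle [] [0, 1, 4] 205701411571329533887329072876427187422158941601602583419977730 [0, 1, 2, 3, 0],
    .decomposable (multiples 15 4),
    .cocycle [] [0, 1, 2] 1685125226841175628216676587419223603898824919828382344094525949952 [0, 1, 3, 7, 11, 0],
    .cocycle [] [0, 2, 4] 25711008738075398387223189295959279581656331652533355232100352 [0, 2, 6, 10, 14, 3, 7, 11, 0],
    .decomposable (multiples 15 1),
    .decomposable (multiples 15 4),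
    .cocycle [] [0, 1, 2] 3370147604939883806999630289278121148199300097271779541651319422976 [0, 3, 6, 9, 12, 0],
    .decomposable (multiples 15 2),
    .decomposable (multiples 15 1),
    .disconnected [] [0, 3] 4681,
    .cocycle [] [0, 1, 2] 6740295236555151211004958883705963297631756442519986768065033404416 [0, 1, 3, 5, 7, 9, 11, 13, 0],
    .decomposable (multiples 15 2),
    .decomposable (multiples 15 1),
    .decomposable (multiples 15 1)]
  | 16 => [
    .decomposable (multiples 16 1),
    .impure [0, 2, 4, 7, 10, 13] [0, 2, 4, 6, 8, 10, 13],
    .impure [0, 1, 4, 5, 10, 11] [0, 1, 4, 5, 8, 11, 12],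
    .impure [0, 3, 6, 11] [0, 3, 6, 9, 12],
    .impure [0, 1, 2, 7, 8, 9] [0, 1, 2, 6, 7, 8, 12],
    .impure [0, 2, 4, 6, 11] [0, 2, 4, 6, 8, 10, 12, 14],
    .impure [0, 1, 8, 9] [0, 1, 5, 9, 10],
    .impure [0, 4, 9] [0, 4, 8, 12],
    .disconnected [0, 1, 2, 8, 9, 10] [3, 11] 2056,
    .impure [0, 2, 7, 9] [0, 2, 5, 7, 10, 13],
    .decomposable (multiples 16 3),
    .cocycle [] [0, 3, 6] 113095951790724034167364936634966529570290586001219358807299772800753992192 [0, 3, 12, 5, 0],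
    .impure [0, 1, 6, 11] [0, 1, 2, 7, 8, 9],
    .impure [0, 5, 10] [0, 2, 7, 9],
    .decomposable (multiples 16 5),
    .impure [0, 7] [0, 5, 10],
    .impure [0, 1, 2, 3, 4, 10] [0, 1, 2, 4, 8, 10, 14],
    .impure [0, 2, 6, 9, 12] [0, 2, 4, 6, 8, 10, 12, 14],
    .impure [0, 1, 8, 9] [0, 1, 4, 7, 8],
    .impure [0, 4, 8, 12] [0, 3, 6, 9, 12],
    .impure [0, 1, 2, 8, 9, 10] [0, 2, 4, 6, 8, 10, 12, 14],
    .impure [0, 2, 9] [0, 2, 4, 6, 8, 10, 12, 14],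
    .impure [0, 4, 10] [0, 1, 7, 8],
    .impure [0, 7] [0, 4, 10],
    .impure [0, 3, 6, 9] [0, 1, 2, 3, 9, 10],
    .impure [0, 2, 9] [0, 2, 8, 10],
    .decomposable (multiples 16 3),
    .impure [0, 8] [0, 3, 6, 9],
    .disconnected [0, 1, 8, 9] [2, 10] 1028,
    .impure [0, 2, 9] [0, 2, 8, 10],
    .cocycle [] [0, 1, 7] 25207064370221535606192411045723572510879375452196472619008 [0, 1, 2, 12, 6, 0],
    .decomposable (multiples 16 7),
    .impure [0, 1, 2, 3, 4, 5] [0, 1, 2, 4, 5, 9, 13],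
    .impure [0, 3, 8, 11] [0, 2, 5, 9, 13],
    .disconnected [0, 4, 8, 12] [1, 5] 8738,
    .cocycle [] [0, 3, 7] 1929455875261516746478109052717442024884005575566975660925723403821340688384 [0, 3, 6, 9, 0],
    .impure [0, 1, 2, 9] [0, 2, 4, 9, 11],
    .impure [0, 4, 8, 12] [0, 2, 4, 9, 11],
    .cocycle [] [0, 1, 5] 235528862044472251367460795383009421756722191993713704738784598324150272 [0, 1, 2, 7, 0],
    .impure [0, 4, 9] [0, 4, 8, 12],
    .decomposable (multiples 16 1),
    .decomposable (multiples 16 7),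
    .disconnected [0, 8] [1, 9] 514,
    .impure [0, 7] [0, 3, 8, 11],
    .cocycle [] [0, 1, 2] 28380199193453929510322855192836622748642202198764427491651773386935238656 [0, 1, 3, 5, 0],
    .impure [0, 8] [0, 2, 7, 9],
    .impure [0, 5] [0, 1, 8, 9],
    .decomposable (multiples 16 5),
    .impure [0, 1, 2, 9] [0, 1, 2, 3, 4],
    .impure [0, 2, 4] [0, 4, 8, 12],
    .cocycle [] [0, 1, 4] 221779708847887541991646856618229490030358822437684347960635446293430272 [0, 1, 2, 3, 0],
    .impure [0, 3, 7] [0, 4, 8, 12],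
    .impure [0, 2, 4] [0, 1, 2, 9],
    .impure [0, 2, 4] [0, 4, 8, 12],
    .disconnected [0, 8] [1, 9] 514,
    .impure [0, 7] [0, 4, 8, 12],
    .cocycle [] [0, 1, 2] 21711404112757508245405352068966606843592883378467571025210035377113567076352 [0, 1, 4, 7, 0],
    .impure [0, 3] [0, 2, 9],
    .impure [0, 3] [0, 1, 8, 9],
    .decomposable (multiples 16 3),
    .cocycle [] [0, 1, 2] 14474343321453854641143595141764236071268364546898071104121112395452182953984 [0, 1, 3, 5, 7, 0],
    .impure [0, 8] [0, 2, 9],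
    .disconnected [0, 8] [1, 9] 514,
    .decomposable (multiples 16 7),
    .impure [0, 1, 3, 5, 6, 11] [0, 1, 2, 3, 4, 5, 6],
    .impure [0, 2, 5, 8, 10, 13] [0, 2, 4, 6, 8, 10, 12, 14],
    .impure [0, 1, 4, 5] [0, 1, 5, 6, 11],
    .impure [0, 4, 10] [0, 3, 6, 11],
    .impure [0, 1, 2, 6, 12] [0, 2, 4, 6, 8, 10, 12, 14],
    .impure [0, 5, 10] [0, 2, 4, 6, 8, 10, 12, 14],
    .impure [0, 4, 8, 12] [0, 1, 5, 6, 11],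
    .impure [0, 4, 10] [0, 4, 8, 12],
    .impure [0, 1, 2, 3] [0, 1, 3, 6, 11, 14],
    .disconnected [0, 3, 8, 11] [5, 13] 8224,
    .cocycle [] [0, 1, 6] 283194019791274580333039335734838034938404707864400351203445782884712514 [0, 1, 2, 3, 0],
    .cocycle [] [0, 3, 6] 62331396694453854802248091807153033681026980064504733858066049389297728 [0, 3, 9, 4, 10, 0],
    .impure [0, 1, 2] [0, 1, 6, 11],
    .impure [0, 5, 10] [0, 2, 8, 10],
    .impure [0, 8] [0, 1, 6, 11],
    .impure [0, 8] [0, 5, 10],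
    .impure [0, 1, 2, 3, 4] [0, 2, 4, 6, 8, 10, 12, 14],
    .impure [0, 3, 6] [0, 2, 4, 6, 8, 10, 12, 14],
    .impure [0, 1, 4] [0, 4, 8, 12],
    .impure [0, 3, 6] [0, 4, 8, 12],
    .impure [0, 1, 2] [0, 2, 4, 6, 8, 10, 12, 14],
    .disconnected [] [0, 2] 21845,
    .impure [0, 1] [0, 4, 10],
    .impure [0, 4, 10] [0, 4, 8, 12],
    .impure [0, 3, 6] [0, 1, 2, 3],
    .impure [0, 3, 6] [0, 2, 8, 10],
    .impure [0, 1] [0, 3, 6],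
    .impure [0, 8] [0, 3, 6],
    .impure [0, 1, 2] [0, 2, 8, 10],
    .disconnected [] [0, 2] 21845,
    .decomposable (multiples 16 1),
    .disconnected [] [0, 6] 21845,
    .impure [0, 3, 8, 11] [0, 1, 2, 5, 13],
    .impure [0, 2, 4] [0, 2, 5, 13],
    .cocycle [] [0, 1, 4] 234720458565551489275040601870787453411951348699420218513056111765225472 [0, 1, 2, 3, 0],
    .disconnected [0, 8] [3, 11] 2056,
    .impure [0, 1, 2] [0, 4, 8, 12],
    .impure [0, 5] [0, 2, 4],
    .impure [0, 1, 5] [0, 4, 8, 12],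
    .impure [0, 5] [0, 4, 8, 12],
    .decomposable (multiples 16 1),
    .cocycle [] [0, 2, 5] 124285354238408533325848037368872730804854127930005818134840955934081024 [0, 2, 4, 1, 3, 0],
    .impure [0, 1] [0, 3, 8, 11],
    .disconnected [0, 8] [3, 11] 2056,
    .impure [0, 5] [0, 1, 2],
    .decomposable (multiples 16 5),
    .decomposable (multiples 16 1),
    .decomposable (multiples 16 5),
    .impure [0, 4, 8, 12] [0, 1, 2, 3, 4],
    .impure [0, 3] [0, 2, 4],
    .impure [0, 1, 4] [0, 4, 8, 12],
    .impure [0, 3] [0, 4, 8, 12],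
    .impure [0, 1, 2] [0, 4, 8, 12],
    .impure [0, 2, 4] [0, 4, 8, 12],
    .impure [0, 1] [0, 4, 8, 12],
    .disconnected [] [0, 4] 4369,
    .impure [0, 8] [0, 1, 2, 3],
    .decomposable (multiples 16 3),
    .decomposable (multiples 16 1),
    .decomposable (multiples 16 3),
    .impure [0, 8] [0, 1, 2],
    .disconnected [] [0, 2] 21845,
    .decomposable (multiples 16 1),
    .disconnected [] [0, 8] 257,
    .decomposable (multiples 16 1),
    .impure [0, 2, 6, 9, 12] [0, 2, 4, 6, 9, 11, 13],
    .cocycle [0, 4, 10] [1, 5, 11] 213915592451756785662833698398859968798084545245270875469177159680 [1, 5, 9, 13, 1],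
    .impure [0, 5, 10] [0, 3, 7, 12],
    .impure [0, 2, 4, 6, 11] [0, 1, 2, 6, 7, 11, 12],
    .impure [0, 2, 6, 12] [0, 2, 4, 6, 11],
    .cocycle [] [0, 1, 5] 3452638030137289951692793615547960875246156543925044259386881525153792 [0, 1, 2, 9, 0],
    .cocycle [] [0, 4, 9] 466458301457580256229748437773546023394228714057319898634413679098382516224 [0, 4, 8, 12, 0],
    .decomposable (multiples 16 1),
    -- The exceptional indices are 137, 140, 152 and 200, that is, the step sets `{1,4,8}`,
    -- `{3,4,8}`, `{4,5,8}` and `{4,7,8}`.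
    .exceptional,
    .decomposable (multiples 16 3),
    .impure [0, 5, 10] [0, 3, 6, 9],
    .exceptional,
    .impure [0, 5, 10] [0, 2, 7, 9],
    .cocycle [] [0, 1, 6] 26341543970165418838282719160259838872335755448240847155045335168 [0, 1, 2, 9, 0],
    .impure [0, 7] [0, 5, 10],
    .impure [0, 1, 2, 3, 4] [0, 1, 3, 4, 7, 10, 13],
    .impure [0, 2, 4, 6] [0, 2, 6, 9, 12],
    .cocycle [] [0, 1, 4] 252351841613949166697750753438253711549951942925670967970162004789886978 [0, 1, 2, 3, 0],
    .cocycle [] [0, 3, 6] 31057865965328057272819467860220368373137358593506209098676417597538320 [0, 4, 8, 12, 0],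
    .impure [0, 1, 2] [0, 2, 4, 6],
    .impure [0, 2, 9] [0, 2, 4, 6],
    .cocycle [] [0, 1, 7] 27608910678916436483775536893741241382441816199542250161980883251298450 [0, 1, 2, 6, 0],
    .impure [0, 7] [0, 4, 10],
    .exceptional,
    .impure [0, 2, 9] [0, 3, 6, 9],
    .cocycle [] [0, 1, 7] 224313502839378438119136478697308035341196970893420715003974792863875074 [0, 1, 2, 3, 0],
    .cocycle [] [0, 3, 6] 59238164063563630896817940931748076062479743997488712820417626240 [0, 3, 12, 5, 14, 7, 0],
    .cocycle [] [0, 1, 2] 14474342890147364715172468608644038798790979771189798909675874891187217235968 [0, 2, 4, 6, 0],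
    .impure [0, 6] [0, 2, 9],
    .cocycle [] [0, 1, 7] 26328675621586091112203917018032287388775722275419950518615736450 [0, 1, 2, 9, 0],
    .decomposable (multiples 16 7),
    .cocycle [0, 2, 4] [1, 3, 5] 3618502789719254027595353733300040579315122598270470694392048143037408215040 [1, 5, 9, 13, 1],
    .cocycle [] [0, 2, 4] 7237033453917329833265668213703844852970867013161159670757433463344627449864 [0, 2, 6, 3, 0],
    .disconnected [0, 4] [1, 5] 8738,
    .disconnected [0, 4] [7, 11] 2176,
    .impure [0, 1, 2] [0, 1, 5, 12],
    .cocycle [] [0, 2, 4] 27822664968596921536723499341477704485771946074164213334494598072893440 [0, 4, 8, 12, 0],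
    .disconnected [0, 4] [5, 9] 544,
    .cocycle [] [0, 4, 9] 480582401619721391334121209302838878000573960817644456640301520643713665152 [0, 5, 14, 7, 0],
    .decomposable (multiples 16 1),
    .cocycle [] [0, 2, 5] 110697541122382774195891922661122021216830442933534918608740866578186248 [0, 3, 6, 9, 0],
    .decomposable (multiples 16 1),
    .decomposable (multiples 16 3),
    .impure [0, 1, 2] [0, 2, 7, 9],
    .cocycle [] [0, 2, 7] 844143838698078894253520542346362874322394795004092201673246638080 [0, 2, 4, 15, 10, 5, 0],
    .decomposable (multiples 16 1),
    .decomposable (multiples 16 5),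
    .impure [0, 2, 9] [0, 1, 4, 13],
    .cocycle [] [0, 2, 4] 7237033238237756483506346338826310234553349395129518871263189030304240107528 [0, 2, 6, 3, 0],
    .disconnected [0, 3] [4, 7] 144,
    .cocycle [] [0, 3, 7] 428653937182186251830900374637952653600825639550258916360879866000 [0, 4, 8, 12, 0],
    .cocycle [] [0, 1, 2] 31920576862192242180948136654037495191552370604741300144564936745418880 [0, 1, 3, 7, 0],
    .cocycle [] [0, 2, 4] 27606985395247162214848621806859286968153914433364719090061557685551104 [0, 4, 8, 12, 0],
    .decomposable (multiples 16 1),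
    .decomposable (multiples 16 7),
    .impure [0, 2, 9] [0, 1, 2, 3],
    .impure [0, 3] [0, 2, 9],
    .decomposable (multiples 16 1),
    .decomposable (multiples 16 3),
    .cocycle [] [0, 1, 2] 49423729555980326907437102799213170880387099785460449280 [0, 1, 8, 7, 0],
    .cocycle [] [0, 2, 9] 49039857353469572614851943555241187771274091923465306116 [0, 2, 4, 6, 8, 10, 12, 14, 0],
    .decomposable (multiples 16 1),
    .decomposable (multiples 16 7),
    .impure [0, 1, 2, 6, 12] [0, 1, 2, 3, 4, 5, 6],
    .impure [0, 2, 5] [0, 2, 4, 6],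
    .impure [0, 3, 6] [0, 1, 4, 5],
    .cocycle [] [0, 3, 6] 42057677237449336921402334059058932807102379272861366650241173804810240 [0, 3, 7, 11, 0],
    .impure [0, 2, 4, 6] [0, 1, 2, 6, 12],
    .impure [0, 5, 10] [0, 2, 4, 6],
    .cocycle [] [0, 1, 5] 1685873276520725172235648143298942572463430603458724987345291182080 [0, 4, 8, 12, 0],
    .cocycle [] [0, 4, 10] 14142001994558454345245724344694416013749883718894077255120179715964403712 [0, 4, 8, 12, 0],
    .exceptional,
    .cocycle [] [0, 2, 5] 124716713385484678265189399965792604302080494971432070502315595752013824 [0, 2, 4, 6, 0],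
    .impure [0, 3, 6] [0, 1, 6, 11],
    .cocycle [] [0, 3, 6] 62331396694855583183330677339730783476886312671083436416912314446381056 [0, 3, 9, 4, 10, 0],
    .impure [0, 1, 2] [0, 1, 6, 11],
    .impure [0, 2] [0, 5, 10],
    .cocycle [] [0, 1, 6] 13257631375557074049005034626088737504762078364887792109027330 [0, 1, 2, 3, 4, 5, 0],
    .cocycle [] [0, 5, 10] 6321544106071791540728343825500017110055028050695815232 [0, 6, 12, 2, 8, 14, 4, 10, 0],
    .impure [0, 2, 6, 12] [0, 1, 2, 3, 4],
    .impure [0, 3, 6] [0, 2, 4, 6],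
    .cocycle [] [0, 1, 4] 248469661950025295053659717664188940078624494571780504346371548029976594 [0, 1, 2, 3, 0],
    .cocycle [] [0, 3, 6] 27607038866060368113091092547411746249512573868000858574871399367704592 [0, 4, 8, 12, 0],
    .impure [0, 1, 2] [0, 2, 4, 6],
    .disconnected [] [0, 2] 21845,
    .impure [0, 1] [0, 4, 10],
    .disconnected [] [0, 4] 21845,
    .impure [0, 3, 6] [0, 1, 2, 3],
    .impure [0, 2] [0, 3, 6],
    .impure [0, 1] [0, 3, 6],
    .cocycle [] [0, 3, 6] 52656145834278803805194789539707645338320449159032371730114936832 [0, 6, 12, 2, 8, 14, 4, 10, 0],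
    .impure [0, 6] [0, 1, 2],
    .disconnected [] [0, 2] 21845,
    .decomposable (multiples 16 1),
    .disconnected [] [0, 6] 21845,
    .cocycle [] [0, 1, 2] 1809292805548344390781375734176819834481124304555453536344413010309018550272 [0, 1, 6, 11, 0],
    .cocycle [] [0, 2, 4] 9046257241686250913209083108572062995556456318330938427950867195851714854920 [0, 2, 6, 3, 0],
    .disconnected [0, 1] [4, 5] 48,
    .decomposable (multiples 16 3),
    .cocycle [] [0, 1, 2] 5427795594635734310196022127500136498302788700763934097030180862280419248128 [0, 1, 6, 11, 0],
    .impure [0, 5] [0, 2, 4],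
    .cocycle [] [0, 1, 5] 1685873251412318230688925087955774495039047869394046130904300257280 [0, 4, 8, 12, 0],
    .decomposable (multiples 16 5),
    .cocycle [] [0, 1, 2] 9046436420124760749543301201504620408906660684124334827382999842971776452608 [0, 1, 6, 11, 0],
    .cocycle [] [0, 2, 5] 110697541122181906940359548876679275955287792656459486092996917877276680 [0, 3, 6, 11, 0],
    .decomposable (multiples 16 1),
    .decomposable (multiples 16 3),
    .impure [0, 5] [0, 1, 2],
    .decomposable (multiples 16 5),
    .decomposable (multiples 16 1),
    .decomposable (multiples 16 5),
    .cocycle [] [0, 1, 2] 3618585611096688787067331778590821680263530129648350998003698660781840138240 [0, 4, 8, 12, 0],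
    .impure [0, 3] [0, 2, 4],
    .cocycle [] [0, 1, 4] 1685462678729750094443648640163118731159869363725459379788792799234 [0, 1, 2, 3, 0],
    .decomposable (multiples 16 3),
    .cocycle [] [0, 1, 2] 3618530396704662080437427629212273211352209396399991691042219778741238759424 [0, 4, 8, 12, 0],
    .disconnected [] [0, 2] 21845,
    .decomposable (multiples 16 1),
    .disconnected [] [0, 4] 4369,
    .cocycle [] [0, 1, 2] 7237171222193689310699525361938533365286816351858919504258285674865161666560 [0, 1, 4, 7, 10, 13, 0],
    .decomposable (multiples 16 3),
    .decomposable (multiples 16 1),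
    .decomposable (multiples 16 3),
    .cocycle [] [0, 1, 2] 14474342458709233219405982415745273779719098576070154421383877261721050546176 [0, 2, 4, 6, 8, 10, 12, 14, 0],
    .disconnected [] [0, 2] 21845,
    .decomposable (multiples 16 1),
    .decomposable (multiples 16 1)]
  | _ => []
/-- The `i`-th certificate `c` of the list satisfies `p (t + i) c`, for all `i`. -/
def allCertificates (p : ℕ → Certificate → Bool) : ℕ → List Certificate → Bool
  | _, [] => true
  | t, c :: l => p t c && allCertificates p (t + 1) l

theorem exists_of_allCertificates {p : ℕ → Certificate → Bool} : ∀ {l : List Certificate} {t : ℕ},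
    allCertificates p t l = true → ∀ i < l.length, ∃ c, p (t + i) c = true := by
  intro l
  induction l with
  | nil => intro t _ i hi; simp at hi
  | cons c l ih =>
    intro t h i hi
    rw [allCertificates, Bool.and_eq_true] at h
    cases i with
    | zero => exact ⟨c, h.1⟩
    | succ i =>
      obtain ⟨c', hc'⟩ := ih h.2 i (Nat.lt_of_succ_lt_succ hi)
      exact ⟨c', by rwa [Nat.add_assoc, Nat.add_comm 1] at hc'⟩

end Certificates

/-! ### Well-covered graphs and pure independence complexes. -/

section WellCovered

variable {V : Type*} [Fintype V] {G : SimpleGraph V}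

/-- Complementation exchanges independent sets and vertex covers and reverses inclusion. -/
theorem isFacet_indComplex_iff {F : Finset V} :
    (indComplex G).IsFacet F ↔ Minimal G.IsVertexCover (F : Set V)ᶜ := by
  classical
  constructor
  · intro hF
    refine ⟨G.isVertexCover_compl.mpr hF.prop, fun D hD hle => ?_⟩
    have hH : Dᶜ.toFinset ∈ (indComplex G).faces := by
      change G.IsIndepSet _
      rw [Set.coe_toFinset]
      exact G.isIndepSet_compl_iff_isVertexCover.mpr hD
    have h1 : F ⊆ Dᶜ.toFinset := by
      rw [Set.subset_toFinset]
      exact Set.subset_compl_comm.mp hle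
    have h2 : Dᶜ.toFinset ⊆ F := hF.le_of_ge hH h1
    rw [Set.toFinset_subset] at h2
    exact Set.compl_subset_comm.mp h2
  · intro hF
    refine ⟨G.isVertexCover_compl.mp hF.prop, fun H hH hle => ?_⟩
    have h1 : ((F : Set V)ᶜ) ≤ (H : Set V)ᶜ := hF.le_of_le (G.isVertexCover_compl.mpr hH)
      (Set.compl_subset_compl.mpr (Finset.coe_subset.mpr hle))
    exact Finset.coe_subset.mp (Set.compl_subset_compl.mp h1)

theorem isWellCovered_iff_isPure : IsWellCovered G ↔ (indComplex G).IsPure := by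
  classical
  have hcard : ∀ F : Finset V, ((F : Set V)ᶜ).ncard + F.card = Fintype.card V := fun F => by
    rw [← Set.ncard_coe_finset F, add_comm, Set.ncard_add_ncard_compl, Nat.card_eq_fintype_card]
  constructor
  · intro h F H hF hH
    have := h _ _ (isFacet_indComplex_iff.mp hF) (isFacet_indComplex_iff.mp hH)
    have := hcard F
    have := hcard H
    omega
  · intro h C D hC hD
    have e : ∀ C : Set V, (Cᶜ.toFinset : Set V)ᶜ = C := fun C => by simp
    have hC' := isFacet_indComplex_iff.mpr (by rwa [e C])
    have hD' := isFacet_indComplex_iff.mpr (by rwa [e D])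
    have h1 := h _ _ hC' hD'
    have h2 := hcard Cᶜ.toFinset
    have h3 := hcard Dᶜ.toFinset
    rw [e] at h2 h3
    omega

end WellCovered

/-! ### Classification of the small circulants. -/

section Classification

/-- All certificates for the circulant graphs on `n` vertices have the property `p`, unless the bit
mask of the set of steps satisfies `e`. -/
def checkCertificates (p : (ℕ → ℕ) → Certificate → Bool) (e : ℕ → Bool) (n : ℕ) : Bool :=
  (certificates n).length == 2 ^ (n / 2) && allCertificates (fun t c => withValue t fun t =>
    withValue (baseMask n t) (fun b => p (rotateMask n b) c) || e t) 0 (certificates n)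

theorem exists_certificate {p : (ℕ → ℕ) → Certificate → Bool} {e : ℕ → Bool} {n : ℕ} (hn : 1 ≤ n)
    (h : checkCertificates p e n = true) {T : Finset ℕ} (hT : T ⊆ Finset.Icc 1 (n / 2)) :
    (∃ C c, IsNbhdMask (circulant n T) C ∧ p C c = true) ∨ ∃ t, T = stepSet n t ∧ e t = true := by
  obtain ⟨t, ht, rfl⟩ := exists_eq_stepSet hT
  rw [checkCertificates, Bool.and_eq_true, beq_iff_eq] at h
  obtain ⟨c, hc⟩ := exists_of_allCertificates h.2 t (h.1 ▸ ht)
  rw [zero_add, withValue_eq, withValue_eq, Bool.or_eq_true] at hc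
  exact hc.imp (fun hc => ⟨_, c, isNbhdMask_circulant ht hn, hc⟩) fun hc => ⟨t, rfl, hc⟩

/-- The exceptions are `C_8(2)`, `C_10(2,3)` and `C_10(1,4)`. -/
theorem isBuchsbaum_of_isPure (k : Type*) [Field k] {n : ℕ} (hn : 1 ≤ n) (hn' : n ≤ 10)
    {T : Finset ℕ} (hT : T ⊆ Finset.Icc 1 (n / 2)) (hp : (indComplex (circulant n T)).IsPure) :
    (indComplex (circulant n T)).IsBuchsbaum k ∨ n = 8 ∧ T = stepSet 8 2 ∨
      n = 10 ∧ (T = stepSet 10 6 ∨ T = stepSet 10 9) := by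
  have hcheck : checkCertificates (checkBuchsbaum n)
      (fun t => (n == 8 && t == 2) || (n == 10 && (t == 6 || t == 9))) n = true := by
    interval_cases n <;> decide +kernel
  rcases exists_certificate hn hcheck hT with ⟨C, c, hC, h⟩ | ⟨t, rfl, h⟩
  · exact Or.inl (checkBuchsbaum_sound k hC h hp)
  · simp only [Bool.or_eq_true, Bool.and_eq_true, beq_iff_eq] at h
    rcases h with ⟨rfl, rfl⟩ | ⟨rfl, rfl | rfl⟩ <;> simp

theorem isCohenMacaulay_of_isPure (k : Type*) [Field k] {n : ℕ} (hn : 1 ≤ n) (hn' : n ≤ 4)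
    {T : Finset ℕ} (hT : T ⊆ Finset.Icc 1 (n / 2)) (hp : (indComplex (circulant n T)).IsPure) :
    (indComplex (circulant n T)).IsCohenMacaulay k ∨ n = 4 ∧ T = stepSet 4 1 := by
  have hcheck : checkCertificates (checkDecomposable n) (fun t => n == 4 && t == 1) n = true := by
    interval_cases n <;> decide +kernel
  rcases exists_certificate hn hcheck hT with ⟨C, c, hC, h⟩ | ⟨t, rfl, h⟩
  · exact Or.inl (checkDecomposable_sound hC h hp).isCohenMacaulay
  · simp only [Bool.and_eq_true, beq_iff_eq] at h
    obtain ⟨rfl, rfl⟩ := h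
    simp

theorem isVertexDecomposable_of_isShellable {n : ℕ} (hn : 1 ≤ n) (hn' : n ≤ 16)
    {T : Finset ℕ} (hT : T ⊆ Finset.Icc 1 (n / 2))
    (hs : (indComplex (circulant n T)).IsShellable) :
    (indComplex (circulant n T)).IsVertexDecomposable ∨ n = 16 ∧ (T = stepSet 16 137 ∨
      T = stepSet 16 140 ∨ T = stepSet 16 152 ∨ T = stepSet 16 200) := by
  have hcheck : checkCertificates (checkShellable n)
      (fun t => n == 16 && (t == 137 || (t == 140 || (t == 152 || t == 200)))) n = true := by
    interval_cases n <;> decide +kernel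
  rcases exists_certificate hn hcheck hT with ⟨C, c, hC, h⟩ | ⟨t, rfl, h⟩
  · exact Or.inl (checkShellable_sound hC h hs)
  · simp only [Bool.or_eq_true, Bool.and_eq_true, beq_iff_eq] at h
    obtain ⟨rfl, rfl | rfl | rfl | rfl⟩ := h <;> simp

end Classification

/-! ### The extremal circulants. -/

section Examples

instance (n : ℕ) (S : Finset ℕ) : DecidableRel (circulant n S).Adj := fun a b =>
  inferInstanceAs (Decidable (a ≠ b ∧
    (((a : ℤ) - (b : ℤ)).natAbs ∈ S ∨ n - ((a : ℤ) - (b : ℤ)).natAbs ∈ S)))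

/-- Multiplication by a unit of `ℤ/n`, as an isomorphism of graphs. -/
def mulIso {n : ℕ} [NeZero n] {G H : SimpleGraph (Fin n)} (u v : Fin n)
    (hvu : ∀ a : Fin n, v * (u * a) = a) (huv : ∀ a : Fin n, u * (v * a) = a)
    (h : ∀ a b, H.Adj (u * a) (u * b) ↔ G.Adj a b) : G ≃g H where
  toFun a := u * a
  invFun a := v * a
  left_inv := hvu
  right_inv := huv
  map_rel_iff' := h _ _

theorem isPure_circulant_four : (indComplex (circulant 4 {1})).IsPure :=
  isPure_of_allFacets (isNbhdMask_circulant (n := 4) (t := 1) (by norm_num) (by norm_num))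
    (L := [5, 10]) (d := 2) (by decide +kernel) (by decide +kernel)

theorem isPure_circulant_eight : (indComplex (circulant 8 {2})).IsPure :=
  isPure_of_allFacets (isNbhdMask_circulant (n := 8) (t := 2) (by norm_num) (by norm_num))
    -- The graph is two disjoint 4-cycles, on the even and the odd vertices; a facet joins a
    -- diagonal of one to a diagonal of the other.
    (L := [51, 153, 102, 204]) (d := 4) (by decide +kernel) (by decide +kernel)

theorem isPure_circulant_ten : (indComplex (circulant 10 {1, 4})).IsPure :=
  isPure_of_allFacets (isNbhdMask_circulant (n := 10) (t := 9) (by norm_num) (by norm_num))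
    -- These are the sets `{i, i + 2, i + 5, i + 7}` modulo 10, unions of two antipodal pairs.
    (L := [165, 297, 330, 594, 660]) (d := 4) (by decide +kernel) (by decide +kernel)

/-- The independence complex of a graph is not Buchsbaum if the link of some edge `{x, y}` in it is
disconnected, of positive dimension. -/
theorem not_isBuchsbaum_of_disconnected (k : Type*) [Field k] {n : ℕ} {G : SimpleGraph (Fin n)}
    {x y a b c : Fin n} (f : Fin n → Bool)
    (hf : ∀ u v : Fin n, {x, y, u, v} ∈ (indComplex G).faces → u ∉ ({x, y} : Finset (Fin n)) →
      v ∉ ({x, y} : Finset (Fin n)) → f u = f v)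
    (hac : {x, y, a, c} ∈ (indComplex G).faces) (hb : {x, y, b} ∈ (indComplex G).faces)
    (hne : [x, y, a, c].Nodup) (hne' : [x, y, b].Nodup) (ha : f a = true) (hfb : f b = false) :
    ¬ (indComplex G).IsBuchsbaum k := by
  intro h
  simp only [List.nodup_cons, List.mem_cons, List.not_mem_nil, or_false, not_or] at hne hne'
  obtain ⟨⟨hxy, hxa, hxc⟩, ⟨hya, hyc⟩, hac', -⟩ := hne
  have hx : {x} ∈ (indComplex G).faces := SComplex.down_closed _ hb (by simp)
  have hy : {y} ∈ ((indComplex G).link {x} hx).faces :=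
    mem_link_singleton.mpr ⟨by simpa using hxy, SComplex.down_closed _ hb (by simp)⟩
  have hmem : ∀ F, F ∈ (((indComplex G).link {x} hx).link {y} hy).faces ↔
      (x ∉ F ∧ y ∉ F) ∧ insert x (insert y F) ∈ (indComplex G).faces := fun F => by
    rw [link_link, mem_link, Finset.disjoint_union_left, Finset.disjoint_singleton_left,
      Finset.disjoint_singleton_left, Finset.union_assoc, ← Finset.insert_eq, ← Finset.insert_eq]
  have hE : {a, c} ∈ (((indComplex G).link {x} hx).link {y} hy).faces :=
    (hmem _).mpr ⟨by simp [hxa, hxc, hya, hyc], hac⟩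
  -- The link of `y` in the link of `x` is the link of the edge `{x, y}`; it contains the edge `{a,
  -- c}`, so it would have to be connected.
  have key := (h.2 x hx).imp_of_edge_of_link hy hE (Finset.card_pair hac').ge
    (fun v => f v = true) (fun u v huv => by
      rw [hmem] at huv
      simp only [Finset.mem_insert, Finset.mem_singleton, not_or] at huv
      rw [hf u v huv.2 (by simp [Ne.symm huv.1.1.1, Ne.symm huv.1.2.1])
        (by simp [Ne.symm huv.1.1.2, Ne.symm huv.1.2.2])]) (a := a) (b := b)
    (SComplex.down_closed _ hE (by simp))
    ((hmem _).mpr ⟨by simp [hne'.1.2, hne'.2.1], hb⟩) ha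
  simp [hfb] at key

/-- The link of `{0, 4}` is the disjoint union of the segments `{1, 5}` and `{3, 7}`. -/
theorem not_isBuchsbaum_circulant_eight (k : Type*) [Field k] :
    ¬ (indComplex (circulant 8 {2})).IsBuchsbaum k := by
  refine not_isBuchsbaum_of_disconnected k (x := 0) (y := 4) (a := 1) (b := 3) (c := 5)
    (fun u => u == 1 || u == 5) (fun u v => ?_) (mem_indComplex.mpr (by decide +kernel))
    (mem_indComplex.mpr (by decide +kernel)) (by decide) (by decide) rfl rfl
  rw [mem_indComplex]
  revert u v
  decide +kernel

/-- The link of `{0, 5}` is the disjoint union of the segments `{2, 7}` and `{3, 8}`. -/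
theorem not_isBuchsbaum_circulant_ten (k : Type*) [Field k] :
    ¬ (indComplex (circulant 10 {1, 4})).IsBuchsbaum k := by
  refine not_isBuchsbaum_of_disconnected k (x := 0) (y := 5) (a := 2) (b := 3) (c := 7)
    (fun u => u == 2 || u == 7) (fun u v => ?_) (mem_indComplex.mpr (by decide +kernel))
    (mem_indComplex.mpr (by decide +kernel)) (by decide) (by decide) rfl rfl
  rw [mem_indComplex]
  revert u v
  decide +kernel

/-- The complex is the disjoint union of the segments `{0, 2}` and `{1, 3}`. -/
theorem not_isCohenMacaulay_circulant_four (k : Type*) [Field k] :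
    ¬ (indComplex (circulant 4 {1})).IsCohenMacaulay k := by
  intro h
  have hmem : ∀ F, F ∈ ((indComplex (circulant 4 {1})).link ∅ (SComplex.empty_mem _)).faces ↔
      F ∈ (indComplex (circulant 4 {1})).faces := fun F => by
    rw [mem_link, Finset.empty_union]
    simp
  have key := h.imp_of_edge_of_link (SComplex.empty_mem _) (E := {0, 2}) (a := 0) (b := 1)
    ((hmem _).mpr (mem_indComplex.mpr (by decide +kernel))) (by decide)
    (fun v => v = 0 ∨ v = 2) (fun u v => by
      rw [hmem, mem_indComplex]
      revert u v
      decide +kernel)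
    ((hmem _).mpr (mem_indComplex.mpr (by decide +kernel)))
    ((hmem _).mpr (mem_indComplex.mpr (by decide +kernel))) (Or.inl rfl)
  exact absurd key (by decide)

/-- The empty certificate suffices, as the check falls back on the vertex links, which are single
points. -/
theorem isBuchsbaum_circulant_four (k : Type*) [Field k] :
    (indComplex (circulant 4 {1})).IsBuchsbaum k := by
  have hcheck : checkBuchsbaum 4 (rotateMask 4 (baseMask 4 1)) .exceptional = true := by
    decide +kernel
  exact checkBuchsbaum_sound k (isNbhdMask_circulant (n := 4) (t := 1) (by norm_num)
    (by norm_num)) hcheck isPure_circulant_four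

/-- The facets of the independence complex of `circulant 16 {1, 4, 8}` with their restriction sets,
in the reverse order of a shelling. -/
def reverseShelling : List (ℕ × ℕ) :=
  [(20610, 20610), (16530, 16514), (20490, 20482), (18450, 16402), (2130, 2066), (32850, 82),
   (33810, 32786), (16650, 16394), (16680, 16648), (1320, 296), (42000, 33808), (42240, 41984),
   (9480, 9472), (1290, 1288), (330, 266), (4170, 74), (4680, 4168), (21000, 4616),
   (20520, 20488), (16425, 16424), (16905, 16392), (20640, 20512), (21120, 20480),
   (18690, 16386), (18720, 16640), (18465, 18464), (16545, 16416), (18960, 18448),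
   (17040, 16400), (18945, 18432), (17025, 16384), (2370, 2050), (33090, 322), (34050, 258),
   (36930, 66), (37890, 32770), (5130, 10), (5250, 4098), (1170, 2), (8520, 264), (585, 520),
   (5160, 4104), (1065, 40), (9225, 1032), (8265, 8), (37440, 4160), (2625, 577), (10305, 65),
   (33360, 33344), (41040, 32848), (41280, 32832), (10560, 320), (9360, 1040), (2640, 576),
   (34080, 1280), (9345, 9216), (10320, 64), (37920, 33792), (5280, 5120), (33060, 33056),
   (1185, 1024), (2340, 288), (10500, 2304), (41220, 256), (36900, 32800), (40980, 40960),
   (33300, 32784), (37380, 32768), (2580, 2576), (10260, 2064), (8340, 8208), (660, 16),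
   (4260, 4128), (4740, 4096), (2565, 2560), (2085, 2080), (10245, 2048), (8325, 8192),
   -- The shelling starts here, with the facet `{0, 2, 5, 7}` and an empty restriction set.
   (645, 512), (165, 0)]

theorem isNbhdMask_circulant_sixteen :
    IsNbhdMask (circulant 16 {1, 4, 8}) (rotateMask 16 (baseMask 16 137)) := by
  have e : ({1, 4, 8} : Finset ℕ) = stepSet 16 137 := by decide +kernel
  rw [e]
  exact isNbhdMask_circulant (by norm_num) (by norm_num)

theorem allFacets_circulant_sixteen : allFacets 16 (rotateMask 16 (baseMask 16 137))
    (fun M => (reverseShelling.map Prod.fst).contains M) 16 (fullMask 16) 0 = true := by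
  decide +kernel

theorem isPure_circulant_sixteen : (indComplex (circulant 16 {1, 4, 8})).IsPure :=
  isPure_of_allFacets isNbhdMask_circulant_sixteen allFacets_circulant_sixteen (d := 4)
    (by decide +kernel)

theorem isShellable_circulant_sixteen : (indComplex (circulant 16 {1, 4, 8})).IsShellable := by
  refine isShellable_of_isReverseShelling isPure_circulant_sixteen (L := reverseShelling)
    (by decide +kernel) fun F => ⟨fun hF => ?_, ?_⟩
  · rw [← indOn_fullMask] at hF
    obtain ⟨N, hN, rfl⟩ : ∃ N, (reverseShelling.map Prod.fst).contains N = true ∧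
        maskSet 16 N = F := by
      obtain ⟨N, hN, h⟩ := allFacets_sound isNbhdMask_circulant_sixteen 16 _ _
        allFacets_circulant_sixteen F hF
      exact ⟨N, hN, by rw [h, maskSet_zero, Finset.empty_union]⟩
    rw [List.contains_iff_mem, List.mem_map] at hN
    obtain ⟨M, hM, rfl⟩ := hN
    exact ⟨M, hM, rfl⟩
  · rintro ⟨M, hM, rfl⟩
    -- The enumeration only shows that every facet is listed; conversely, each listed set must be a
    -- facet.
    have hcheck : (reverseShelling.all fun M => remaining 16 (rotateMask 16 (baseMask 16 137))
        ((List.range 16).filter fun i => M.1.testBit i) (fullMask 16) == some 0) = true := by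
      decide +kernel
    have h := List.all_eq_true.mp hcheck M hM
    rw [beq_iff_eq] at h
    have := isFacet_of_remaining isNbhdMask_circulant_sixteen h
    rw [indOn_fullMask] at this
    convert this
    ext i
    simp [mem_maskSet, mem_listSet]

theorem not_isVertexDecomposable_circulant_sixteen :
    ¬ (indComplex (circulant 16 {1, 4, 8})).IsVertexDecomposable :=
  not_isVertexDecomposable_of_deletions isNbhdMask_circulant_sixteen (d := 4)
    -- Two disjoint facets, so that every vertex is avoided by one of them.
    (L := [[0, 2, 5, 7], [8, 10, 13, 15]]) (by decide +kernel) (u := 0) (v := 1) (by decide +kernel)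

/-- The parity of the vertex is constant along edges. -/
theorem not_connected_circulant_eight : ¬ (circulant 8 {2}).Connected := by
  intro h
  have key : ∀ u v : Fin 8, (circulant 8 {2}).Reachable u v → (u : ℕ) % 2 = v % 2 := by
    rintro u v ⟨p⟩
    induction p with
    | nil => rfl
    | cons h _ ih =>
      have step : ∀ u v : Fin 8, (circulant 8 {2}).Adj u v → (u : ℕ) % 2 = v % 2 := by
        decide +kernel
      exact (step _ _ h).trans ih
  exact absurd (key 0 1 (h.preconnected 0 1)) (by decide)

theorem connected_circulant_ten : (circulant 10 {1, 4}).Connected := by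
  have key : ∀ i : Fin 10, (circulant 10 {1, 4}).Reachable 0 i := by
    intro i
    induction i using Fin.induction with
    | zero => rfl
    | succ i ih =>
      have step : ∀ i : Fin 9, (circulant 10 {1, 4}).Adj i.castSucc i.succ := by decide +kernel
      exact ih.trans (step i).reachable
  exact ⟨fun u v => (key u).symm.trans (key v)⟩

end Examples

/-! ### The four extremal statements combined. -/

theorem theorem6p1 (k : Type*) [Field k] :
    -- part (i), for all circulants and for the connected ones
    (¬ (circulant 8 {2}).Connected ∧
      IsSmallestCirculant
        (fun _ G => IsWellCovered G ∧ ¬ (indComplex G).IsBuchsbaum k) 8 {2}) ∧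
    IsSmallestCirculant
      (fun _ G => G.Connected ∧ IsWellCovered G ∧ ¬ (indComplex G).IsBuchsbaum k) 10 {1, 4} ∧
    -- part (ii)
    IsSmallestCirculant
      (fun _ G => IsWellCovered G ∧ (indComplex G).IsBuchsbaum k ∧
        ¬ (indComplex G).IsCohenMacaulay k) 4 {1} ∧
    -- part (iii)
    IsSmallestCirculant
      (fun _ G => IsWellCovered G ∧ (indComplex G).IsShellable ∧
        ¬ (indComplex G).IsVertexDecomposable) 16 {1, 4, 8} := by
  refine ⟨⟨not_connected_circulant_eight, ⟨by norm_num, by decide,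
    isWellCovered_iff_isPure.mpr isPure_circulant_eight, not_isBuchsbaum_circulant_eight k⟩, ?_⟩,
    ⟨⟨by norm_num, by decide, connected_circulant_ten,
      isWellCovered_iff_isPure.mpr isPure_circulant_ten, not_isBuchsbaum_circulant_ten k⟩, ?_⟩,
    ⟨⟨by norm_num, by decide, isWellCovered_iff_isPure.mpr isPure_circulant_four,
      isBuchsbaum_circulant_four k, not_isCohenMacaulay_circulant_four k⟩, ?_⟩,
    ⟨by norm_num, by decide, isWellCovered_iff_isPure.mpr isPure_circulant_sixteen,
      isShellable_circulant_sixteen, not_isVertexDecomposable_circulant_sixteen⟩, ?_⟩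
  · rintro m T hm hT ⟨hw, hb⟩
    rcases lt_or_ge 8 m with h8 | h8
    · exact ⟨h8.le, fun h => absurd h h8.ne'⟩
    rcases isBuchsbaum_of_isPure k hm (by omega) hT (isWellCovered_iff_isPure.mp hw) with
      h | ⟨rfl, rfl⟩ | ⟨rfl, -⟩
    · exact absurd h hb
    · have e : stepSet 8 2 = {2} := by decide +kernel
      exact ⟨le_rfl, fun _ => ⟨e ▸ SimpleGraph.Iso.refl⟩⟩
    · omega
  · rintro m T hm hT ⟨hc, hw, hb⟩
    rcases lt_or_ge 10 m with h10 | h10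
    · exact ⟨h10.le, fun h => absurd h h10.ne'⟩
    rcases isBuchsbaum_of_isPure k hm h10 hT (isWellCovered_iff_isPure.mp hw) with
      h | ⟨rfl, rfl⟩ | ⟨rfl, rfl | rfl⟩
    · exact absurd h hb
    -- The only exception on fewer than ten vertices is disconnected.
    · have e : stepSet 8 2 = {2} := by decide +kernel
      rw [e] at hc
      exact absurd hc not_connected_circulant_eight
    -- Modulo 10 and up to sign, multiplication by 7 carries the steps `{2, 3}` to `{4, 1}`; its
    -- inverse is 3.
    · exact ⟨le_rfl, fun _ => ⟨mulIso 7 3 (by decide +kernel) (by decide +kernel)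
        (by decide +kernel)⟩⟩
    · have e : stepSet 10 9 = {1, 4} := by decide +kernel
      exact ⟨le_rfl, fun _ => ⟨e ▸ SimpleGraph.Iso.refl⟩⟩
  · rintro m T hm hT ⟨hw, -, hc⟩
    rcases lt_or_ge 4 m with h4 | h4
    · exact ⟨h4.le, fun h => absurd h h4.ne'⟩
    rcases isCohenMacaulay_of_isPure k hm h4 hT (isWellCovered_iff_isPure.mp hw) with
      h | ⟨rfl, rfl⟩
    · exact absurd h hc
    · have e : stepSet 4 1 = {1} := by decide +kernel
      exact ⟨le_rfl, fun _ => ⟨e ▸ SimpleGraph.Iso.refl⟩⟩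
  · rintro m T hm hT ⟨-, hs, hv⟩
    rcases lt_or_ge 16 m with h16 | h16
    · exact ⟨h16.le, fun h => absurd h h16.ne'⟩
    rcases isVertexDecomposable_of_isShellable hm h16 hT hs with
      h | ⟨rfl, rfl | rfl | rfl | rfl⟩
    · exact absurd h hv
    · have e : stepSet 16 137 = {1, 4, 8} := by decide +kernel
      exact ⟨le_rfl, fun _ => ⟨e ▸ SimpleGraph.Iso.refl⟩⟩
    -- Modulo 16 and up to sign, the units 11, 13 and 7 carry 3, 5 and 7, respectively, to 1 and
    -- preserve the steps 4 and 8.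
    · exact ⟨le_rfl, fun _ => ⟨mulIso 11 3 (by decide +kernel) (by decide +kernel)
        (by decide +kernel)⟩⟩
    · exact ⟨le_rfl, fun _ => ⟨mulIso 13 5 (by decide +kernel) (by decide +kernel)
        (by decide +kernel)⟩⟩
    · exact ⟨le_rfl, fun _ => ⟨mulIso 7 7 (by decide +kernel) (by decide +kernel)
        (by decide +kernel)⟩⟩
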